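/- Consider the heat equation on $[0,1]$ with Dirichlet boundary control at $\xi=1$, $$x_t=x_{\xi\xi}\ \text{ in }(0,1)\times(0,\infty),\qquad x(0,t)=0,\quad x(1,t)=u(t),$$ as a boundary control system on the state space $X=L^2([0,1])$ (complex-valued functions) with input space $U=\mathbb{C}$: let $\mathfrak{A}f=f''$ on $D(\mathfrak{A})=\{f\in H^2([0,1]): f(0)=0\}$, $\mathfrak{B}f=f(1)$ on $D(\mathfrak{A})$, and $A=\mathfrak{A}|_{\ker\mathfrak{B}}$, so that $Af=f''$ on $D(A)=\{f\in H^2([0,1]):f(0)=f(1)=0\}$. Notation. For $s\in\rho(A)$ let $X_{-1}$ be the completion of $X$ for the norm $\|(s-A)^{-1}x\|_X$, and let $A_{-1}:X\to X_{-1}$ be the bounded extension of $A$. Let $T$ be the $C_0$-semigroup generated by $A$; its extension to $X_{-1}$ is also denoted by $T$. For $0<\beta<1$ let $X_{-\beta}$ be the completion of $X$ for the norm $\|(-A)^{-\beta}x\|_X$, where $(-A)^{-\beta}=\frac1{2\pi i}\int_\gamma z^{-\beta}(z+A)^{-1}\,dz$ and $\gamma$ is the boundary of a sector $\{z\ne0:|\operatorname{Arg}z|<\varphi\}$,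 $0<\varphi\le\pi/2$, oriented from $\infty e^{i\varphi}$ through $0$ to $\infty e^{-i\varphi}$; the identity of $X$ extends to a continuous injection $X_{-\beta}\to X_{-1}$. An operator $B\in\mathcal{L}(\mathbb{C},X_{-1})$ is called finite-time $p$-admissible ($1\le p\le\infty$) if for every $t\ge0$ there is $C>0$ such that, for all $u\in L^p([0,t])$, the integral $\int_0^tT(t-s)Bu(s)\,ds$, formed in $X_{-1}$, lies in $X$ and has $X$-norm at most $C\|u\|_{L^p([0,t])}$; it is called infinite-time $p$-admissible if $C$ can be chosen independently of $t$. Then the following hold. 1. $(\mathfrak{A},\mathfrak{B})$ is a boundary control system: $\mathfrak{A}$ is closed, $\mathfrak{B}$ is bounded for the graph norm of $\mathfrak{A}$ and has a right inverse $B_0$ that is bounded from $\mathbb{C}$ to $D(\mathfrak{A})$ with the graph norm, and $A$ generates a $C_0$-semigroup $T$ on $X$. The functions $e_n(\xi)=\sqrt2\sin(n\pi\xi)$, $n\ge1$, form an orthonormal basis of $X$ with $Ae_n=\lambda_ne_n$, $\lambda_n=-n^2\pi^2$; and $0\in\rho(A)$. 2. For every $s\in\rho(A)$ the control operator $B=(\mathfrak{A}-A_{-1})B_0\in\mathcal{L}(\mathbb{C},X_{-1})$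 exists and is uniquely determined. It is $B=\delta_1'$, i.e. $\langle Bz,y\rangle=z\,\overline{(-y'(1))}$ for $z\in\mathbb{C}$ and $y\in D(A)=D(A^*)$, where $\langle\cdot,\cdot\rangle$ extends the inner product of $X$ to $X_{-1}\times D(A^*)$. It is represented by the sequence $b_n=(-1)^{n+1}\sqrt2\,n\pi$: $B1=\sum_{n\ge1}b_ne_n$ in $X_{-1}$. 3. For every $\beta\in(3/4,1)$, $B$ lies in $X_{-\beta}$, i.e. $B\in\mathcal{L}(\mathbb{C},X_{-\beta})$. 4. $B$ is finite-time and infinite-time $p$-admissible for every $p\in(4,\infty]$. 5. $B$ is neither finite-time nor infinite-time $p$-admissible for any $p\in[1,4]$. -/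

import Mathlib

open MeasureTheory Set Filter Topology
open scoped ENNReal ContDiff

noncomputable section

/-! ### Strongly continuous semigroups, resolvents, extrapolation spaces -/

section Abstract

variable {X : Type*} [NormedAddCommGroup X] [NormedSpace ℂ X]
variable {U : Type*} [NormedAddCommGroup U] [NormedSpace ℂ U]

/-- `T` is a strongly continuous semigroup of bounded operators
(the values at negative times are irrelevant). -/
structure IsC0Semigroup (T : ℝ → X →L[ℂ] X) : Prop where
  map_zero : T 0 = ContinuousLinearMap.id ℂ X
  map_add : ∀ s t : ℝ, 0 ≤ s → 0 ≤ t → T (s + t) = (T s).comp (T t)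
  continuousOn : ∀ x : X, ContinuousOn (fun t => T t x) (Ici 0)

/-- `A` is the generator of `T`: `x ∈ D(A)` and `A x = y` if and only if
`(T(h) x - x) / h → y` as `h → 0+`. -/
def Generates (A : X →ₗ.[ℂ] X) (T : ℝ → X →L[ℂ] X) : Prop :=
  ∀ x y : X, (x, y) ∈ A.graph ↔
    Tendsto (fun h : ℝ => ((h : ℂ)⁻¹) • (T h x - x)) (𝓝[>] 0) (𝓝 y)

/-- `R` is a bounded two-sided inverse of `z I - A : D(A) → X`. -/
def IsResolventAt (A : X →ₗ.[ℂ] X) (z : ℂ) (R : X →L[ℂ] X) : Prop :=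
  (∀ x : X, ∃ h : R x ∈ A.domain, z • R x - A ⟨R x, h⟩ = x) ∧
    ∀ x : A.domain, R (z • (x : X) - A x) = x

/-- The resolvent set `ρ(A)` of an unbounded operator. -/
def unboundedResolventSet (A : X →ₗ.[ℂ] X) : Set ℂ :=
  {z | ∃ R : X →L[ℂ] X, IsResolventAt A z R}

open Classical in
/-- The resolvent `R(z, A) = (z I - A)⁻¹` for `z ∈ ρ(A)` (and `0` for other `z`). -/
def resolventOp (A : X →ₗ.[ℂ] X) (z : ℂ) : X →L[ℂ] X :=
  if h : ∃ R : X →L[ℂ] X, IsResolventAt A z R then h.choose else 0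

/-- The vector space `X` with the norm `x ↦ ‖J x‖`, for a bounded (injective) operator `J`. -/
def Renormed (_J : X →L[ℂ] X) : Type _ := X

instance (J : X →L[ℂ] X) : AddCommGroup (Renormed J) := inferInstanceAs (AddCommGroup X)

instance (J : X →L[ℂ] X) : Module ℂ (Renormed J) := inferInstanceAs (Module ℂ X)

/-- `J`, seen as a linear map on the renormed space. -/
def Renormed.toOriginal (J : X →L[ℂ] X) : Renormed J →ₗ[ℂ] X := J.toLinearMap

instance (J : X →L[ℂ] X) : SeminormedAddCommGroup (Renormed J) :=
  SeminormedAddCommGroup.induced (Renormed J) X (Renormed.toOriginal J)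

instance (J : X →L[ℂ] X) : NormedSpace ℂ (Renormed J) :=
  NormedSpace.induced ℂ (Renormed J) X (Renormed.toOriginal J)

/-- The completion of `X` with respect to the norm `x ↦ ‖J x‖`. -/
abbrev ExtrapSpace (J : X →L[ℂ] X) : Type _ := UniformSpace.Completion (Renormed J)

/-- The canonical map of `X` into its completion with respect to `x ↦ ‖J x‖`. -/
def extrapEmbed (J : X →L[ℂ] X) : X →ₗ[ℂ] ExtrapSpace J :=
  (UniformSpace.Completion.toComplL (𝕜 := ℂ) (E := Renormed J)).toLinearMap

/-- A bounded operator `S` on `X`, seen as a linear map of the renormed space. -/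
def Renormed.mapOp (J S : X →L[ℂ] X) : Renormed J →ₗ[ℂ] Renormed J := S.toLinearMap

/-- The extension by continuity of a bounded operator `S` on `X` to the completion of `X` with
respect to `x ↦ ‖J x‖` (used for operators `S` commuting with `J`, so that `S` is bounded for
that norm). -/
def extrapExtend (J S : X →L[ℂ] X) : ExtrapSpace J → ExtrapSpace J :=
  UniformSpace.Completion.map (Renormed.mapOp J S)

/-- The fractional power `(-A)^(-β)`, `0 < β < 1`: the operator-valued contour integral
`(2πi)⁻¹ ∫_γ z^(-β) R(z, -A) dz`, where `γ` is the boundary of the sector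
`{z ≠ 0 : |Arg z| < φ}`, which runs from `∞ e^(iφ)` to `0` and from `0` to `∞ e^(-iφ)`. -/
def negFracPow (A : X →ₗ.[ℂ] X) (φ β : ℝ) : X →L[ℂ] X :=
  let z : ℝ → ℝ → ℂ := fun θ r => (r : ℂ) * Complex.exp (θ * Complex.I)
  let leg : ℝ → X →L[ℂ] X := fun θ =>
    ∫ r in Ioi (0 : ℝ), (z θ r ^ (-(β : ℂ)) * Complex.exp (θ * Complex.I)) •
      resolventOp (-A) (z θ r)
  (2 * Real.pi * Complex.I)⁻¹ • (leg (-φ) - leg φ)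

/-- For `R = R(s, A)` and `J = (-A)^(-β)`, so that `ExtrapSpace R` is `X₋₁` and `ExtrapSpace J` is
`X_{-β}`: the space `X_{-β}` is continuously embedded in `X₋₁` by the extension of the identity of
`X`, and the operator `B` from `U` to `X₋₁` is a bounded operator from `U` to `X_{-β}`. -/
def MapsIntoExtrap (R J : X →L[ℂ] X) (B : U →L[ℂ] ExtrapSpace R) : Prop :=
  ∃ ι : ExtrapSpace J →L[ℂ] ExtrapSpace R,
    (∀ x : X, ι (extrapEmbed J x) = extrapEmbed R x) ∧ Function.Injective ι ∧
      ∃ B' : U →L[ℂ] ExtrapSpace J, ∀ u : U, ι (B' u) = B u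

/-! ### Admissible control operators

Here `R = R(s, A)` for a point `s ∈ ρ(A)`, so that `ExtrapSpace R` is `X₋₁` and
`extrapExtend R (T t)` is the extension of `T t` to `X₋₁`. -/

/-- The integral `∫_0^t T(t-s) B u(s) ds` in `X₋₁` is an element of `X`, of norm at most
`C ‖u‖_{L^p([0,t],U)}`, for every input function `u ∈ L^p([0,t],U)`. -/
def AdmissibleAt (T : ℝ → X →L[ℂ] X) (R : X →L[ℂ] X) (B : U →L[ℂ] ExtrapSpace R)
    (p : ℝ≥0∞) (t C : ℝ) : Prop :=
  ∀ u : ℝ → U, MemLp u p (volume.restrict (Icc 0 t)) →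
    ∃ x : X, extrapEmbed R x = ∫ s in Icc 0 t, extrapExtend R (T (t - s)) (B (u s)) ∧
      ‖x‖ ≤ C * (eLpNorm u p (volume.restrict (Icc 0 t))).toReal

/-- Finite-time `L^p`-admissibility. -/
def FiniteTimeAdmissible (T : ℝ → X →L[ℂ] X) (R : X →L[ℂ] X) (B : U →L[ℂ] ExtrapSpace R)
    (p : ℝ≥0∞) : Prop :=
  ∀ t : ℝ, 0 ≤ t → ∃ C : ℝ, 0 < C ∧ AdmissibleAt T R B p t C

/-- Infinite-time `L^p`-admissibility. -/
def InfiniteTimeAdmissible (T : ℝ → X →L[ℂ] X) (R : X →L[ℂ] X) (B : U →L[ℂ] ExtrapSpace R)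
    (p : ℝ≥0∞) : Prop :=
  ∃ C : ℝ, 0 < C ∧ ∀ t : ℝ, 0 ≤ t → AdmissibleAt T R B p t C

/-! ### Boundary control systems -/

/-- The restriction of `𝔄` to the kernel of `𝔅`. -/
def mainOperator (𝔄 : X →ₗ.[ℂ] X) (𝔅 : X →ₗ.[ℂ] U) : X →ₗ.[ℂ] X :=
  𝔄.domRestrict ((LinearMap.ker 𝔅.toFun).map 𝔅.domain.subtype)

/-- `B₀` is a bounded right inverse of `𝔅`, from `U` to `D(𝔄)` with the graph norm. The space
`D(𝔄)` with the graph norm is the graph of `𝔄`: `(B₀ u).1.1` is the element of `D(𝔄)`, and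
`(B₀ u).1.2` is its image under `𝔄`. -/
def IsRightInverse (𝔄 : X →ₗ.[ℂ] X) (𝔅 : X →ₗ.[ℂ] U) (B₀ : U →L[ℂ] 𝔄.graph) : Prop :=
  ∀ u : U, ((B₀ u).1.1, u) ∈ 𝔅.graph

/-- `(𝔄, 𝔅)` is a boundary control system: `𝔄` is closed, `𝔅` is defined on `D(𝔄)` and is bounded
for the graph norm of `𝔄`, the restriction of `𝔄` to `ker 𝔅` generates a strongly continuous
semigroup, and `𝔅` has a bounded right inverse. -/
structure IsBoundaryControlSystem (𝔄 : X →ₗ.[ℂ] X) (𝔅 : X →ₗ.[ℂ] U) : Prop where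
  closed : 𝔄.IsClosed
  domain_eq : 𝔅.domain = 𝔄.domain
  bounded : ∃ K : ℝ, ∀ (x y : X) (u : U), (x, y) ∈ 𝔄.graph → (x, u) ∈ 𝔅.graph →
    ‖u‖ ≤ K * (‖x‖ + ‖y‖)
  generator : ∃ T : ℝ → X →L[ℂ] X, IsC0Semigroup T ∧ Generates (mainOperator 𝔄 𝔅) T
  rightInverse : ∃ B₀ : U →L[ℂ] 𝔄.graph, IsRightInverse 𝔄 𝔅 B₀

/-- `B = (𝔄 - A₋₁) B₀`, where `B₀` is a bounded right inverse of `𝔅` and `A₋₁ : X → X₋₁` is the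
bounded extension of `A = 𝔄|ker 𝔅`; the space `X₋₁` is formed with `R = R(s, A)`. -/
def IsControlOperator (𝔄 : X →ₗ.[ℂ] X) (𝔅 : X →ₗ.[ℂ] U) (R : X →L[ℂ] X)
    (B : U →L[ℂ] ExtrapSpace R) : Prop :=
  ∃ (A₁ : X →L[ℂ] ExtrapSpace R) (B₀ : U →L[ℂ] 𝔄.graph),
    (∀ x y : X, (x, y) ∈ (mainOperator 𝔄 𝔅).graph → A₁ x = extrapEmbed R y) ∧
      IsRightInverse 𝔄 𝔅 B₀ ∧
        ∀ u : U, B u = extrapEmbed R (B₀ u).1.2 - A₁ (B₀ u).1.1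

end Abstract

/-! ### The heat equation on `[0,1]` -/

/-- The state space `L²([0,1])`. -/
abbrev HeatState : Type := Lp ℂ 2 (volume.restrict (Icc (0 : ℝ) 1))

/-- `g ∈ L²` is the weak derivative of `f ∈ L²` on `(0,1)`. -/
def HasWeakDeriv (f g : HeatState) : Prop :=
  ∀ φ : ℝ → ℝ, ContDiff ℝ ∞ φ → HasCompactSupport φ → tsupport φ ⊆ Ioo 0 1 →
    ∫ ξ in Icc (0 : ℝ) 1, deriv φ ξ • f ξ = -∫ ξ in Icc (0 : ℝ) 1, φ ξ • g ξ

/-- The continuous representative of `f` on `[0,1]` has the value `c` at `a ∈ [0,1]`. -/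
def HasPointValue (f : HeatState) (a : ℝ) (c : ℂ) : Prop :=
  ∃ F : ℝ → ℂ, ContinuousOn F (Icc 0 1) ∧ f =ᵐ[volume.restrict (Icc (0 : ℝ) 1)] F ∧ F a = c

theorem HeatState.integrable_smul (f : HeatState) {φ : ℝ → ℝ} (hφ : Continuous φ)
    (hc : HasCompactSupport φ) :
    Integrable (fun ξ => φ ξ • f ξ) (volume.restrict (Icc (0 : ℝ) 1)) := by
  obtain ⟨C, hC⟩ := hc.exists_bound_of_continuous hφ
  exact ((Lp.memLp f).integrable one_le_two).bdd_smul C hφ.aestronglyMeasurable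
    (Eventually.of_forall hC)

theorem HasWeakDeriv.add {f g f' g' : HeatState} (h : HasWeakDeriv f g)
    (h' : HasWeakDeriv f' g') : HasWeakDeriv (f + f') (g + g') := by
  intro φ h1 h2 h3
  have e : ∀ (ψ : ℝ → ℝ) (_ : Continuous ψ) (_ : HasCompactSupport ψ) (a b : HeatState),
      ∫ ξ in Icc (0 : ℝ) 1, ψ ξ • (a + b : HeatState) ξ =
        (∫ ξ in Icc (0 : ℝ) 1, ψ ξ • a ξ) + ∫ ξ in Icc (0 : ℝ) 1, ψ ξ • b ξ := by
    intro ψ c1 c2 a b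
    rw [← integral_add (a.integrable_smul c1 c2) (b.integrable_smul c1 c2)]
    refine integral_congr_ae ?_
    filter_upwards [Lp.coeFn_add a b] with ξ hξ
    rw [hξ, Pi.add_apply, smul_add]
  rw [e _ (h1.continuous_deriv (by simp)) h2.deriv, e _ h1.continuous h2, h φ h1 h2 h3,
    h' φ h1 h2 h3, neg_add]

theorem HasWeakDeriv.smul {f g : HeatState} (c : ℂ) (h : HasWeakDeriv f g) :
    HasWeakDeriv (c • f) (c • g) := by
  intro φ h1 h2 h3
  have e : ∀ (ψ : ℝ → ℝ) (a : HeatState),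
      ∫ ξ in Icc (0 : ℝ) 1, ψ ξ • (c • a : HeatState) ξ =
        c • ∫ ξ in Icc (0 : ℝ) 1, ψ ξ • a ξ := by
    intro ψ a
    rw [← integral_smul]
    refine integral_congr_ae ?_
    filter_upwards [Lp.coeFn_smul c a] with ξ hξ
    rw [hξ, Pi.smul_apply, smul_comm]
  rw [e, e, h φ h1 h2 h3, smul_neg]

theorem HasWeakDeriv.zero : HasWeakDeriv 0 0 := by
  have h : ∀ ψ : ℝ → ℝ, ∫ ξ in Icc (0 : ℝ) 1, ψ ξ • (0 : HeatState) ξ = 0 := by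
    intro ψ
    refine integral_eq_zero_of_ae ?_
    filter_upwards [Lp.coeFn_zero ℂ 2 (volume.restrict (Icc (0 : ℝ) 1))] with ξ hξ
    rw [hξ, Pi.zero_apply, smul_zero]
  intro φ _ _ _
  rw [h, h, neg_zero]

theorem HasPointValue.add {f f' : HeatState} {a : ℝ} {c c' : ℂ} (h : HasPointValue f a c)
    (h' : HasPointValue f' a c') : HasPointValue (f + f') a (c + c') := by
  obtain ⟨F, h1, h2, h3⟩ := h
  obtain ⟨F', h1', h2', h3'⟩ := h'
  exact ⟨F + F', h1.add h1', (Lp.coeFn_add f f').trans (h2.add h2'), by simp [h3, h3']⟩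

theorem HasPointValue.smul {f : HeatState} {a : ℝ} {c : ℂ} (k : ℂ) (h : HasPointValue f a c) :
    HasPointValue (k • f) a (k • c) := by
  obtain ⟨F, h1, h2, h3⟩ := h
  exact ⟨k • F, h1.const_smul k, (Lp.coeFn_smul k f).trans (h2.const_smul k), by simp [h3]⟩

theorem HasPointValue.zero (a : ℝ) : HasPointValue 0 a 0 :=
  ⟨0, continuousOn_const, Lp.coeFn_zero _ _ _, rfl⟩

/-- The graph of `𝔄`: the pairs `(f, f'')` with `f ∈ H²([0,1])` and `f(0) = 0`. -/
def heatMaxGraph : Submodule ℂ (HeatState × HeatState) where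
  carrier := {q | (∃ g : HeatState, HasWeakDeriv q.1 g ∧ HasWeakDeriv g q.2) ∧
    HasPointValue q.1 0 0}
  zero_mem' := ⟨⟨0, HasWeakDeriv.zero, HasWeakDeriv.zero⟩, HasPointValue.zero 0⟩
  add_mem' := by
    rintro q q' ⟨⟨g, h1, h2⟩, h3⟩ ⟨⟨g', h1', h2'⟩, h3'⟩
    exact ⟨⟨g + g', h1.add h1', h2.add h2'⟩, by simpa using h3.add h3'⟩
  smul_mem' := by
    rintro c q ⟨⟨g, h1, h2⟩, h3⟩
    exact ⟨⟨c • g, h1.smul c, h2.smul c⟩, by simpa using h3.smul c⟩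

/-- The operator `𝔄 f = f''` with domain `{f ∈ H²([0,1]) : f(0) = 0}`. -/
def heatMax : HeatState →ₗ.[ℂ] HeatState := heatMaxGraph.toLinearPMap

/-- The graph of `𝔅`: the pairs `(f, f(1))` with `f ∈ D(𝔄)`. -/
def heatTraceGraph : Submodule ℂ (HeatState × ℂ) where
  carrier := {q | q.1 ∈ heatMax.domain ∧ HasPointValue q.1 1 q.2}
  zero_mem' := ⟨heatMax.domain.zero_mem, HasPointValue.zero 1⟩
  add_mem' := by
    rintro q q' ⟨h1, h2⟩ ⟨h1', h2'⟩
    exact ⟨heatMax.domain.add_mem h1 h1', h2.add h2'⟩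
  smul_mem' := by
    rintro c q ⟨h1, h2⟩
    exact ⟨heatMax.domain.smul_mem c h1, h2.smul c⟩

/-- The boundary operator `𝔅 f = f(1)` on `D(𝔄)`. -/
def heatTrace : HeatState →ₗ.[ℂ] ℂ := heatTraceGraph.toLinearPMap

theorem HasWeakDeriv.eq_zero {g : HeatState} (h : HasWeakDeriv 0 g) : g = 0 := by
  have h0 : ∀ ψ : ℝ → ℝ, ∫ ξ in Icc (0 : ℝ) 1, ψ ξ • (0 : HeatState) ξ = 0 := by
    intro ψ
    refine integral_eq_zero_of_ae ?_
    filter_upwards [Lp.coeFn_zero ℂ 2 (volume.restrict (Icc (0 : ℝ) 1))] with ξ hξ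
    rw [hξ, Pi.zero_apply, smul_zero]
  have hint : IntegrableOn g (Icc (0 : ℝ) 1) := (Lp.memLp g).integrable one_le_two
  have key := isOpen_Ioo.ae_eq_zero_of_integral_contDiff_smul_eq_zero (μ := volume)
    (U := Ioo (0 : ℝ) 1) (f := g) (hint.mono_set Ioo_subset_Icc_self).locallyIntegrableOn ?_
  · refine Lp.ext ?_
    refine EventuallyEq.trans ?_ (Lp.coeFn_zero ℂ 2 (volume.restrict (Icc (0 : ℝ) 1))).symm
    have h4 : ∀ᵐ ξ ∂(volume.restrict (Ioo (0 : ℝ) 1)), g ξ = 0 :=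
      (ae_restrict_iff' measurableSet_Ioo).2 key
    have h5 : volume.restrict (Icc (0 : ℝ) 1) = volume.restrict (Ioo (0 : ℝ) 1) :=
      (Measure.restrict_congr_set Ioo_ae_eq_Icc).symm
    exact h5.le.absolutelyContinuous.ae_le h4
  · intro φ h1 h2 h3
    have := h φ h1 h2 h3
    rw [h0, eq_comm, neg_eq_zero] at this
    rwa [setIntegral_eq_integral_of_forall_compl_eq_zero] at this
    intro ξ hξ
    rw [image_eq_zero_of_notMem_tsupport (fun hh => hξ (Ioo_subset_Icc_self (h3 hh))), zero_smul]

/-- The relation defining `𝔄` is single-valued. -/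
theorem heatMaxGraph_single (q : HeatState × HeatState) (hq : q ∈ heatMaxGraph)
    (h : q.1 = 0) : q.2 = 0 := by
  obtain ⟨⟨g, h1, h2⟩, -⟩ := hq
  rw [h] at h1
  rw [h1.eq_zero] at h2
  exact h2.eq_zero

/-- The relation defining `𝔅` is single-valued. -/
theorem heatTraceGraph_single (q : HeatState × ℂ) (hq : q ∈ heatTraceGraph)
    (h : q.1 = 0) : q.2 = 0 := by
  obtain ⟨-, F, h1, h2, h3⟩ := hq
  rw [h] at h2
  have h4 : F =ᵐ[volume.restrict (Icc (0 : ℝ) 1)] fun _ => (0 : ℂ) :=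
    h2.symm.trans (Lp.coeFn_zero _ _ _)
  rw [← h3]
  exact Measure.eqOn_Icc_of_ae_eq volume (zero_ne_one) h4 h1 continuousOn_const
    (right_mem_Icc.2 zero_le_one)

/-- The Dirichlet Laplacian `A = 𝔄|ker 𝔅`. -/
def dirichletLaplacian : HeatState →ₗ.[ℂ] HeatState := mainOperator heatMax heatTrace

theorem memLp_dirichletMode (n : ℕ+) :
    MemLp (fun ξ : ℝ => ((Real.sqrt 2 * Real.sin (n * Real.pi * ξ) : ℝ) : ℂ)) 2
      (volume.restrict (Icc (0 : ℝ) 1)) := by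
  refine MemLp.of_bound (Continuous.aestronglyMeasurable (by fun_prop)) (Real.sqrt 2)
    (Eventually.of_forall fun ξ => ?_)
  rw [Complex.norm_real, norm_mul, Real.norm_of_nonneg (Real.sqrt_nonneg 2)]
  exact mul_le_of_le_one_right (Real.sqrt_nonneg 2) (Real.abs_sin_le_one _)

/-- `e_n(ξ) = √2 sin(nπξ)`, `n ≥ 1`. -/
def dirichletMode (n : ℕ+) : HeatState := (memLp_dirichletMode n).toLp _

/-- `λ_n = -n²π²`. -/
def dirichletEigenvalue (n : ℕ+) : ℝ := -((n : ℝ) ^ 2 * Real.pi ^ 2)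

/-- `b_n = (-1)^(n+1) √2 n π`. -/
def dirichletCoeff (n : ℕ+) : ℝ := (-1) ^ ((n : ℕ) + 1) * (Real.sqrt 2 * n * Real.pi)

/-- `B z = z δ'_1` with `δ'_1(y) = -y'(1)`: in the duality of `X₋₁` with `D(A*) = D(A)` that extends
the inner product of `L²([0,1])`, the operator `B` satisfies `⟨B z, y⟩ = z · conj (-y'(1))` for
every `y ∈ D(A)`. Here `ℓ` is the continuous extension of `x ↦ ⟨x, y⟩` to `X₋₁`. -/
def IsDeltaPrimeOne (R : HeatState →L[ℂ] HeatState) (B : ℂ →L[ℂ] ExtrapSpace R) : Prop :=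
  ∀ y ∈ dirichletLaplacian.domain, ∃ (y' : HeatState) (c : ℂ) (ℓ : ExtrapSpace R →L[ℂ] ℂ),
    HasWeakDeriv y y' ∧ HasPointValue y' 1 c ∧
      (∀ x : HeatState, ℓ (extrapEmbed R x) = inner ℂ y x) ∧
        ∀ z : ℂ, ℓ (B z) = z * (starRingEnd ℂ) (-c)

end

noncomputable section

/-! ### Primitives and weak derivatives on the unit interval -/

/-! Everything is diagonalised in the sine basis. Integrating `f'' = h` twice with the Volterra
operator `V` shows that `(f, h)` lies in the graph of `𝔄` exactly when `f = c · id + V² h`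
(`mem_heatMax_graph`). The condition `f(1) = 0` fixes `c`, so the Dirichlet Laplacian is the inverse
of the bounded operator `green`, which multiplies `e_n` by `λ_n⁻¹`. Since the sines are complete
(Stone–Weierstrass in the variable `cos πξ`), `A` is a diagonal operator with maximal domain. Its
resolvents, its semigroup and its fractional powers are then diagonal with multipliers `(s -
λ_n)⁻¹`, `e^(λ_n t)` and, up to one nonzero constant, `(-λ_n)^(-β)`.

For `J` with dense range, the completion of `X` for `‖J x‖` is isometric to `X` through the
extension of `J` (`extrapEquiv`), and the extension of an operator commuting with `J` becomes that
operator itself. For `J = R(s, A)`, the lift `u ↦ u · id` turns the control operator into the vector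
`id - s R id`. The sine coefficients of `id` are `-b_n / λ_n`, so this vector has coordinates `b_n /
(s - λ_n)`. The remaining claims concern sequences.

Membership in `X_{-β}` asks that `b_n (-λ_n)^(-β)` be square summable; the squares are of order
`n^(2 - 4β)`, which is summable for `β > 3/4`. The state reached at time `t` has coordinates `b_n ∫
e^(λ_n (t - τ)) u(τ) dτ`. Hölder bounds the integral by `|λ_n|^(-1/q) ‖u‖_p` uniformly in `t`, and
the sum of `n^(2 - 4/q)` converges because `p > 4` gives `q < 4/3`.

For `p ≤ 4` the input is `(1 - τ)^(-1/4)` cut off at distance `ε = 1/(4M²)` from the final time. Its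
`L^p` norm is at most `(log 1/ε)^(1/4)`. Each mode `n ≤ M` sees it at distance about `n⁻²` and
contributes at least a constant times `1/n` to `‖x‖²`. Thus `‖x‖²` grows like `log M`, while
admissibility would allow only `(log M)^(1/2)` (`not_finiteTimeAdmissible_controlOperator`). -/

instance isProbabilityMeasure_unitInterval :
    IsProbabilityMeasure (volume.restrict (Icc (0 : ℝ) 1)) :=
  ⟨by simp⟩

namespace HeatState

theorem integrable (h : HeatState) : Integrable h (volume.restrict (Icc (0 : ℝ) 1)) :=
  (Lp.memLp h).integrable one_le_two

theorem integrable_indicator (h : HeatState) : Integrable ((Icc (0 : ℝ) 1).indicator h) :=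
  (integrable_indicator_iff measurableSet_Icc).2 h.integrable

/-- The primitive `ξ ↦ ∫_0^ξ h`. -/
def prim (h : HeatState) (ξ : ℝ) : ℂ := ∫ η in (0 : ℝ)..ξ, (Icc (0 : ℝ) 1).indicator h η

/-- Extending `h` by zero makes it integrable on the whole line, so the primitive is globally
continuous and defines a class through `ofContinuous`. -/
theorem continuous_prim (h : HeatState) : Continuous h.prim :=
  intervalIntegral.continuous_primitive
    (fun _ _ => h.integrable_indicator.intervalIntegrable) 0

@[simp] theorem prim_apply_zero (h : HeatState) : h.prim 0 = 0 := by simp [prim]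

theorem indicator_ae_eq {h : HeatState} {F : ℝ → ℂ} (hF : h =ᵐ[volume.restrict (Icc (0 : ℝ) 1)] F) :
    (Icc (0 : ℝ) 1).indicator h =ᵐ[volume] (Icc (0 : ℝ) 1).indicator F := by
  filter_upwards [(ae_restrict_iff' measurableSet_Icc).1 hF] with ξ hξ
  by_cases h1 : ξ ∈ Icc (0 : ℝ) 1
  · rw [indicator_of_mem h1, indicator_of_mem h1, hξ h1]
  · rw [indicator_of_notMem h1, indicator_of_notMem h1]

theorem prim_eq_of_ae_eq {h : HeatState} {F : ℝ → ℂ}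
    (hF : h =ᵐ[volume.restrict (Icc (0 : ℝ) 1)] F) {ξ : ℝ} (hξ : ξ ∈ Icc (0 : ℝ) 1) :
    h.prim ξ = ∫ η in (0 : ℝ)..ξ, F η := by
  unfold prim
  rw [intervalIntegral.integral_congr_ae (g := (Icc (0 : ℝ) 1).indicator F)]
  · refine intervalIntegral.integral_congr fun η hη => ?_
    rw [uIcc_of_le hξ.1] at hη
    have h1 : η ∈ Icc (0 : ℝ) 1 := ⟨hη.1, hη.2.trans hξ.2⟩
    rw [indicator_of_mem h1]
  · filter_upwards [indicator_ae_eq hF] with η hη _ using hη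

theorem prim_add (h k : HeatState) (ξ : ℝ) : (h + k).prim ξ = h.prim ξ + k.prim ξ := by
  unfold prim
  rw [← intervalIntegral.integral_add h.integrable_indicator.intervalIntegrable
    k.integrable_indicator.intervalIntegrable]
  refine intervalIntegral.integral_congr_ae ?_
  filter_upwards [indicator_ae_eq (Lp.coeFn_add h k)] with η hη _
  rw [hη, indicator_add']
  rfl

theorem prim_smul (c : ℂ) (h : HeatState) (ξ : ℝ) : (c • h).prim ξ = c * h.prim ξ := by
  unfold prim
  rw [← intervalIntegral.integral_const_mul]
  refine intervalIntegral.integral_congr_ae ?_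
  filter_upwards [indicator_ae_eq (Lp.coeFn_smul c h)] with η hη _
  rw [hη]
  by_cases h1 : η ∈ Icc (0 : ℝ) 1 <;> simp [h1]

theorem integral_norm_le (h : HeatState) : ∫ ξ in Icc (0 : ℝ) 1, ‖h ξ‖ ≤ ‖h‖ := by
  rw [integral_norm_eq_lintegral_enorm h.integrable.aestronglyMeasurable, Lp.norm_def,
    ← eLpNorm_one_eq_lintegral_enorm]
  exact ENNReal.toReal_mono (Lp.eLpNorm_ne_top h)
    (eLpNorm_le_eLpNorm_of_exponent_le one_le_two h.integrable.aestronglyMeasurable)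

theorem norm_prim_le (h : HeatState) (ξ : ℝ) : ‖h.prim ξ‖ ≤ ‖h‖ := by
  refine le_trans ?_ h.integral_norm_le
  unfold prim
  rw [← integral_indicator measurableSet_Icc]
  refine intervalIntegral.norm_integral_le_integral_norm_uIoc.trans ?_
  refine (setIntegral_le_integral h.integrable_indicator.norm
    (Eventually.of_forall fun _ => norm_nonneg _)).trans ?_
  refine le_of_eq (integral_congr_ae (Eventually.of_forall fun η => ?_))
  exact norm_indicator_eq_indicator_norm _ _

/-- The class in `L²([0,1])` of a continuous function. -/
def ofContinuous (F : ℝ → ℂ) (hF : Continuous F) : HeatState :=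
  MemLp.toLp F (by
    obtain ⟨C, hC⟩ := isCompact_Icc.exists_bound_of_continuousOn
      (hF.continuousOn (s := Icc (0 : ℝ) 1))
    refine MemLp.of_bound hF.aestronglyMeasurable C ?_
    filter_upwards [ae_restrict_mem measurableSet_Icc] with ξ hξ using hC ξ hξ)

theorem coeFn_ofContinuous (F : ℝ → ℂ) (hF : Continuous F) :
    ofContinuous F hF =ᵐ[volume.restrict (Icc (0 : ℝ) 1)] F :=
  MemLp.coeFn_toLp _

theorem eq_ofContinuous {h : HeatState} {F : ℝ → ℂ} (hF : Continuous F)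
    (hh : h =ᵐ[volume.restrict (Icc (0 : ℝ) 1)] F) : h = ofContinuous F hF :=
  Lp.ext (hh.trans (coeFn_ofContinuous F hF).symm)

theorem ofContinuous_congr {F K : ℝ → ℂ} (hF : Continuous F) (hK : Continuous K)
    (h : ∀ ξ ∈ Icc (0 : ℝ) 1, F ξ = K ξ) : ofContinuous F hF = ofContinuous K hK := by
  refine eq_ofContinuous hK ((coeFn_ofContinuous F hF).trans ?_)
  filter_upwards [ae_restrict_mem measurableSet_Icc] with ξ hξ using h ξ hξ

theorem ofContinuous_add {F K : ℝ → ℂ} (hF : Continuous F) (hK : Continuous K) :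
    ofContinuous F hF + ofContinuous K hK = ofContinuous (fun ξ => F ξ + K ξ) (hF.add hK) :=
  eq_ofContinuous _ ((Lp.coeFn_add _ _).trans
    ((coeFn_ofContinuous F hF).add (coeFn_ofContinuous K hK)))

theorem ofContinuous_smul (c : ℂ) {F : ℝ → ℂ} (hF : Continuous F) :
    c • ofContinuous F hF = ofContinuous (fun ξ => c * F ξ) (continuous_const.mul hF) :=
  eq_ofContinuous _ ((Lp.coeFn_smul _ _).trans ((coeFn_ofContinuous F hF).const_smul c))

theorem norm_ofContinuous_le {F : ℝ → ℂ} (hF : Continuous F) {C : ℝ} (hC : 0 ≤ C)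
    (h : ∀ ξ, ‖F ξ‖ ≤ C) : ‖ofContinuous F hF‖ ≤ C := by
  have := Lp.norm_le_of_ae_bound (f := ofContinuous F hF) hC (by
    filter_upwards [coeFn_ofContinuous F hF] with ξ hξ
    rw [hξ]; exact h ξ)
  simpa [measureUnivNNReal] using this

theorem hasPointValue_ofContinuous {F : ℝ → ℂ} (hF : Continuous F) (a : ℝ) :
    HasPointValue (ofContinuous F hF) a (F a) :=
  ⟨F, hF.continuousOn, coeFn_ofContinuous F hF, rfl⟩

theorem prim_ofContinuous {F Φ : ℝ → ℂ} (hF : Continuous F) (hΦ : ∀ ξ, HasDerivAt Φ (F ξ) ξ)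
    {ξ : ℝ} (hξ : ξ ∈ Icc (0 : ℝ) 1) : (ofContinuous F hF).prim ξ = Φ ξ - Φ 0 := by
  rw [prim_eq_of_ae_eq (coeFn_ofContinuous F hF) hξ]
  exact intervalIntegral.integral_eq_sub_of_hasDerivAt (fun x _ => hΦ x)
    (hF.intervalIntegrable _ _)

/-- The Volterra operator `(V h)(ξ) = ∫_0^ξ h`. -/
def volterra : HeatState →L[ℂ] HeatState :=
  LinearMap.mkContinuous
    { toFun := fun h => ofContinuous h.prim h.continuous_prim
      map_add' := fun h k => by
        rw [ofContinuous_add]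
        exact ofContinuous_congr _ _ fun ξ _ => prim_add h k ξ
      map_smul' := fun c h => by
        rw [RingHom.id_apply, ofContinuous_smul]
        exact ofContinuous_congr _ _ fun ξ _ => prim_smul c h ξ }
    1 fun h => by
      rw [one_mul]
      exact norm_ofContinuous_le h.continuous_prim (norm_nonneg _) h.norm_prim_le

theorem volterra_apply (h : HeatState) :
    volterra h = ofContinuous h.prim h.continuous_prim := rfl

theorem coeFn_volterra (h : HeatState) :
    volterra h =ᵐ[volume.restrict (Icc (0 : ℝ) 1)] h.prim :=
  coeFn_ofContinuous _ h.continuous_prim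

/-- The functional `h ↦ ∫_0^1 h`. -/
def total : HeatState →L[ℂ] ℂ :=
  LinearMap.mkContinuous
    { toFun := fun h => h.prim 1
      map_add' := fun h k => prim_add h k 1
      map_smul' := fun c h => prim_smul c h 1 }
    1 fun h => by
      rw [one_mul]
      exact h.norm_prim_le 1

theorem total_apply (h : HeatState) : total h = h.prim 1 := rfl

theorem total_eq_integral (h : HeatState) : total h = ∫ ξ in Icc (0 : ℝ) 1, h ξ := by
  rw [total_apply, prim, intervalIntegral.integral_of_le zero_le_one,
    ← integral_Icc_eq_integral_Ioc]
  exact setIntegral_congr_fun measurableSet_Icc fun ξ hξ => indicator_of_mem hξ _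

end HeatState

/-! ### Integration by parts and functions with zero weak derivative -/

/-- Both `φ` and the primitive of `f` are absolutely continuous, and the latter has derivative `f`
almost everywhere; no continuity of `f` is needed. -/
theorem integral_mul_eq_sub_integral_primitive {f φ : ℝ → ℝ}
    (hf : IntervalIntegrable f volume 0 1) (hφ : ContDiff ℝ 1 φ) :
    ∫ ξ in (0 : ℝ)..1, φ ξ * f ξ =
      φ 1 * (∫ η in (0 : ℝ)..1, f η) - ∫ ξ in (0 : ℝ)..1, deriv φ ξ * ∫ η in (0 : ℝ)..ξ, f η := by
  have h1 : AbsolutelyContinuousOnInterval φ 0 1 :=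
    hφ.contDiffOn.absolutelyContinuousOnInterval
  have h2 := hf.absolutelyContinuousOnInterval_intervalIntegral (c := 0) (by simp)
  have h3 := h1.integral_mul_deriv_eq_deriv_mul h2
  rw [intervalIntegral.integral_same, mul_zero, sub_zero] at h3
  rw [← h3]
  refine intervalIntegral.integral_congr_ae ?_
  filter_upwards [hf.ae_hasDerivAt_integral] with x hx hx1
  rw [(hx (uIoc_subset_uIcc hx1) 0 (by simp)).deriv]

namespace HeatState

/-- Integration by parts against a continuously differentiable function. -/
theorem integral_smul_eq_sub (h : HeatState) {φ : ℝ → ℝ} (hφ : ContDiff ℝ 1 φ) :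
    ∫ ξ in Icc (0 : ℝ) 1, φ ξ • h ξ =
      φ 1 • h.prim 1 - ∫ ξ in Icc (0 : ℝ) 1, deriv φ ξ • h.prim ξ := by
  set k : ℝ → ℂ := (Icc (0 : ℝ) 1).indicator h with hk
  have hki : ∀ a b, IntervalIntegrable k volume a b := fun a b =>
    h.integrable_indicator.intervalIntegrable
  have e1 : ∫ ξ in Icc (0 : ℝ) 1, φ ξ • h ξ = ∫ ξ in (0 : ℝ)..1, φ ξ • k ξ := by
    rw [intervalIntegral.integral_of_le zero_le_one, ← integral_Icc_eq_integral_Ioc]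
    exact setIntegral_congr_fun measurableSet_Icc fun ξ hξ => by
      simp only [hk, indicator_of_mem hξ]
  have e2 : ∫ ξ in Icc (0 : ℝ) 1, deriv φ ξ • h.prim ξ =
      ∫ ξ in (0 : ℝ)..1, deriv φ ξ • h.prim ξ := by
    rw [intervalIntegral.integral_of_le zero_le_one, ← integral_Icc_eq_integral_Ioc]
  rw [e1, e2]
  have i1 : IntervalIntegrable (fun ξ => φ ξ • k ξ) volume 0 1 :=
    (hki 0 1).continuousOn_smul hφ.continuous.continuousOn
  have i2 : IntervalIntegrable (fun ξ => deriv φ ξ • h.prim ξ) volume 0 1 :=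
    (((hφ.continuous_deriv le_rfl).smul h.continuous_prim)).intervalIntegrable _ _
  -- The real formula passes to complex values through real functionals; real and imaginary parts
  -- suffice.
  have key : ∀ L : ℂ →L[ℝ] ℝ, L (∫ ξ in (0 : ℝ)..1, φ ξ • k ξ) =
      L (φ 1 • h.prim 1 - ∫ ξ in (0 : ℝ)..1, deriv φ ξ • h.prim ξ) := by
    intro L
    rw [map_sub, ← L.intervalIntegral_comp_comm i1, ← L.intervalIntegral_comp_comm i2]
    simp only [map_smul, smul_eq_mul]
    have e3 : ∀ ξ, L (h.prim ξ) = ∫ η in (0 : ℝ)..ξ, L (k η) := fun ξ => by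
      rw [L.intervalIntegral_comp_comm (hki 0 ξ)]
      rfl
    simp only [e3]
    exact integral_mul_eq_sub_integral_primitive
      ⟨L.integrable_comp (hki 0 1).1, L.integrable_comp (hki 0 1).2⟩ hφ
  exact Complex.ext (key Complex.reCLM) (key Complex.imCLM)

theorem hasWeakDeriv_volterra (g : HeatState) : HasWeakDeriv (volterra g) g := by
  intro φ h1 h2 h3
  have e : φ 1 = 0 := image_eq_zero_of_notMem_tsupport fun hh => lt_irrefl _ (h3 hh).2
  rw [g.integral_smul_eq_sub (h1.of_le (by simp)), e, zero_smul, zero_sub, neg_neg]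
  refine integral_congr_ae ?_
  filter_upwards [g.coeFn_volterra] with ξ hξ
  rw [hξ]

/-- The constant function `1`. -/
def one : HeatState := ofContinuous (fun _ => 1) continuous_const

/-- The function `ξ ↦ ξ`. -/
def idState : HeatState := ofContinuous (fun ξ => (ξ : ℂ)) Complex.continuous_ofReal

theorem volterra_one : volterra one = idState := by
  rw [volterra_apply]
  refine ofContinuous_congr _ _ fun ξ hξ => ?_
  rw [one, prim_ofContinuous (Φ := fun ξ => (ξ : ℂ)) _
    (fun ξ => by simpa using (hasDerivAt_id ξ).ofReal_comp) hξ]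
  simp

theorem hasWeakDeriv_one : HasWeakDeriv one 0 := by
  intro φ h1 h2 h3
  have e0 : φ 0 = 0 := image_eq_zero_of_notMem_tsupport fun hh => lt_irrefl _ (h3 hh).1
  have e1 : φ 1 = 0 := image_eq_zero_of_notMem_tsupport fun hh => lt_irrefl _ (h3 hh).2
  have h4 : ∫ ξ in Icc (0 : ℝ) 1, φ ξ • (0 : HeatState) ξ = 0 := by
    refine integral_eq_zero_of_ae ?_
    filter_upwards [Lp.coeFn_zero ℂ 2 (volume.restrict (Icc (0 : ℝ) 1))] with ξ hξ
    simp
  have h5 : ∫ ξ in Icc (0 : ℝ) 1, deriv φ ξ • one ξ =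
      ∫ ξ in (0 : ℝ)..1, ((deriv φ ξ : ℝ) : ℂ) := by
    rw [intervalIntegral.integral_of_le zero_le_one, ← integral_Icc_eq_integral_Ioc]
    refine integral_congr_ae ?_
    filter_upwards [coeFn_ofContinuous (fun _ => (1 : ℂ)) continuous_const] with ξ hξ
    rw [one, hξ]
    simp
  rw [h4, h5, intervalIntegral.integral_ofReal, intervalIntegral.integral_deriv_eq_sub
    (fun x _ => (h1.differentiable (by simp)).differentiableAt)
    ((h1.continuous_deriv (by simp)).intervalIntegrable _ _), e0, e1]
  simp

end HeatState

/-- Subtracting a multiple of this unit mass makes any test function have integral zero. -/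
theorem exists_bump_unitInterval : ∃ ρ : ℝ → ℝ, ContDiff ℝ ∞ ρ ∧ HasCompactSupport ρ ∧
    tsupport ρ ⊆ Ioo 0 1 ∧ ∫ ξ, ρ ξ = 1 := by
  let b : ContDiffBump (1 / 2 : ℝ) := ⟨1 / 8, 1 / 4, by norm_num, by norm_num⟩
  refine ⟨b.normed volume, b.contDiff_normed, b.hasCompactSupport_normed, ?_, b.integral_normed⟩
  rw [b.tsupport_normed_eq]
  intro x hx
  rw [Metric.mem_closedBall, Real.dist_eq, abs_le] at hx
  have : b.rOut = 1 / 4 := rfl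
  rw [this] at hx
  constructor <;> linarith [hx.1, hx.2]

/-- A test function of integral zero is the derivative of a test function. -/
theorem exists_primitive_testFunction {ψ : ℝ → ℝ} (h1 : ContDiff ℝ ∞ ψ)
    (h3 : tsupport ψ ⊆ Ioo 0 1) (h4 : ∫ ξ, ψ ξ = 0) :
    ∃ φ : ℝ → ℝ, ContDiff ℝ ∞ φ ∧ HasCompactSupport φ ∧ tsupport φ ⊆ Ioo 0 1 ∧
      deriv φ = ψ := by
  have hK : IsCompact (tsupport ψ) :=
    isCompact_Icc.of_isClosed_subset (isClosed_tsupport ψ) (h3.trans Ioo_subset_Icc_self)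
  -- The support is compact in the open interval, so it leaves a margin; integrating from `a` then
  -- gives a primitive that vanishes off `[a, b]`, on the right because `ψ` has total integral zero.
  obtain ⟨a, b, ha, hab, hb, hsub⟩ : ∃ a b : ℝ, 0 < a ∧ a ≤ b ∧ b < 1 ∧ tsupport ψ ⊆ Icc a b := by
    rcases (tsupport ψ).eq_empty_or_nonempty with he | hne
    · exact ⟨1 / 2, 1 / 2, by norm_num, le_rfl, by norm_num, by simp [he]⟩
    · have m1 := h3 (hK.sInf_mem hne)
      have m2 := h3 (hK.sSup_mem hne)
      exact ⟨_, _, m1.1, csInf_le hK.bddBelow (hK.sSup_mem hne), m2.2,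
        fun x hx => ⟨csInf_le hK.bddBelow hx, le_csSup hK.bddAbove hx⟩⟩
  have hz : ∀ x, x ∉ Icc a b → ψ x = 0 := fun x hx =>
    image_eq_zero_of_notMem_tsupport fun hh => hx (hsub hh)
  have hint : ∀ c d, IntervalIntegrable ψ volume c d := fun c d =>
    h1.continuous.intervalIntegrable c d
  let φ : ℝ → ℝ := fun x => ∫ η in a..x, ψ η
  have hd : ∀ x, HasDerivAt φ (ψ x) x := fun x =>
    intervalIntegral.integral_hasDerivAt_right (hint _ _)
      (h1.continuous.stronglyMeasurableAtFilter _ _) h1.continuous.continuousAt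
  have hderiv : deriv φ = ψ := funext fun x => (hd x).deriv
  have hφ0 : ∀ x, x ∉ Icc a b → φ x = 0 := by
    intro x hx
    rw [mem_Icc, not_and_or, not_le, not_le] at hx
    rcases hx with hx | hx
    · refine intervalIntegral.integral_zero_ae ((ae_of_all _ fun η hη => ?_))
      rw [uIoc_of_ge hx.le] at hη
      -- The half-open interval of integration contains `a` itself, where `ψ` vanishes by continuity
      -- from the left.
      rcases hη.2.lt_or_eq with h | h
      · exact hz η fun hh => absurd hh.1 (not_le.2 h)
      · rw [h]
        have hcl : IsClosed {y | ψ y = 0} := isClosed_eq h1.continuous continuous_const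
        have hss : Iio a ⊆ {y | ψ y = 0} := fun y hy => hz y fun hh => absurd hh.1 (not_le.2 hy)
        have := hcl.closure_subset_iff.2 hss
        rw [closure_Iio] at this
        exact this (mem_Iic.2 le_rfl)
    · have : φ x = ∫ η, ψ η := by
        rw [← setIntegral_eq_integral_of_forall_compl_eq_zero (s := Icc a x),
          integral_Icc_eq_integral_Ioc, ← intervalIntegral.integral_of_le (hab.trans hx.le)]
        intro y hy
        exact hz y fun hh => hy ⟨hh.1, hh.2.trans hx.le⟩
      rw [this, h4]
  have hsupp : tsupport φ ⊆ Icc a b :=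
    closure_minimal (fun x hx => by_contra fun hh => hx (hφ0 x hh)) isClosed_Icc
  refine ⟨φ, contDiff_infty_iff_deriv.2 ⟨fun x => (hd x).differentiableAt, by rwa [hderiv]⟩,
    HasCompactSupport.of_support_subset_isCompact isCompact_Icc
      ((subset_tsupport φ).trans hsupp), fun x hx => ?_, hderiv⟩
  exact ⟨ha.trans_le (hsupp hx).1, (hsupp hx).2.trans_lt hb⟩

namespace HeatState

theorem setIntegral_eq_integral_of_tsupport {φ : ℝ → ℝ} (h3 : tsupport φ ⊆ Ioo 0 1)
    (f : ℝ → ℂ) : ∫ ξ in Icc (0 : ℝ) 1, φ ξ • f ξ = ∫ ξ, φ ξ • f ξ := by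
  refine setIntegral_eq_integral_of_forall_compl_eq_zero fun ξ hξ => ?_
  rw [image_eq_zero_of_notMem_tsupport (fun hh => hξ (Ioo_subset_Icc_self (h3 hh))), zero_smul]

/-- The du Bois-Reymond lemma: a function with zero weak derivative is constant. -/
theorem eq_const_of_hasWeakDeriv_zero {w : HeatState} (h : HasWeakDeriv w 0) :
    ∃ c : ℂ, w = c • one := by
  obtain ⟨ρ, r1, r2, r3, r4⟩ := exists_bump_unitInterval
  refine ⟨∫ ξ in Icc (0 : ℝ) 1, ρ ξ • w ξ, ?_⟩
  set c : ℂ := ∫ ξ in Icc (0 : ℝ) 1, ρ ξ • w ξ with hc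
  have hint : IntegrableOn (fun ξ => w ξ - c) (Icc (0 : ℝ) 1) :=
    w.integrable.sub (integrable_const c)
  have key := isOpen_Ioo.ae_eq_zero_of_integral_contDiff_smul_eq_zero (μ := volume)
    (U := Ioo (0 : ℝ) 1) (f := fun ξ => w ξ - c)
    (hint.mono_set Ioo_subset_Icc_self).locallyIntegrableOn ?_
  · have h4 : ∀ᵐ ξ ∂(volume.restrict (Ioo (0 : ℝ) 1)), w ξ - c = 0 :=
      (ae_restrict_iff' measurableSet_Ioo).2 key
    have h5 : volume.restrict (Icc (0 : ℝ) 1) = volume.restrict (Ioo (0 : ℝ) 1) :=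
      (Measure.restrict_congr_set Ioo_ae_eq_Icc).symm
    rw [← h5] at h4
    rw [one, ofContinuous_smul]
    refine eq_ofContinuous _ ?_
    filter_upwards [h4] with ξ hξ
    rw [sub_eq_zero.1 hξ, mul_one]
  · intro ψ p1 p2 p3
    have hψi : Integrable ψ := p1.continuous.integrable_of_hasCompactSupport p2
    have hρi : Integrable ρ := r1.continuous.integrable_of_hasCompactSupport r2
    -- `ψ - I ρ` has integral zero, so it is the derivative of a test function and is annihilated by
    -- `w`; this gives `∫ ψ w = I c = ∫ ψ c`.
    set I : ℝ := ∫ ξ, ψ ξ with hI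
    have q1 : ContDiff ℝ ∞ (fun ξ => ψ ξ - I * ρ ξ) := p1.sub (contDiff_const.mul r1)
    have q3 : tsupport (fun ξ => ψ ξ - I * ρ ξ) ⊆ Ioo 0 1 := by
      refine (closure_minimal (t := tsupport ψ ∪ tsupport ρ) (fun x hx => ?_)
        ((isClosed_tsupport ψ).union (isClosed_tsupport ρ))).trans (union_subset p3 r3)
      by_contra hh
      rw [mem_union, not_or] at hh
      exact hx (by
        simp [image_eq_zero_of_notMem_tsupport hh.1, image_eq_zero_of_notMem_tsupport hh.2])
    have q4 : ∫ ξ, (ψ ξ - I * ρ ξ) = 0 := by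
      rw [integral_sub hψi (hρi.const_mul I), integral_const_mul, r4, mul_one, sub_self]
    obtain ⟨φ, s1, s2, s3, s4⟩ := exists_primitive_testFunction q1 q3 q4
    have s5 := h φ s1 s2 s3
    have s6 : ∫ ξ in Icc (0 : ℝ) 1, φ ξ • (0 : HeatState) ξ = 0 := by
      refine integral_eq_zero_of_ae ?_
      filter_upwards [Lp.coeFn_zero ℂ 2 (volume.restrict (Icc (0 : ℝ) 1))] with ξ hξ
      simp
    rw [s6, neg_zero, s4] at s5
    have s7 : ∫ ξ in Icc (0 : ℝ) 1, (ψ ξ - I * ρ ξ) • w ξ =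
        (∫ ξ in Icc (0 : ℝ) 1, ψ ξ • w ξ) - I • c := by
      have i2 : Integrable (fun ξ => I • ρ ξ • w ξ) (volume.restrict (Icc (0 : ℝ) 1)) :=
        (w.integrable_smul r1.continuous r2).smul I
      rw [hc, ← integral_smul, ← integral_sub (w.integrable_smul p1.continuous p2) i2]
      refine integral_congr_ae (Eventually.of_forall fun ξ => ?_)
      simp only [sub_smul, mul_smul]
    have s8 : ∫ ξ in Icc (0 : ℝ) 1, ψ ξ • c = I • c := by
      rw [integral_smul_const]
      congr 1
      refine setIntegral_eq_integral_of_forall_compl_eq_zero fun ξ hξ => ?_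
      exact image_eq_zero_of_notMem_tsupport (fun hh => hξ (Ioo_subset_Icc_self (p3 hh)))
    have hψc : Integrable (fun ξ => ψ ξ • c) (volume.restrict (Icc (0 : ℝ) 1)) :=
      hψi.restrict.smul_const c
    rw [← setIntegral_eq_integral_of_tsupport p3]
    simp only [smul_sub]
    rw [integral_sub (w.integrable_smul p1.continuous p2) hψc, s8, ← s7, s5]

/-- `f - V g` has zero weak derivative, hence is constant. From here on weak derivatives are handled
by this formula, without test functions. -/
theorem hasWeakDeriv_iff {f g : HeatState} :
    HasWeakDeriv f g ↔ ∃ c : ℂ, f = c • one + volterra g := by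
  constructor
  · intro h
    have h1 : HasWeakDeriv (f + (-1 : ℂ) • volterra g) 0 := by
      simpa using h.add ((hasWeakDeriv_volterra g).smul (-1))
    obtain ⟨c, hc⟩ := eq_const_of_hasWeakDeriv_zero h1
    exact ⟨c, by rw [← hc]; simp⟩
  · rintro ⟨c, rfl⟩
    simpa using (hasWeakDeriv_one.smul c).add (hasWeakDeriv_volterra g)

end HeatState

theorem HasPointValue.unique {f : HeatState} {a : ℝ} {c c' : ℂ} (h : HasPointValue f a c)
    (h' : HasPointValue f a c') (ha : a ∈ Icc (0 : ℝ) 1) : c = c' := by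
  obtain ⟨F, h1, h2, rfl⟩ := h
  obtain ⟨F', h1', h2', rfl⟩ := h'
  exact Measure.eqOn_Icc_of_ae_eq volume zero_ne_one (h2.symm.trans h2') h1 h1' ha

/-! ### The operators of the boundary control system -/

namespace HeatState

/-- The inverse of the Dirichlet Laplacian. -/
def green : HeatState →L[ℂ] HeatState :=
  volterra.comp volterra - (total.comp volterra).smulRight idState

theorem green_apply (h : HeatState) :
    green h = volterra (volterra h) - total (volterra h) • idState := rfl

theorem hasPointValue_volterra (h : HeatState) (a : ℝ) :
    HasPointValue (volterra h) a (h.prim a) :=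
  hasPointValue_ofContinuous h.continuous_prim a

theorem hasPointValue_one (a : ℝ) : HasPointValue one a 1 :=
  hasPointValue_ofContinuous (F := fun _ => 1) continuous_const a

theorem hasPointValue_idState (a : ℝ) : HasPointValue idState a a :=
  hasPointValue_ofContinuous (F := fun ξ => (ξ : ℂ)) Complex.continuous_ofReal a

theorem idState_ne_zero : idState ≠ 0 := fun h => by
  have h1 := hasPointValue_idState 1
  rw [h] at h1
  exact one_ne_zero (α := ℂ) (by simpa using h1.unique (HasPointValue.zero 1) (by simp))

end HeatState

open HeatState

theorem heatMax_graph : heatMax.graph = heatMaxGraph :=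
  Submodule.toLinearPMap_graph_eq _ heatMaxGraph_single

theorem heatTrace_graph : heatTrace.graph = heatTraceGraph :=
  Submodule.toLinearPMap_graph_eq _ heatTraceGraph_single

/-- Two integrations leave an affine function undetermined; `f(0) = 0` removes its constant term. -/
theorem mem_heatMax_graph {f h : HeatState} :
    (f, h) ∈ heatMax.graph ↔ ∃ c : ℂ, f = c • idState + volterra (volterra h) := by
  rw [heatMax_graph]
  constructor
  · rintro ⟨⟨g, h1, h2⟩, h3⟩
    obtain ⟨a, ha⟩ := hasWeakDeriv_iff.1 h1
    obtain ⟨b, hb⟩ := hasWeakDeriv_iff.1 h2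
    dsimp only at h3 ha hb
    have h4 : HasPointValue f 0 (a • 1 + g.prim 0) := by
      rw [ha]
      exact ((hasPointValue_one 0).smul a).add (hasPointValue_volterra g 0)
    have h5 := h3.unique h4 (by simp)
    have h6 : a = 0 := by simpa using h5.symm
    refine ⟨b, ?_⟩
    rw [ha, h6, hb, zero_smul, zero_add, map_add, map_smul, volterra_one]
  · rintro ⟨c, rfl⟩
    refine ⟨⟨c • one + volterra h, hasWeakDeriv_iff.2 ⟨0, ?_⟩, hasWeakDeriv_iff.2 ⟨c, rfl⟩⟩, ?_⟩
    · simp [volterra_one]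
    · simpa using ((hasPointValue_idState 0).smul c).add (hasPointValue_volterra (volterra h) 0)

theorem mem_heatTrace_graph {f : HeatState} {u : ℂ} :
    (f, u) ∈ heatTrace.graph ↔ f ∈ heatMax.domain ∧ HasPointValue f 1 u := by
  rw [heatTrace_graph]
  rfl

theorem hasPointValue_one_of_heatMax (c : ℂ) (h : HeatState) :
    HasPointValue (c • idState + volterra (volterra h)) 1 (c + total (volterra h)) := by
  simpa [total_apply] using
    ((hasPointValue_idState 1).smul c).add (hasPointValue_volterra (volterra h) 1)

theorem heatTrace_domain : heatTrace.domain = heatMax.domain := by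
  ext f
  constructor
  · intro hf
    exact (mem_heatTrace_graph.1 (LinearPMap.mem_graph heatTrace ⟨f, hf⟩)).1
  · intro hf
    obtain ⟨h, hh⟩ := LinearPMap.mem_domain_iff.1 hf
    obtain ⟨c, rfl⟩ := mem_heatMax_graph.1 hh
    exact LinearPMap.mem_domain_iff.2
      ⟨_, mem_heatTrace_graph.2 ⟨hf, hasPointValue_one_of_heatMax c h⟩⟩

theorem mem_mainOperator_graph {X U : Type*} [NormedAddCommGroup X] [NormedSpace ℂ X]
    [NormedAddCommGroup U] [NormedSpace ℂ U] {𝔄 : X →ₗ.[ℂ] X} {𝔅 : X →ₗ.[ℂ] U} {x y : X} :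
    (x, y) ∈ (mainOperator 𝔄 𝔅).graph ↔ (x, y) ∈ 𝔄.graph ∧ (x, (0 : U)) ∈ 𝔅.graph := by
  have hle : mainOperator 𝔄 𝔅 ≤ 𝔄 := LinearPMap.domRestrict_le
  constructor
  · intro h
    refine ⟨LinearPMap.le_graph_of_le hle h, ?_⟩
    have h1 : x ∈ (mainOperator 𝔄 𝔅).domain := LinearPMap.mem_domain_of_mem_graph h
    obtain ⟨z, hz, rfl⟩ := h1.1
    rw [LinearPMap.mem_graph_iff]
    exact ⟨z, rfl, LinearMap.mem_ker.1 hz⟩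
  · rintro ⟨h1, h2⟩
    have h3 : x ∈ (mainOperator 𝔄 𝔅).domain := by
      refine ⟨?_, LinearPMap.mem_domain_of_mem_graph h1⟩
      obtain ⟨z, hz1, hz2⟩ := (LinearPMap.mem_graph_iff 𝔅).1 h2
      exact ⟨z, LinearMap.mem_ker.2 hz2, hz1⟩
    have h4 := LinearPMap.mem_graph (mainOperator 𝔄 𝔅) ⟨x, h3⟩
    have h5 := LinearPMap.mem_graph_snd_inj 𝔄 (LinearPMap.le_graph_of_le hle h4) h1 rfl
    rwa [h5] at h4

/-- The value at `1` of `c · id + V² h` is `c + total (V h)`, so the second boundary condition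
determines `c`. -/
theorem mem_dirichletLaplacian_graph {f h : HeatState} :
    (f, h) ∈ dirichletLaplacian.graph ↔ f = green h := by
  rw [dirichletLaplacian, mem_mainOperator_graph, mem_heatMax_graph, mem_heatTrace_graph]
  constructor
  · rintro ⟨⟨c, rfl⟩, -, h1⟩
    have h2 := h1.unique (hasPointValue_one_of_heatMax c h) (by simp)
    rw [green_apply, eq_neg_of_add_eq_zero_left h2.symm, neg_smul]
    abel
  · intro hf
    have h1 : f = (-total (volterra h)) • idState + volterra (volterra h) := by
      rw [hf, green_apply, neg_smul]
      abel
    refine ⟨⟨_, h1⟩, LinearPMap.mem_domain_of_mem_graph (mem_heatMax_graph.2 ⟨_, h1⟩), ?_⟩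
    rw [h1]
    simpa using hasPointValue_one_of_heatMax (-total (volterra h)) h

/-- The graph is the preimage of the line spanned by `id`, closed by finite dimension, under the
continuous map `(f, h) ↦ f - V² h`. -/
theorem heatMax_isClosed : heatMax.IsClosed := by
  have h1 : (heatMax.graph : Set (HeatState × HeatState)) =
      (fun q : HeatState × HeatState => q.1 - volterra (volterra q.2)) ⁻¹'
        (Submodule.span ℂ {idState} : Submodule ℂ HeatState) := by
    ext ⟨f, h⟩
    rw [SetLike.mem_coe, mem_heatMax_graph, mem_preimage, SetLike.mem_coe,
      Submodule.mem_span_singleton]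
    exact exists_congr fun c => by rw [eq_sub_iff_add_eq, eq_comm]
  unfold LinearPMap.IsClosed
  rw [h1]
  exact (Submodule.closed_of_finiteDimensional _).preimage (by fun_prop)

/-- The trace is `c + total (V y)`, and `c` is controlled through `c · id = x - V² y`. -/
theorem heatTrace_bounded : ∃ K : ℝ, ∀ (x y : HeatState) (u : ℂ), (x, y) ∈ heatMax.graph →
    (x, u) ∈ heatTrace.graph → ‖u‖ ≤ K * (‖x‖ + ‖y‖) := by
  have hpos : 0 < ‖idState‖ := norm_pos_iff.2 idState_ne_zero
  set D := ‖volterra.comp volterra‖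
  set E := ‖total.comp volterra‖
  refine ⟨(1 + D) / ‖idState‖ + E, fun x y u hx hu => ?_⟩
  obtain ⟨c, rfl⟩ := mem_heatMax_graph.1 hx
  have h1 := (mem_heatTrace_graph.1 hu).2.unique (hasPointValue_one_of_heatMax c y) (by simp)
  rw [h1]
  have h2 : ‖total (volterra y)‖ ≤ E * ‖y‖ := (total.comp volterra).le_opNorm y
  have h3 : ‖volterra (volterra y)‖ ≤ D * ‖y‖ := (volterra.comp volterra).le_opNorm y
  set x := c • idState + volterra (volterra y) with hxdef
  have h4 : ‖c‖ * ‖idState‖ ≤ ‖x‖ + D * ‖y‖ := by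
    rw [← norm_smul, show c • idState = x - volterra (volterra y) by rw [hxdef]; abel]
    exact (norm_sub_le _ _).trans (by gcongr)
  have hD : 0 ≤ D := norm_nonneg _
  have hE : 0 ≤ E := norm_nonneg _
  have h5 : ‖c‖ ≤ (1 + D) / ‖idState‖ * (‖x‖ + ‖y‖) := by
    rw [div_mul_eq_mul_div, le_div_iff₀ hpos]
    nlinarith [norm_nonneg x, norm_nonneg y, mul_nonneg hD (norm_nonneg x)]
  have h6 : E * ‖y‖ ≤ E * (‖x‖ + ‖y‖) :=
    mul_le_mul_of_nonneg_left (by linarith [norm_nonneg x]) hE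
  calc ‖c + total (volterra y)‖ ≤ ‖c‖ + ‖total (volterra y)‖ := norm_add_le _ _
    _ ≤ _ := by rw [add_mul]; linarith

/-- The right inverse `u ↦ u · id` of the boundary operator. -/
def dirichletLift : ℂ →L[ℂ] heatMax.graph :=
  (ContinuousLinearMap.toSpanSingleton ℂ (idState, (0 : HeatState))).codRestrict heatMax.graph
    fun u => mem_heatMax_graph.2 ⟨u, by simp⟩

theorem dirichletLift_fst (u : ℂ) : (dirichletLift u).1.1 = u • idState := rfl

theorem dirichletLift_snd (u : ℂ) : (dirichletLift u).1.2 = 0 := smul_zero u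

theorem isRightInverse_dirichletLift : IsRightInverse heatMax heatTrace dirichletLift := by
  intro u
  refine mem_heatTrace_graph.2
    ⟨LinearPMap.mem_domain_of_mem_graph (dirichletLift u).2, ?_⟩
  rw [dirichletLift_fst]
  simpa using (hasPointValue_idState 1).smul u

/-! ### The eigenfunctions -/

theorem continuous_dirichletMode (n : ℕ+) :
    Continuous fun ξ : ℝ => ((Real.sqrt 2 * Real.sin (n * Real.pi * ξ) : ℝ) : ℂ) := by
  fun_prop

theorem dirichletMode_eq (n : ℕ+) :
    dirichletMode n = ofContinuous _ (continuous_dirichletMode n) := rfl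

theorem dirichletEigenvalue_neg (n : ℕ+) : dirichletEigenvalue n < 0 := by
  have := Real.pi_pos
  have h : (0 : ℝ) < n := by exact_mod_cast n.pos
  unfold dirichletEigenvalue
  have : 0 < (n : ℝ) ^ 2 * Real.pi ^ 2 := by positivity
  linarith

theorem volterra_ofContinuous {F Φ : ℝ → ℂ} (hF : Continuous F) (hΦ : ∀ ξ, HasDerivAt Φ (F ξ) ξ)
    (hΦ0 : Φ 0 = 0) : volterra (ofContinuous F hF) =
      ofContinuous Φ (continuous_iff_continuousAt.2 fun ξ => (hΦ ξ).continuousAt) := by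
  rw [volterra_apply]
  refine ofContinuous_congr _ _ fun ξ hξ => ?_
  rw [prim_ofContinuous hF hΦ hξ, hΦ0, sub_zero]

/-- With `k = nπ`, two explicit antiderivatives vanishing at `0` give `V² e_n = √2 (ξ -
sin(kξ)/k)/k`; the correction term of `green` removes the linear part because `sin k = 0`. -/
theorem green_dirichletMode (n : ℕ+) :
    green (dirichletMode n) = (dirichletEigenvalue n : ℂ)⁻¹ • dirichletMode n := by
  have hn : (n * Real.pi : ℝ) ≠ 0 :=
    mul_ne_zero (by exact_mod_cast n.pos.ne') Real.pi_ne_zero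
  set k : ℝ := n * Real.pi with hk
  have hlam : dirichletEigenvalue n = -k ^ 2 := by rw [dirichletEigenvalue, hk]; ring
  have d1 : ∀ ξ : ℝ, HasDerivAt (fun ξ : ℝ => ((Real.sqrt 2 * (1 - Real.cos (k * ξ)) / k : ℝ) : ℂ))
      ((Real.sqrt 2 * Real.sin (k * ξ) : ℝ) : ℂ) ξ := by
    intro ξ
    apply HasDerivAt.ofReal_comp
    have h1 := ((((hasDerivAt_id ξ).const_mul k).cos.const_sub 1).const_mul (Real.sqrt 2)).div_const k
    refine HasDerivAt.congr_deriv h1 ?_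
    simp only [id]
    field_simp
  have d2 : ∀ ξ : ℝ, HasDerivAt
      (fun ξ : ℝ => ((Real.sqrt 2 * (ξ - Real.sin (k * ξ) / k) / k : ℝ) : ℂ))
      ((Real.sqrt 2 * (1 - Real.cos (k * ξ)) / k : ℝ) : ℂ) ξ := by
    intro ξ
    apply HasDerivAt.ofReal_comp
    have h1 := (((hasDerivAt_id ξ).sub
      (((hasDerivAt_id ξ).const_mul k).sin.div_const k)).const_mul (Real.sqrt 2)).div_const k
    refine HasDerivAt.congr_deriv h1 ?_
    simp only [id]
    field_simp
  have v1 : volterra (dirichletMode n) = _ :=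
    volterra_ofContinuous (continuous_dirichletMode n) d1 (by simp)
  rw [green_apply, v1, volterra_ofContinuous _ d2 (by simp), total_apply,
    prim_ofContinuous _ d2 (by simp), dirichletMode_eq, idState, ofContinuous_smul,
    ofContinuous_smul, sub_eq_add_neg, ← neg_one_smul ℂ, ofContinuous_smul, ofContinuous_add]
  refine ofContinuous_congr _ _ fun ξ _ => ?_
  have hs : Real.sin (k * 1) = 0 := by rw [mul_one, hk]; exact Real.sin_nat_mul_pi n
  have hkc : (k : ℂ) ≠ 0 := by exact_mod_cast hn
  rw [hs, hlam]
  simp only [← hk]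
  push_cast
  simp only [mul_zero, Complex.sin_zero, zero_div, sub_zero, mul_one]
  field_simp
  ring

theorem integral_cos_int_mul_pi {k : ℤ} (hk : k ≠ 0) :
    ∫ ξ in (0 : ℝ)..1, Real.cos (k * Real.pi * ξ) = 0 := by
  have h : (k * Real.pi : ℝ) ≠ 0 := mul_ne_zero (by exact_mod_cast hk) Real.pi_ne_zero
  rw [intervalIntegral.integral_comp_mul_left (fun x => Real.cos x) h, integral_cos]
  simp

theorem inner_ofContinuous {F K : ℝ → ℂ} (hF : Continuous F) (hK : Continuous K) :
    inner ℂ (ofContinuous F hF) (ofContinuous K hK) =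
      ∫ ξ in (0 : ℝ)..1, (starRingEnd ℂ) (F ξ) * K ξ := by
  rw [L2.inner_def, intervalIntegral.integral_of_le zero_le_one, ← integral_Icc_eq_integral_Ioc]
  refine integral_congr_ae ?_
  filter_upwards [coeFn_ofContinuous F hF, coeFn_ofContinuous K hK] with ξ h1 h2
  rw [h1, h2, RCLike.inner_apply, mul_comm]

theorem orthonormal_dirichletMode : Orthonormal ℂ dirichletMode := by
  classical
  rw [orthonormal_iff_ite]
  intro m n
  have hr : ∀ ξ : ℝ, (starRingEnd ℂ) ((Real.sqrt 2 * Real.sin (m * Real.pi * ξ) : ℝ) : ℂ) *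
      ((Real.sqrt 2 * Real.sin (n * Real.pi * ξ) : ℝ) : ℂ) =
      ((Real.cos (((m : ℤ) - (n : ℤ) : ℤ) * Real.pi * ξ) -
        Real.cos (((m : ℤ) + (n : ℤ) : ℤ) * Real.pi * ξ) : ℝ) : ℂ) := by
    intro ξ
    rw [Complex.conj_ofReal, ← Complex.ofReal_mul]
    congr 1
    have e1 : (((m : ℤ) - (n : ℤ) : ℤ) * Real.pi * ξ : ℝ) =
      m * Real.pi * ξ - n * Real.pi * ξ := by push_cast; ring
    have e2 : (((m : ℤ) + (n : ℤ) : ℤ) * Real.pi * ξ : ℝ) =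
      m * Real.pi * ξ + n * Real.pi * ξ := by push_cast; ring
    rw [e1, e2, Real.cos_sub, Real.cos_add]
    have := Real.mul_self_sqrt (show (0 : ℝ) ≤ 2 by norm_num)
    linear_combination (Real.sin (m * Real.pi * ξ) * Real.sin (n * Real.pi * ξ)) * this
  have hci : ∀ k : ℤ, IntervalIntegrable (fun ξ : ℝ => Real.cos (k * Real.pi * ξ)) volume 0 1 :=
    fun k => (by fun_prop : Continuous _).intervalIntegrable _ _
  rw [dirichletMode_eq, dirichletMode_eq, inner_ofContinuous]
  simp only [hr]
  rw [intervalIntegral.integral_ofReal, intervalIntegral.integral_sub (hci _) (hci _),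
    integral_cos_int_mul_pi (k := (m : ℤ) + n) (by have := m.pos; have := n.pos; lia)]
  split_ifs with h
  · subst h
    simp
  · rw [integral_cos_int_mul_pi (sub_ne_zero.2 fun h' => h (by exact_mod_cast h'))]
    simp

/-! ### Completeness of the eigenfunctions -/

/-- A function orthogonal to all `sin(nπ·)` is orthogonal to all `cos(π·)^k sin(nπ·)`. -/
theorem integral_cos_pow_mul_sin_mul_eq_zero {f : HeatState}
    (hf : ∀ n : ℕ+, inner ℂ (dirichletMode n) f = 0) (k : ℕ) (n : ℤ) :
    ∫ ξ in Icc (0 : ℝ) 1,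
      (Real.cos (Real.pi * ξ) ^ k * Real.sin (n * Real.pi * ξ)) • f ξ = 0 := by
  have hb : ∀ φ : ℝ → ℝ, Continuous φ →
      Integrable (fun ξ => φ ξ • f ξ) (volume.restrict (Icc (0 : ℝ) 1)) := by
    intro φ hφ
    obtain ⟨C, hC⟩ := isCompact_Icc.exists_bound_of_continuousOn
      (hφ.continuousOn (s := Icc (0 : ℝ) 1))
    exact f.integrable.bdd_smul C hφ.aestronglyMeasurable (by
      filter_upwards [ae_restrict_mem measurableSet_Icc] with ξ hξ using hC ξ hξ)
  -- `cos(πξ) sin(nπξ)` is the mean of the sines of frequencies `n ± 1`, which may leave the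
  -- positive integers; hence the induction over all integers, with oddness settling `n ≤ 0` at the
  -- start.
  induction k generalizing n with
  | zero =>
    have hpos : ∀ n : ℕ+, ∫ ξ in Icc (0 : ℝ) 1, Real.sin (n * Real.pi * ξ) • f ξ = 0 := by
      intro n
      have h1 := hf n
      rw [L2.inner_def] at h1
      have h2 : ∫ ξ in Icc (0 : ℝ) 1, inner ℂ (dirichletMode n ξ) (f ξ) =
          Real.sqrt 2 • ∫ ξ in Icc (0 : ℝ) 1, Real.sin (n * Real.pi * ξ) • f ξ := by
        rw [← integral_smul]
        refine integral_congr_ae ?_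
        rw [dirichletMode_eq]
        filter_upwards [coeFn_ofContinuous _ (continuous_dirichletMode n)] with ξ hξ
        rw [hξ, RCLike.inner_apply, Complex.conj_ofReal, smul_smul, Complex.real_smul, mul_comm]
      rw [h2] at h1
      exact (smul_eq_zero.1 h1).resolve_left (by positivity)
    simp only [pow_zero, one_mul]
    have hpos' : ∀ m : ℕ, 0 < m →
        ∫ ξ in Icc (0 : ℝ) 1, Real.sin (m * Real.pi * ξ) • f ξ = 0 := fun m hm => hpos ⟨m, hm⟩
    rcases lt_trichotomy n 0 with h | h | h
    · obtain ⟨m, rfl⟩ : ∃ m : ℕ, n = -m := ⟨n.natAbs, by lia⟩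
      simp only [Int.cast_neg, Int.cast_natCast, neg_mul, Real.sin_neg, neg_smul, integral_neg,
        hpos' m (by lia), neg_zero]
    · simp [h]
    · lift n to ℕ using h.le
      simp only [Int.cast_natCast]
      exact hpos' n (by exact_mod_cast h)
  | succ k ih =>
    have h1 : ∀ ξ : ℝ, (Real.cos (Real.pi * ξ) ^ (k + 1) * Real.sin (n * Real.pi * ξ)) • f ξ =
        (1 / 2 : ℝ) • (((Real.cos (Real.pi * ξ) ^ k *
          Real.sin ((n + 1 : ℤ) * Real.pi * ξ)) • f ξ) +
        ((Real.cos (Real.pi * ξ) ^ k * Real.sin ((n - 1 : ℤ) * Real.pi * ξ)) • f ξ)) := by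
      intro ξ
      rw [← add_smul, smul_smul]
      congr 1
      have e1 : ((n + 1 : ℤ) * Real.pi * ξ : ℝ) = n * Real.pi * ξ + Real.pi * ξ := by
        push_cast; ring
      have e2 : ((n - 1 : ℤ) * Real.pi * ξ : ℝ) = n * Real.pi * ξ - Real.pi * ξ := by
        push_cast; ring
      rw [e1, e2, Real.sin_add, Real.sin_sub]
      ring
    simp only [h1]
    rw [integral_smul, integral_add (hb _ (by fun_prop)) (hb _ (by fun_prop)), ih, ih]
    simp

/-- Stone–Weierstrass: an injective `γ` separates points, so polynomials in `γ` are dense in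
`C([0,1])`, and integration against `w` is a continuous functional vanishing on them. -/
theorem integral_continuous_smul_eq_zero {w : ℝ → ℂ}
    (hw : Integrable w (volume.restrict (Icc (0 : ℝ) 1))) {γ : ℝ → ℝ} (hγ : Continuous γ)
    (hinj : InjOn γ (Icc 0 1)) (h : ∀ k : ℕ, ∫ ξ in Icc (0 : ℝ) 1, γ ξ ^ k • w ξ = 0)
    {φ : ℝ → ℝ} (hφ : Continuous φ) : ∫ ξ in Icc (0 : ℝ) 1, φ ξ • w ξ = 0 := by
  let g : C(Icc (0 : ℝ) 1, ℝ) := ⟨fun ξ => γ ξ, by fun_prop⟩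
  let ext : C(Icc (0 : ℝ) 1, ℝ) → ℝ → ℝ := fun F => IccExtend zero_le_one F
  have hcont : ∀ F, Continuous (ext F) := fun F => F.continuous.Icc_extend'
  have hext : ∀ F : C(Icc (0 : ℝ) 1, ℝ), ∀ ξ, ∀ hξ : ξ ∈ Icc (0 : ℝ) 1, ext F ξ = F ⟨ξ, hξ⟩ :=
    fun F ξ hξ => IccExtend_of_mem _ _ hξ
  have hbd : ∀ F : C(Icc (0 : ℝ) 1, ℝ), ∀ ξ, ‖ext F ξ‖ ≤ ‖F‖ := fun F ξ => F.norm_coe_le_norm _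
  have hI : ∀ F, Integrable (fun ξ => ext F ξ • w ξ) (volume.restrict (Icc (0 : ℝ) 1)) :=
    fun F => hw.bdd_smul ‖F‖ (hcont F).aestronglyMeasurable (Eventually.of_forall (hbd F))
  let Λ : C(Icc (0 : ℝ) 1, ℝ) →L[ℝ] ℂ := LinearMap.mkContinuous
    { toFun := fun F => ∫ ξ in Icc (0 : ℝ) 1, ext F ξ • w ξ
      map_add' := fun F K => by
        rw [← integral_add (hI F) (hI K)]
        refine integral_congr_ae (Eventually.of_forall fun ξ => ?_)
        exact add_smul (ext F ξ) (ext K ξ) (w ξ)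
      map_smul' := fun c F => by
        rw [RingHom.id_apply, ← integral_smul]
        refine integral_congr_ae (Eventually.of_forall fun ξ => ?_)
        exact mul_smul c (ext F ξ) (w ξ) }
    (∫ ξ in Icc (0 : ℝ) 1, ‖w ξ‖) fun F => by
      rw [mul_comm, ← integral_const_mul]
      refine norm_integral_le_of_norm_le (hw.norm.const_mul _) (Eventually.of_forall fun ξ => ?_)
      rw [norm_smul]
      exact mul_le_mul_of_nonneg_right (hbd F ξ) (norm_nonneg _)
  have hΛ : ∀ F, Λ F = ∫ ξ in Icc (0 : ℝ) 1, ext F ξ • w ξ := fun F => rfl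
  have hpow : ∀ k : ℕ, Λ (g ^ k) = 0 := by
    intro k
    rw [hΛ, ← h k]
    refine setIntegral_congr_fun measurableSet_Icc fun ξ hξ => ?_
    simp only [hext _ ξ hξ]
    rfl
  have hadj : ∀ F ∈ Algebra.adjoin ℝ {g}, Λ F = 0 := by
    intro F hF
    rw [Algebra.adjoin_singleton_eq_range_aeval] at hF
    obtain ⟨p, rfl⟩ := hF
    change Λ (Polynomial.aeval g p) = 0
    rw [Polynomial.aeval_eq_sum_range, map_sum]
    exact Finset.sum_eq_zero fun i _ => by rw [map_smul, hpow, smul_zero]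
  have htop : (Algebra.adjoin ℝ {g}).topologicalClosure = ⊤ := by
    refine ContinuousMap.subalgebra_topologicalClosure_eq_top_of_separatesPoints _ ?_
    intro x y hxy
    exact ⟨g, ⟨g, Algebra.self_mem_adjoin_singleton ℝ g, rfl⟩,
      fun hh => hxy (Subtype.ext (hinj x.2 y.2 hh))⟩
  have hall : ∀ F, Λ F = 0 := by
    intro F
    have hF : F ∈ (Algebra.adjoin ℝ {g}).topologicalClosure := by rw [htop]; trivial
    have hcl : IsClosed {F | Λ F = 0} := isClosed_eq Λ.continuous continuous_const
    exact closure_minimal (fun K hK => hadj K hK) hcl hF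
  have h1 := hall ⟨fun ξ => φ ξ, by fun_prop⟩
  rw [hΛ] at h1
  rw [← h1]
  refine setIntegral_congr_fun measurableSet_Icc fun ξ hξ => ?_
  simp only [hext _ ξ hξ]
  rfl

/-- The weight `sin(πξ)` turns orthogonality to the sines into vanishing moments of `sin(πξ) f` in
the injective variable `cos(πξ)`. The weight is positive inside the interval, so it can be divided
out. -/
theorem eq_zero_of_inner_dirichletMode {f : HeatState}
    (hf : ∀ n : ℕ+, inner ℂ (dirichletMode n) f = 0) : f = 0 := by
  set w : ℝ → ℂ := fun ξ => Real.sin (Real.pi * ξ) • f ξ with hw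
  have hwi : Integrable w (volume.restrict (Icc (0 : ℝ) 1)) :=
    f.integrable.bdd_smul 1
      (by fun_prop : Continuous fun ξ : ℝ => Real.sin (Real.pi * ξ)).aestronglyMeasurable
      (Eventually.of_forall fun ξ => Real.abs_sin_le_one _)
  have hinj : InjOn (fun ξ : ℝ => Real.cos (Real.pi * ξ)) (Icc 0 1) := by
    intro x hx y hy hxy
    have hpi := Real.pi_pos
    have := Real.injOn_cos (⟨by nlinarith [hx.1], by nlinarith [hx.2]⟩ : _ ∈ Icc 0 Real.pi)
      (⟨by nlinarith [hy.1], by nlinarith [hy.2]⟩ : _ ∈ Icc 0 Real.pi) hxy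
    exact mul_left_cancel₀ hpi.ne' this
  have h0 : ∀ k : ℕ, ∫ ξ in Icc (0 : ℝ) 1, Real.cos (Real.pi * ξ) ^ k • w ξ = 0 := by
    intro k
    have := integral_cos_pow_mul_sin_mul_eq_zero hf k 1
    simpa only [hw, smul_smul, Int.cast_one, one_mul] using this
  have key := isOpen_Ioo.ae_eq_zero_of_integral_contDiff_smul_eq_zero (μ := volume)
    (U := Ioo (0 : ℝ) 1) (f := w)
    ((show IntegrableOn w (Icc 0 1) volume from hwi).mono_set Ioo_subset_Icc_self).locallyIntegrableOn ?_
  · refine Lp.ext ?_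
    refine EventuallyEq.trans ?_ (Lp.coeFn_zero ℂ 2 (volume.restrict (Icc (0 : ℝ) 1))).symm
    have h4 : ∀ᵐ ξ ∂(volume.restrict (Ioo (0 : ℝ) 1)), f ξ = 0 := by
      refine (ae_restrict_iff' measurableSet_Ioo).2 ?_
      filter_upwards [key] with ξ h1 h2
      refine (smul_eq_zero.1 (h1 h2)).resolve_left (Real.sin_pos_of_pos_of_lt_pi ?_ ?_).ne'
      · exact mul_pos Real.pi_pos h2.1
      · nlinarith [Real.pi_pos, h2.2]
    have h5 : volume.restrict (Icc (0 : ℝ) 1) = volume.restrict (Ioo (0 : ℝ) 1) :=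
      (Measure.restrict_congr_set Ioo_ae_eq_Icc).symm
    exact h5.le.absolutelyContinuous.ae_le h4
  · intro φ h1 _ h3
    rw [← setIntegral_eq_integral_of_tsupport h3]
    exact integral_continuous_smul_eq_zero hwi (by fun_prop) hinj h0 h1.continuous

theorem span_dirichletMode_orthogonal :
    (Submodule.span ℂ (Set.range dirichletMode))ᗮ = ⊥ := by
  rw [Submodule.eq_bot_iff]
  intro f hf
  exact eq_zero_of_inner_dirichletMode fun n =>
    (Submodule.mem_orthogonal _ _).1 hf _ (Submodule.subset_span ⟨n, rfl⟩)

/-- The Hilbert basis `e_n(ξ) = √2 sin(nπξ)` of `L²([0,1])`. -/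
def dirichletBasis : HilbertBasis ℕ+ ℂ HeatState :=
  HilbertBasis.mkOfOrthogonalEqBot orthonormal_dirichletMode span_dirichletMode_orthogonal

theorem dirichletBasis_apply (n : ℕ+) : dirichletBasis n = dirichletMode n :=
  congrFun (HilbertBasis.coe_mkOfOrthogonalEqBot _ _) n

theorem span_dirichletMode_topologicalClosure :
    (Submodule.span ℂ (Set.range dirichletMode)).topologicalClosure = ⊤ := by
  rw [← dirichletBasis.dense_span]
  congr 3
  exact (funext dirichletBasis_apply).symm

/-! ### Diagonal operators with respect to a Hilbert basis -/

namespace HilbertBasis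

variable {ι X : Type*} [NormedAddCommGroup X] [InnerProductSpace ℂ X] (b : HilbertBasis ι ℂ X)

theorem ext_repr {x y : X} (h : ∀ n, b.repr x n = b.repr y n) : x = y :=
  b.repr.injective (lp.ext (funext h))

theorem repr_add_apply (x y : X) (n : ι) : b.repr (x + y) n = b.repr x n + b.repr y n := by
  rw [map_add]; rfl

theorem repr_sub_apply (x y : X) (n : ι) : b.repr (x - y) n = b.repr x n - b.repr y n := by
  rw [map_sub]; rfl

theorem repr_smul_apply (c : ℂ) (x : X) (n : ι) : b.repr (c • x) n = c * b.repr x n := by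
  rw [map_smul]; rfl

theorem hasSum_norm_sq_repr (x : X) : HasSum (fun n => ‖b.repr x n‖ ^ 2) (‖x‖ ^ 2) := by
  have h := lp.hasSum_norm (p := 2) (by norm_num) (b.repr x)
  simpa [LinearIsometryEquiv.norm_map] using h

theorem exists_repr_eq {c : ι → ℂ} (hc : Summable fun n => ‖c n‖ ^ 2) :
    ∃ x : X, ∀ n, b.repr x n = c n := by
  have hm : Memℓp c 2 := memℓp_gen (by simpa using hc)
  exact ⟨b.repr.symm ⟨c, hm⟩, fun n => by rw [LinearIsometryEquiv.apply_symm_apply]⟩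

theorem norm_le_of_repr_le {x y : X} {C : ℝ} (hC : 0 ≤ C)
    (h : ∀ n, ‖b.repr x n‖ ≤ C * ‖b.repr y n‖) : ‖x‖ ≤ C * ‖y‖ := by
  refine le_of_sq_le_sq ?_ (by positivity)
  rw [mul_pow]
  refine hasSum_le (fun n => ?_) (b.hasSum_norm_sq_repr x) ((b.hasSum_norm_sq_repr y).mul_left _)
  rw [← mul_pow]
  exact pow_le_pow_left₀ (norm_nonneg _) (h n) 2

/-- Coordinatewise convergence with a square-summable majorant is convergence in norm. -/
theorem tendsto_of_dominated {α : Type*} {l : Filter α} {f : α → X} {y : X} {g : ι → ℝ}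
    (hg : Summable fun n => g n ^ 2)
    (h : ∀ n, Tendsto (fun a => b.repr (f a) n) l (𝓝 (b.repr y n)))
    (hb : ∀ᶠ a in l, ∀ n, ‖b.repr (f a) n‖ ≤ g n) : Tendsto f l (𝓝 y) := by
  rcases l.eq_or_neBot with rfl | hl
  · exact tendsto_bot
  have hy : ∀ n, ‖b.repr y n‖ ≤ g n := fun n =>
    le_of_tendsto (h n).norm (hb.mono fun a ha => ha n)
  have h1 : Tendsto (fun a => ∑' n, ‖b.repr (f a - y) n‖ ^ 2) l (𝓝 (∑' _ : ι, (0 : ℝ))) := by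
    refine tendsto_tsum_of_dominated_convergence (bound := fun n => 4 * g n ^ 2)
      (hg.mul_left 4) (fun n => ?_) (hb.mono fun a ha n => ?_)
    · have h2 : Tendsto (fun a => b.repr (f a) n - b.repr y n) l (𝓝 0) := by
        simpa using (h n).sub_const (b.repr y n)
      simpa [b.repr_sub_apply] using (h2.norm.pow 2)
    · rw [Real.norm_of_nonneg (by positivity), b.repr_sub_apply]
      have := norm_sub_le (b.repr (f a) n) (b.repr y n)
      have h3 := ha n
      have h4 := hy n
      calc _ ≤ (2 * g n) ^ 2 := pow_le_pow_left₀ (norm_nonneg _) (by linarith) 2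
        _ = _ := by ring
  rw [tsum_zero] at h1
  simp only [(b.hasSum_norm_sq_repr _).tsum_eq] at h1
  rw [tendsto_iff_norm_sub_tendsto_zero]
  have h2 := h1.sqrt
  simpa [Real.sqrt_sq (norm_nonneg _)] using h2

theorem continuous_repr_apply (n : ι) : Continuous fun x => b.repr x n := by
  simp only [b.repr_apply_apply]
  fun_prop

/-- The bounded operator `S` is diagonal, with multipliers `m`. -/
def IsDiag (S : X →L[ℂ] X) (m : ι → ℂ) : Prop :=
  ∀ x n, b.repr (S x) n = m n * b.repr x n

variable {b}

theorem isDiag_of_apply {S : X →L[ℂ] X} {m : ι → ℂ} (h : ∀ n, S (b n) = m n • b n) :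
    b.IsDiag S m := by
  classical
  intro x n
  have h1 : HasSum (fun i => inner ℂ (b n) (S (b.repr x i • b i))) (inner ℂ (b n) (S x)) :=
    ((innerSL ℂ (b n)).comp S).hasSum (b.hasSum_repr x)
  rw [b.repr_apply_apply]
  refine h1.unique ?_
  have h2 := hasSum_single (f := fun i => inner ℂ (b n) (S (b.repr x i • b i))) n ?_
  · convert h2 using 1
    rw [map_smul, h, inner_smul_right, inner_smul_right,
      orthonormal_iff_ite.1 b.orthonormal, if_pos rfl]
    ring
  · intro i hi
    rw [map_smul, h, inner_smul_right, inner_smul_right,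
      orthonormal_iff_ite.1 b.orthonormal, if_neg hi.symm]
    simp

theorem repr_basis_apply [DecidableEq ι] (i n : ι) : b.repr (b i) n = if n = i then 1 else 0 := by
  rw [b.repr_apply_apply, orthonormal_iff_ite.1 b.orthonormal]

namespace IsDiag

variable {S S' : X →L[ℂ] X} {m m' : ι → ℂ}

theorem apply_basis (h : b.IsDiag S m) (i : ι) : S (b i) = m i • b i := by
  classical
  refine b.ext_repr fun n => ?_
  rw [h, b.repr_smul_apply, repr_basis_apply]
  split_ifs with hn
  · rw [hn]
  · simp

theorem comm (h : b.IsDiag S m) (h' : b.IsDiag S' m') (x : X) : S (S' x) = S' (S x) :=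
  b.ext_repr fun n => by rw [h, h', h', h]; ring

theorem norm_apply_le (h : b.IsDiag S m) {C : ℝ} (hC : 0 ≤ C) (hm : ∀ n, ‖m n‖ ≤ C) (x : X) :
    ‖S x‖ ≤ C * ‖x‖ :=
  b.norm_le_of_repr_le hC fun n => by
    rw [h, norm_mul]
    exact mul_le_mul_of_nonneg_right (hm n) (norm_nonneg _)

theorem opNorm_le (h : b.IsDiag S m) {C : ℝ} (hC : 0 ≤ C) (hm : ∀ n, ‖m n‖ ≤ C) : ‖S‖ ≤ C :=
  S.opNorm_le_bound hC (h.norm_apply_le hC hm)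

theorem sub (h : b.IsDiag S m) (h' : b.IsDiag S' m') : b.IsDiag (S - S') (fun n => m n - m' n) :=
  fun x n => by
    rw [sub_apply, b.repr_sub_apply, h, h', sub_mul]

theorem smul (c : ℂ) (h : b.IsDiag S m) : b.IsDiag (c • S) (fun n => c * m n) := fun x n => by
  rw [smul_apply, b.repr_smul_apply, h, mul_assoc]

theorem injective (h : b.IsDiag S m) (hm : ∀ n, m n ≠ 0) : Function.Injective S := by
  intro x y hxy
  refine b.ext_repr fun n => mul_left_cancel₀ (hm n) ?_
  rw [← h, ← h, hxy]

/-- Every basis vector is attained. Dense range is what identifies the completion for `‖S x‖` with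
`X`. -/
theorem denseRange (h : b.IsDiag S m) (hm : ∀ n, m n ≠ 0) : DenseRange S := by
  have h1 : Submodule.span ℂ (Set.range b) ≤ LinearMap.range S.toLinearMap := by
    rw [Submodule.span_le]
    rintro _ ⟨n, rfl⟩
    refine ⟨(m n)⁻¹ • b n, ?_⟩
    change S ((m n)⁻¹ • b n) = b n
    rw [map_smul, h.apply_basis, smul_smul, inv_mul_cancel₀ (hm n), one_smul]
  have h2 : Dense (Submodule.span ℂ (Set.range b) : Set X) :=
    Submodule.dense_iff_topologicalClosure_eq_top.2 b.dense_span
  refine h2.mono fun x hx => ?_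
  obtain ⟨y, hy⟩ := h1 hx
  exact ⟨y, hy⟩

end IsDiag

theorem exists_isDiag (b : HilbertBasis ι ℂ X) {m : ι → ℂ} {C : ℝ} (hm : ∀ n, ‖m n‖ ≤ C) :
    ∃ S : X →L[ℂ] X, b.IsDiag S m := by
  have hC : ∀ x n, ‖m n * b.repr x n‖ ≤ |C| * ‖b.repr x n‖ := fun x n => by
    rw [norm_mul]
    exact mul_le_mul_of_nonneg_right ((hm n).trans (le_abs_self C)) (norm_nonneg _)
  have hs : ∀ x, Summable fun n => ‖m n * b.repr x n‖ ^ 2 := by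
    intro x
    refine Summable.of_nonneg_of_le (fun n => by positivity) (fun n => ?_)
      ((b.hasSum_norm_sq_repr x).summable.mul_left (|C| ^ 2))
    rw [← mul_pow]
    exact pow_le_pow_left₀ (norm_nonneg _) (hC x n) 2
  choose S hS using fun x => b.exists_repr_eq (hs x)
  refine ⟨LinearMap.mkContinuous
    { toFun := S
      map_add' := fun x y => b.ext_repr fun n => by
        rw [hS, b.repr_add_apply, b.repr_add_apply, hS, hS, mul_add]
      map_smul' := fun c x => b.ext_repr fun n => by
        rw [hS, RingHom.id_apply, b.repr_smul_apply, b.repr_smul_apply, hS]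
        ring } |C| fun x => b.norm_le_of_repr_le (abs_nonneg C) fun n => ?_, hS⟩
  change ‖b.repr (S x) n‖ ≤ _
  rw [hS]
  exact hC x n

variable (b) in
/-- The unbounded operator `A` is diagonal with its maximal domain, with multipliers `l`. -/
def IsDiagonalOperator (A : X →ₗ.[ℂ] X) (l : ι → ℂ) : Prop :=
  ∀ x y, (x, y) ∈ A.graph ↔ ∀ n, b.repr y n = l n * b.repr x n

namespace IsDiagonalOperator

variable {A : X →ₗ.[ℂ] X} {l : ι → ℂ}

theorem basis_mem_graph (hA : b.IsDiagonalOperator A l) (i : ι) :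
    (b i, l i • b i) ∈ A.graph := by
  classical
  refine (hA _ _).2 fun n => ?_
  rw [b.repr_smul_apply, repr_basis_apply]
  split_ifs with hn
  · rw [hn]
  · simp

theorem neg (hA : b.IsDiagonalOperator A l) : b.IsDiagonalOperator (-A) (fun n => -l n) := by
  intro x y
  have h1 : (x, y) ∈ (-A).graph ↔ (x, -y) ∈ A.graph := by
    rw [LinearPMap.mem_graph_iff, LinearPMap.mem_graph_iff]
    refine exists_congr fun z => and_congr Iff.rfl ?_
    rw [LinearPMap.neg_apply]
    exact neg_eq_iff_eq_neg
  rw [h1, hA]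
  refine forall_congr' fun n => ?_
  rw [← neg_one_smul ℂ, b.repr_smul_apply]
  constructor <;> intro h <;> linear_combination -h

/-- Applying `R` to `(z - l n) b_n` returns `b_n ≠ 0`; this both excludes `z = l n` and determines
`R` on the basis. -/
theorem isDiag_of_isResolventAt (hA : b.IsDiagonalOperator A l) {z : ℂ} {R : X →L[ℂ] X}
    (hR : IsResolventAt A z R) : (∀ n, z - l n ≠ 0) ∧ b.IsDiag R (fun n => (z - l n)⁻¹) := by
  have h1 : ∀ n, (z - l n) • R (b n) = b n := by
    intro n
    obtain ⟨w, hw1, hw2⟩ := (LinearPMap.mem_graph_iff A).1 (hA.basis_mem_graph n)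
    have h2 := hR.2 w
    rw [hw2, hw1] at h2
    rw [← map_smul, sub_smul]
    exact h2
  have h3 : ∀ n, z - l n ≠ 0 := by
    intro n hn
    have h4 := h1 n
    rw [hn, zero_smul] at h4
    exact b.orthonormal.ne_zero n h4.symm
  refine ⟨h3, isDiag_of_apply fun n => ?_⟩
  calc R (b n) = (z - l n)⁻¹ • (z - l n) • R (b n) := by
        rw [smul_smul, inv_mul_cancel₀ (h3 n), one_smul]
    _ = _ := by rw [h1]

theorem isResolventAt (hA : b.IsDiagonalOperator A l) {z : ℂ} {R : X →L[ℂ] X}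
    (hz : ∀ n, z - l n ≠ 0) (hR : b.IsDiag R (fun n => (z - l n)⁻¹)) : IsResolventAt A z R := by
  constructor
  · intro x
    have h1 : (R x, z • R x - x) ∈ A.graph := by
      refine (hA _ _).2 fun n => ?_
      rw [b.repr_sub_apply, b.repr_smul_apply, hR]
      have := hz n
      field_simp
      ring
    obtain ⟨w, hw1, hw2⟩ := (LinearPMap.mem_graph_iff A).1 h1
    have h2 : R x ∈ A.domain := LinearPMap.mem_domain_of_mem_graph h1
    refine ⟨h2, ?_⟩
    rw [show (⟨R x, h2⟩ : A.domain) = w from Subtype.ext hw1.symm, hw2, sub_sub_cancel]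
  · intro x
    refine b.ext_repr fun n => ?_
    have h1 := (hA _ _).1 (LinearPMap.mem_graph A x) n
    rw [hR, b.repr_sub_apply, b.repr_smul_apply, h1, ← sub_mul, ← mul_assoc,
      inv_mul_cancel₀ (hz n), one_mul]

theorem isDiag_resolventOp (hA : b.IsDiagonalOperator A l) {z : ℂ}
    (hz : z ∈ unboundedResolventSet A) :
    (∀ n, z - l n ≠ 0) ∧ b.IsDiag (resolventOp A z) (fun n => (z - l n)⁻¹) := by
  have h : ∃ R : X →L[ℂ] X, IsResolventAt A z R := hz
  refine hA.isDiag_of_isResolventAt ?_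
  rw [resolventOp, dif_pos h]
  exact h.choose_spec

theorem mem_unboundedResolventSet (hA : b.IsDiagonalOperator A l) {z : ℂ} {δ : ℝ} (hδ : 0 < δ)
    (hz : ∀ n, δ ≤ ‖z - l n‖) : z ∈ unboundedResolventSet A := by
  have h1 : ∀ n, z - l n ≠ 0 := fun n => norm_pos_iff.1 (hδ.trans_le (hz n))
  obtain ⟨R, hR⟩ := b.exists_isDiag (m := fun n => (z - l n)⁻¹) (C := δ⁻¹) fun n => by
    rw [norm_inv]
    exact inv_anti₀ hδ (hz n)
  exact ⟨R, hA.isResolventAt h1 hR⟩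

end IsDiagonalOperator

/-! ### Diagonal semigroups -/

/-- The generator gives a right derivative only, but that suffices: `s ↦ e^(-l n s) T(s) b_n` is
continuous with zero right derivative, hence constant. This covers every semigroup generated by `A`,
not only the one constructed below. -/
theorem isDiag_of_generates {A : X →ₗ.[ℂ] X} {l : ι → ℂ} (hA : b.IsDiagonalOperator A l)
    {T : ℝ → X →L[ℂ] X} (hT : IsC0Semigroup T) (hg : Generates A T) {t : ℝ} (ht : 0 ≤ t) :
    b.IsDiag (T t) (fun n => Complex.exp (l n * t)) := by
  refine isDiag_of_apply fun n => ?_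
  have h0 := (hg _ _).1 (hA.basis_mem_graph n)
  have hd : ∀ s, 0 ≤ s → HasDerivWithinAt (fun s : ℝ => T s (b n)) (l n • T s (b n)) (Ici s) s := by
    intro s hs
    rw [← hasDerivWithinAt_Ioi_iff_Ici, hasDerivWithinAt_iff_tendsto_slope' self_notMem_Ioi]
    have h1 : Tendsto (fun u : ℝ => u - s) (𝓝[>] s) (𝓝[>] 0) := by
      refine tendsto_nhdsWithin_iff.2 ⟨?_, ?_⟩
      · have : Tendsto (fun u : ℝ => u - s) (𝓝 s) (𝓝 (s - s)) := by
          exact (continuous_id.sub continuous_const).tendsto s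
        rw [sub_self] at this
        exact this.mono_left nhdsWithin_le_nhds
      · filter_upwards [self_mem_nhdsWithin] with u hu using sub_pos.2 (mem_Ioi.1 hu)
    have h2 := ((T s).continuous.tendsto _).comp (h0.comp h1)
    rw [map_smul] at h2
    refine h2.congr' ?_
    filter_upwards [self_mem_nhdsWithin] with u hu
    have hu' : 0 ≤ u - s := (sub_pos.2 (mem_Ioi.1 hu)).le
    have h3 : T u = (T s).comp (T (u - s)) := by
      rw [← hT.map_add s (u - s) hs hu', add_sub_cancel]
    simp only [Function.comp_apply, slope_def_module]
    rw [map_smul, map_sub, h3, ContinuousLinearMap.comp_apply, ← Complex.ofReal_inv]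
    rfl
  have hc : ∀ s ∈ Icc 0 t, Complex.exp (-(l n * s)) • T s (b n) =
      Complex.exp (-(l n * (0 : ℝ))) • T 0 (b n) := by
    refine constant_of_has_deriv_right_zero
      (f := fun s : ℝ => Complex.exp (-(l n * s)) • T s (b n)) ?_ ?_
    · refine ContinuousOn.smul (by fun_prop) ?_
      exact (hT.continuousOn (b n)).mono Icc_subset_Ici_self
    · intro s hs
      have h1 : HasDerivWithinAt (fun s : ℝ => Complex.exp (-(l n * s)))
          (Complex.exp (-(l n * s)) * -(l n)) (Ici s) s := by
        have h2 : HasDerivAt (fun s : ℝ => -(l n * (s : ℂ))) (-(l n)) s := by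
          have h3 := ((hasDerivAt_id s).ofReal_comp.const_mul (l n)).neg
          rw [Complex.ofReal_one, mul_one] at h3
          exact h3
        exact h2.cexp.hasDerivWithinAt
      refine (h1.smul (hd s hs.1)).congr_deriv ?_
      rw [smul_smul, ← add_smul]
      simp
  have h1 := hc t ⟨ht, le_rfl⟩
  rw [hT.map_zero] at h1
  simp only [Complex.ofReal_zero, mul_zero, neg_zero, Complex.exp_zero, one_smul,
    ContinuousLinearMap.id_apply] at h1
  calc T t (b n) = Complex.exp (l n * t) • Complex.exp (-(l n * t)) • T t (b n) := by
        rw [smul_smul, ← Complex.exp_add, add_neg_cancel, Complex.exp_zero, one_smul]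
    _ = _ := by rw [h1]

theorem norm_cexp_mul_le_one {r t : ℝ} (hr : r ≤ 0) (ht : 0 ≤ t) :
    ‖Complex.exp ((r : ℂ) * t)‖ ≤ 1 := by
  rw [Complex.norm_exp, ← Complex.ofReal_mul, Complex.ofReal_re]
  exact Real.exp_le_one_iff.2 (mul_nonpos_of_nonpos_of_nonneg hr ht)

/-- From `1 + rh ≤ e^(rh)`. It makes the coordinates of `A x` a majorant of the difference
quotients, uniformly in `h`. -/
theorem norm_cexp_sub_one_le {r h : ℝ} (hr : r ≤ 0) (hh : 0 < h) :
    ‖((h : ℂ)⁻¹ * (Complex.exp ((r : ℂ) * h) - 1))‖ ≤ ‖(r : ℂ)‖ := by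
  rw [norm_mul, norm_inv, ← Complex.ofReal_mul, ← Complex.ofReal_exp, ← Complex.ofReal_one,
    ← Complex.ofReal_sub, Complex.norm_real, Complex.norm_real, Complex.norm_real,
    Real.norm_of_nonneg hh.le, Real.norm_of_nonpos hr, Real.norm_of_nonpos
      (sub_nonpos.2 (Real.exp_le_one_iff.2 (mul_nonpos_of_nonpos_of_nonneg hr hh.le))),
    inv_mul_le_iff₀ hh]
  linarith [Real.add_one_le_exp (r * h)]

/-- Strong continuity and convergence on the domain follow by dominated convergence over
coordinates. Conversely, a norm limit of difference quotients has coordinates `r n x_n`, which is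
membership in the maximal domain. -/
theorem exists_generates {A : X →ₗ.[ℂ] X} {r : ι → ℝ}
    (hA : b.IsDiagonalOperator A (fun n => (r n : ℂ))) (hr : ∀ n, r n ≤ 0) :
    ∃ T : ℝ → X →L[ℂ] X, IsC0Semigroup T ∧ Generates A T := by
  -- Replacing `t` by `max t 0` keeps the multipliers bounded at negative times, where the values
  -- are irrelevant.
  have hex : ∀ t : ℝ, ∃ S : X →L[ℂ] X,
      b.IsDiag S (fun n => Complex.exp ((r n : ℂ) * (max t 0 : ℝ))) := fun t =>
    b.exists_isDiag fun n => norm_cexp_mul_le_one (hr n) (le_max_right t 0)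
  choose T hT using hex
  have hTp : ∀ t, 0 ≤ t → b.IsDiag (T t) (fun n => Complex.exp ((r n : ℂ) * t)) := by
    intro t ht
    have := hT t
    rwa [max_eq_left ht] at this
  refine ⟨T, ⟨?_, ?_, ?_⟩, ?_⟩
  · refine ContinuousLinearMap.ext fun x => b.ext_repr fun n => ?_
    rw [hTp 0 le_rfl]
    simp
  · intro s t hs ht
    refine ContinuousLinearMap.ext fun x => b.ext_repr fun n => ?_
    rw [hTp _ (add_nonneg hs ht), ContinuousLinearMap.comp_apply, hTp s hs, hTp t ht,
      ← mul_assoc, ← Complex.exp_add]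
    push_cast
    ring_nf
  · intro x
    refine Continuous.continuousOn (continuous_iff_continuousAt.2 fun t => ?_)
    refine b.tendsto_of_dominated (b.hasSum_norm_sq_repr x).summable (fun n => ?_)
      (Eventually.of_forall fun t n => ?_)
    · simp only [hT _ x n]
      exact Continuous.tendsto (by fun_prop) t
    · rw [hT, norm_mul]
      exact mul_le_of_le_one_left (norm_nonneg _)
        (norm_cexp_mul_le_one (hr n) (le_max_right t 0))
  · intro x y
    have hco : ∀ h : ℝ, 0 < h → ∀ n, b.repr (((h : ℂ)⁻¹) • (T h x - x)) n =
        ((h : ℂ)⁻¹ * (Complex.exp ((r n : ℂ) * h) - 1)) * b.repr x n := by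
      intro h hh n
      rw [b.repr_smul_apply, b.repr_sub_apply, hTp h hh.le]
      ring
    have hlim : ∀ n, Tendsto (fun h : ℝ => b.repr (((h : ℂ)⁻¹) • (T h x - x)) n) (𝓝[>] 0)
        (𝓝 ((r n : ℂ) * b.repr x n)) := by
      intro n
      have h1 : HasDerivAt (fun h : ℝ => Complex.exp ((r n : ℂ) * h)) (r n : ℂ) 0 := by
        have h2 : HasDerivAt (fun s : ℝ => ((r n : ℂ) * (s : ℂ))) (r n : ℂ) 0 := by
          simpa using ((hasDerivAt_id (0 : ℝ)).ofReal_comp).const_mul (r n : ℂ)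
        simpa using h2.cexp
      have h2 := h1.tendsto_slope_zero_right
      have h3 := h2.mul_const (b.repr x n)
      refine h3.congr' ?_
      filter_upwards [self_mem_nhdsWithin] with h hh
      rw [hco h hh]
      simp
    rw [hA]
    constructor
    · intro hxy
      refine b.tendsto_of_dominated (b.hasSum_norm_sq_repr y).summable (fun n => ?_) ?_
      · rw [hxy]
        exact hlim n
      · filter_upwards [self_mem_nhdsWithin] with h hh n
        rw [hco h hh, hxy, norm_mul _ (b.repr x n), norm_mul (r n : ℂ)]
        exact mul_le_mul_of_nonneg_right (norm_cexp_sub_one_le (hr n) hh) (norm_nonneg _)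
    · intro ht n
      exact tendsto_nhds_unique (((b.continuous_repr_apply n).tendsto y).comp ht) (hlim n)

end HilbertBasis

/-! ### The completion with respect to `x ↦ ‖J x‖` -/

section Extrap

variable {X : Type*} [NormedAddCommGroup X] [NormedSpace ℂ X]

theorem Renormed.norm_eq (J : X →L[ℂ] X) (x : Renormed J) :
    ‖x‖ = ‖Renormed.toOriginal J x‖ := rfl

variable [CompleteSpace X]

/-- The isometry of the completion for the norm `x ↦ ‖J x‖` into `X` which extends `J`. -/
def extrapIsometry (J : X →L[ℂ] X) : ExtrapSpace J →ₗᵢ[ℂ] X :=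
  let j : Renormed J →L[ℂ] X := (Renormed.toOriginal J).mkContinuous 1 fun x : Renormed J => by
    exact (one_mul ‖x‖).ge
  { (j.extend (UniformSpace.Completion.toComplL (𝕜 := ℂ) (E := Renormed J))).toLinearMap with
    norm_map' := fun w => by
      change ‖j.extend (UniformSpace.Completion.toComplL (𝕜 := ℂ) (E := Renormed J)) w‖ = ‖w‖
      induction w using UniformSpace.Completion.induction_on with
      | hp => exact isClosed_eq (j.extend (UniformSpace.Completion.toComplL (𝕜 := ℂ)
          (E := Renormed J))).continuous.norm continuous_norm
      | ih a =>
        have h := j.extend_eq (e := UniformSpace.Completion.toComplL (𝕜 := ℂ) (E := Renormed J))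
          UniformSpace.Completion.denseRange_coe
          (UniformSpace.Completion.isUniformInducing_coe _) a
        rw [UniformSpace.Completion.norm_coe, Renormed.norm_eq]
        exact congrArg norm h }

theorem extrapIsometry_embed (J : X →L[ℂ] X) (x : X) :
    extrapIsometry J (extrapEmbed J x) = J x :=
  ContinuousLinearMap.extend_eq _ (e := UniformSpace.Completion.toComplL (𝕜 := ℂ)
    (E := Renormed J)) UniformSpace.Completion.denseRange_coe
    (UniformSpace.Completion.isUniformInducing_coe _) x

/-- The range of an isometry of a complete space is closed, and here it contains the dense range of
`J`. -/
theorem extrapIsometry_surjective {J : X →L[ℂ] X} (hJ : DenseRange J) :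
    Function.Surjective (extrapIsometry J) := by
  have h1 : IsClosed (Set.range (extrapIsometry J)) :=
    (extrapIsometry J).isometry.isClosedEmbedding.isClosed_range
  have h2 : Set.range J ⊆ Set.range (extrapIsometry J) := by
    rintro _ ⟨x, rfl⟩
    exact ⟨extrapEmbed J x, extrapIsometry_embed J x⟩
  have h3 := (hJ.mono h2).closure_eq
  rw [h1.closure_eq] at h3
  exact Set.range_eq_univ.1 h3

/-- For `J` with dense range, the completion for the norm `x ↦ ‖J x‖` is isometric to `X`. -/
def extrapEquiv (J : X →L[ℂ] X) (hJ : DenseRange J) : ExtrapSpace J ≃ₗᵢ[ℂ] X :=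
  LinearIsometryEquiv.ofSurjective (extrapIsometry J) (extrapIsometry_surjective hJ)

theorem extrapEquiv_embed {J : X →L[ℂ] X} (hJ : DenseRange J) (x : X) :
    extrapEquiv J hJ (extrapEmbed J x) = J x :=
  extrapIsometry_embed J x

/-- Commutation gives `‖J S v‖ ≤ ‖S‖ ‖J v‖`, so `S` is uniformly continuous for the new norm and
`Completion.map` really extends it; the identity then passes from `X` by density. -/
theorem extrapEquiv_extend {J : X →L[ℂ] X} (hJ : DenseRange J) {S : X →L[ℂ] X}
    (hS : ∀ x, S (J x) = J (S x)) (w : ExtrapSpace J) :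
    extrapEquiv J hJ (extrapExtend J S w) = S (extrapEquiv J hJ w) := by
  have hu : UniformContinuous (Renormed.mapOp J S) := by
    refine (LipschitzWith.of_dist_le_mul (K := ‖S‖₊) fun x y => ?_).uniformContinuous
    rw [dist_eq_norm, dist_eq_norm, ← map_sub]
    have h : ∀ v : X, ‖J (S v)‖ ≤ ‖S‖ * ‖J v‖ := fun v => by
      rw [← hS]
      exact S.le_opNorm _
    exact h (x - y)
  induction w using UniformSpace.Completion.induction_on with
  | hp =>
    refine isClosed_eq ((extrapEquiv J hJ).continuous.comp UniformSpace.Completion.continuous_map)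
      (S.continuous.comp (extrapEquiv J hJ).continuous)
  | ih a =>
    rw [extrapExtend, UniformSpace.Completion.map_coe hu]
    have h : ∀ v : X, extrapEquiv J hJ (extrapEmbed J (S v)) =
        S (extrapEquiv J hJ (extrapEmbed J v)) := fun v => by
      rw [extrapEquiv_embed, extrapEquiv_embed, hS]
    exact h a

end Extrap

/-! ### The control operator of the heat equation -/

open HeatState

theorem HilbertBasis.inner_eq_of_repr {ι X : Type*} [NormedAddCommGroup X]
    [InnerProductSpace ℂ X] (b : HilbertBasis ι ℂ X) {x y x' y' : X}
    (h : ∀ n, (starRingEnd ℂ) (b.repr x n) * b.repr y n =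
      (starRingEnd ℂ) (b.repr x' n) * b.repr y' n) : inner ℂ x y = inner ℂ x' y' := by
  rw [← b.repr.inner_map_map, ← b.repr.inner_map_map x', lp.inner_eq_tsum, lp.inner_eq_tsum]
  refine tsum_congr fun n => ?_
  rw [RCLike.inner_apply', RCLike.inner_apply']
  exact h n

theorem dirichletEigenvalue_ne_zero (n : ℕ+) : (dirichletEigenvalue n : ℂ) ≠ 0 :=
  Complex.ofReal_ne_zero.2 (dirichletEigenvalue_neg n).ne

theorem isDiag_green : dirichletBasis.IsDiag green (fun n => (dirichletEigenvalue n : ℂ)⁻¹) :=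
  HilbertBasis.isDiag_of_apply fun n => by rw [dirichletBasis_apply, green_dirichletMode]

theorem isDiagonalOperator_dirichletLaplacian :
    dirichletBasis.IsDiagonalOperator dirichletLaplacian
      (fun n => (dirichletEigenvalue n : ℂ)) := by
  intro x y
  rw [mem_dirichletLaplacian_graph]
  constructor
  · rintro rfl n
    rw [isDiag_green, mul_inv_cancel_left₀ (dirichletEigenvalue_ne_zero n)]
  · intro h
    refine dirichletBasis.ext_repr fun n => ?_
    rw [isDiag_green, h, inv_mul_cancel_left₀ (dirichletEigenvalue_ne_zero n)]

theorem isBoundaryControlSystem_heat : IsBoundaryControlSystem heatMax heatTrace where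
  closed := heatMax_isClosed
  domain_eq := heatTrace_domain
  bounded := heatTrace_bounded
  generator := HilbertBasis.exists_generates isDiagonalOperator_dirichletLaplacian
    fun n => (dirichletEigenvalue_neg n).le
  rightInverse := ⟨dirichletLift, isRightInverse_dirichletLift⟩

/-- A crude gap below zero; `1` serves as the convenient lower bound for `-λ_n` in the resolvent and
ray estimates. -/
theorem dirichletEigenvalue_le (n : ℕ+) : dirichletEigenvalue n ≤ -1 := by
  have h1 : (1 : ℝ) ≤ n := by exact_mod_cast n.pos
  have h2 : (1 : ℝ) ≤ n ^ 2 := one_le_pow₀ h1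
  have h3 : (1 : ℝ) ≤ Real.pi ^ 2 := one_le_pow₀ (by linarith [Real.pi_gt_three])
  unfold dirichletEigenvalue
  nlinarith

theorem zero_mem_unboundedResolventSet_dirichletLaplacian :
    (0 : ℂ) ∈ unboundedResolventSet dirichletLaplacian := by
  refine isDiagonalOperator_dirichletLaplacian.mem_unboundedResolventSet one_pos fun n => ?_
  rw [zero_sub, norm_neg, Complex.norm_real, Real.norm_of_nonpos (dirichletEigenvalue_neg n).le]
  linarith [dirichletEigenvalue_le n]

/-- The origin of the coefficients `b_n`: integrating `√2 ξ sin(nπξ)` by parts leaves only the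
boundary term at `1`, namely `(-1)^(n+1) √2 / (nπ)`. -/
theorem repr_idState (n : ℕ+) :
    dirichletBasis.repr idState n = -((dirichletCoeff n : ℂ) / dirichletEigenvalue n) := by
  have hk : (n * Real.pi : ℝ) ≠ 0 :=
    mul_ne_zero (by exact_mod_cast n.pos.ne') Real.pi_ne_zero
  have hcos : Real.cos (n * Real.pi) = (-1) ^ (n : ℕ) := Real.cos_nat_mul_pi n
  have hsin : Real.sin (n * Real.pi) = 0 := Real.sin_nat_mul_pi n
  have hlam : dirichletEigenvalue n = -(n * Real.pi) ^ 2 := by rw [dirichletEigenvalue]; ring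
  have hco : dirichletCoeff n = (-1) ^ ((n : ℕ) + 1) * (Real.sqrt 2 * (n * Real.pi)) := by
    rw [dirichletCoeff]; ring
  rw [dirichletBasis.repr_apply_apply, dirichletBasis_apply, dirichletMode_eq, idState,
    inner_ofContinuous]
  simp only [Complex.conj_ofReal, ← Complex.ofReal_mul]
  rw [intervalIntegral.integral_ofReal, ← Complex.ofReal_div, ← Complex.ofReal_neg, hlam, hco]
  congr 1
  set k : ℝ := n * Real.pi
  have hd : ∀ ξ ∈ uIcc (0 : ℝ) 1, HasDerivAt
      (fun ξ : ℝ => Real.sqrt 2 * (Real.sin (k * ξ) / k ^ 2 - ξ * Real.cos (k * ξ) / k))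
      (Real.sqrt 2 * Real.sin (k * ξ) * ξ) ξ := by
    intro ξ _
    have h0 := (hasDerivAt_id ξ).const_mul k
    have h1 := ((h0.sin.div_const (k ^ 2)).sub
      (((hasDerivAt_id ξ).mul h0.cos).div_const k)).const_mul (Real.sqrt 2)
    refine h1.congr_deriv ?_
    simp only [id]
    field_simp
    ring
  rw [intervalIntegral.integral_eq_sub_of_hasDerivAt hd
    ((by fun_prop : Continuous fun ξ : ℝ => Real.sqrt 2 * Real.sin (k * ξ) * ξ).intervalIntegrable
      _ _), mul_one, hsin, hcos]
  simp only [mul_zero, Real.sin_zero, zero_div, zero_mul, sub_zero, one_mul, zero_sub]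
  field_simp
  ring

section ControlOperator

variable {s : ℂ} {R : HeatState →L[ℂ] HeatState}

/-- The control operator, seen in `X` through the isometry of `X₋₁` with `X`. -/
def controlState (s : ℂ) (R : HeatState →L[ℂ] HeatState) : HeatState :=
  idState - s • R idState

variable (hs : ∀ n : ℕ+, s - (dirichletEigenvalue n : ℂ) ≠ 0)
  (hR : dirichletBasis.IsDiag R (fun n => (s - (dirichletEigenvalue n : ℂ))⁻¹))

include hs hR in
-- The factor `1 - s/(s - λ_n) = -λ_n/(s - λ_n)` cancels the denominator of the coefficient
-- `-b_n/λ_n`.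
theorem repr_controlState (n : ℕ+) : dirichletBasis.repr (controlState s R) n =
    (dirichletCoeff n : ℂ) * (s - (dirichletEigenvalue n : ℂ))⁻¹ := by
  rw [controlState, dirichletBasis.repr_sub_apply, dirichletBasis.repr_smul_apply, hR,
    repr_idState]
  have h1 := hs n
  have h2 := dirichletEigenvalue_ne_zero n
  field_simp
  ring

variable (hd : DenseRange R)

/-- The control operator with values in `X₋₁`. -/
def controlOperator (s : ℂ) (R : HeatState →L[ℂ] HeatState) (hd : DenseRange R) :
    ℂ →L[ℂ] ExtrapSpace R :=
  ((extrapEquiv R hd).symm.toContinuousLinearEquiv.toContinuousLinearMap).comp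
    (ContinuousLinearMap.toSpanSingleton ℂ (controlState s R))

theorem extrapEquiv_controlOperator (z : ℂ) :
    extrapEquiv R hd (controlOperator s R hd z) = z • controlState s R :=
  (extrapEquiv R hd).apply_symm_apply _

include hs hR in
-- `s R - I = A R` is `A₋₁` seen through the isometry of `X₋₁` with `X`.
theorem isDiag_smul_sub_id : dirichletBasis.IsDiag (s • R - ContinuousLinearMap.id ℂ HeatState)
    (fun n => dirichletEigenvalue n * (s - (dirichletEigenvalue n : ℂ))⁻¹) := by
  intro x n
  rw [sub_apply, smul_apply, ContinuousLinearMap.id_apply, dirichletBasis.repr_sub_apply,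
    dirichletBasis.repr_smul_apply, hR]
  have h1 := hs n
  field_simp
  ring

include hs hR in
-- `A₁` is determined by its values on the eigenfunctions. Any right inverse differs from `u ↦ u ·
-- id` by a term `green h` in `D(A)`, on which `𝔄` and `A₋₁` agree, so neither choice affects `B`.
theorem isControlOperator_iff (B : ℂ →L[ℂ] ExtrapSpace R) :
    IsControlOperator heatMax heatTrace R B ↔ B = controlOperator s R hd := by
  constructor
  · rintro ⟨A₁, B₀, h1, h2, h3⟩
    have hA : dirichletBasis.IsDiag
        ((extrapEquiv R hd).toContinuousLinearEquiv.toContinuousLinearMap.comp A₁)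
        (fun n => dirichletEigenvalue n * (s - (dirichletEigenvalue n : ℂ))⁻¹) := by
      refine HilbertBasis.isDiag_of_apply fun n => ?_
      have h4 := h1 _ _ (isDiagonalOperator_dirichletLaplacian.basis_mem_graph n)
      change extrapEquiv R hd (A₁ (dirichletBasis n)) = _
      rw [h4, extrapEquiv_embed, map_smul, hR.apply_basis, smul_smul]
    refine ContinuousLinearMap.ext fun u => (extrapEquiv R hd).injective ?_
    rw [extrapEquiv_controlOperator, h3 u, map_sub, extrapEquiv_embed]
    refine dirichletBasis.ext_repr fun n => ?_
    rw [dirichletBasis.repr_sub_apply, dirichletBasis.repr_smul_apply, repr_controlState hs hR, hR]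
    have h5 := hA (B₀ u).1.1 n
    change dirichletBasis.repr (extrapEquiv R hd (A₁ (B₀ u).1.1)) n = _ at h5
    rw [h5]
    obtain ⟨c, hc⟩ := mem_heatMax_graph.1 (B₀ u).2
    have h6 := (mem_heatTrace_graph.1 (h2 u)).2
    rw [hc] at h6
    have h7 := h6.unique (hasPointValue_one_of_heatMax c _) (by simp)
    have h8 : (B₀ u).1.1 = u • idState + green (B₀ u).1.2 := by
      rw [hc, eq_sub_of_add_eq h7.symm, green_apply, sub_smul]
      abel
    rw [h8, dirichletBasis.repr_add_apply, dirichletBasis.repr_smul_apply, isDiag_green,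
      repr_idState]
    have h9 := dirichletEigenvalue_ne_zero n
    field_simp
    ring
  · rintro rfl
    refine ⟨(extrapEquiv R hd).symm.toContinuousLinearEquiv.toContinuousLinearMap.comp
      (s • R - ContinuousLinearMap.id ℂ HeatState), dirichletLift, fun x y hxy => ?_,
      isRightInverse_dirichletLift, fun u => ?_⟩
    · refine (extrapEquiv R hd).injective ?_
      rw [extrapEquiv_embed]
      refine ((extrapEquiv R hd).apply_symm_apply _).trans ?_
      refine dirichletBasis.ext_repr fun n => ?_
      refine (isDiag_smul_sub_id hs hR x n).trans ?_
      rw [hR, (isDiagonalOperator_dirichletLaplacian x y).1 hxy]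
      ring
    · rw [dirichletLift_fst, dirichletLift_snd, map_zero, zero_sub]
      refine (extrapEquiv R hd).injective ?_
      rw [extrapEquiv_controlOperator, map_neg]
      have h1 : extrapEquiv R hd
          (((extrapEquiv R hd).symm.toContinuousLinearEquiv.toContinuousLinearMap.comp
            (s • R - ContinuousLinearMap.id ℂ HeatState)) (u • idState)) =
          (s • R - ContinuousLinearMap.id ℂ HeatState) (u • idState) :=
        (extrapEquiv R hd).apply_symm_apply _
      rw [h1, map_smul, ← smul_neg, controlState, sub_apply, smul_apply,
        ContinuousLinearMap.id_apply, neg_sub]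

/-- Integration by parts against `ξ`. For `y = green h` the right-hand side is `y'(1)`, since `y' =
V h - total (V h)`. -/
theorem inner_idState (h : HeatState) :
    inner ℂ idState h = total h - total (volterra h) := by
  rw [L2.inner_def]
  have h1 : ∫ ξ in Icc (0 : ℝ) 1, inner ℂ (idState ξ) (h ξ) =
      ∫ ξ in Icc (0 : ℝ) 1, id ξ • h ξ := by
    refine integral_congr_ae ?_
    filter_upwards [coeFn_ofContinuous (fun ξ => (ξ : ℂ)) Complex.continuous_ofReal] with ξ hξ
    rw [idState, hξ, RCLike.inner_apply, Complex.conj_ofReal, mul_comm, id, Complex.real_smul]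
  rw [h1, h.integral_smul_eq_sub contDiff_id, total_eq_integral (volterra h), total_apply]
  simp only [id, one_smul, deriv_id']
  congr 1
  exact (integral_congr_ae h.coeFn_volterra).symm

include hs hR in
-- Through the isometry, pairing with `y` becomes the inner product with `(conj s - A) y`, whose
-- conjugate coordinates cancel the factors `(s - λ_n)⁻¹`. Applied to the control vector it leaves
-- `-⟨A y, id⟩`, the conjugate of `-y'(1)`.
theorem isDeltaPrimeOne_controlOperator : IsDeltaPrimeOne R (controlOperator s R hd) := by
  intro y hy
  obtain ⟨h, hh⟩ := LinearPMap.mem_domain_iff.1 hy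
  have hco := (isDiagonalOperator_dirichletLaplacian y h).1 hh
  have hy' : y = green h := mem_dirichletLaplacian_graph.1 hh
  refine ⟨(-total (volterra h)) • one + volterra h, total h - total (volterra h),
    (innerSL ℂ ((starRingEnd ℂ) s • y - h)).comp
      (extrapEquiv R hd).toContinuousLinearEquiv.toContinuousLinearMap, ?_, ?_, fun x => ?_,
    fun z => ?_⟩
  · refine hasWeakDeriv_iff.2 ⟨0, ?_⟩
    rw [hy', green_apply, map_add, map_smul, volterra_one, neg_smul, zero_smul]
    abel
  · have := ((hasPointValue_one 1).smul (-total (volterra h))).add (hasPointValue_volterra h 1)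
    convert this using 1
    rw [total_apply h, smul_eq_mul]
    ring
  · change inner ℂ ((starRingEnd ℂ) s • y - h) (extrapEquiv R hd (extrapEmbed R x)) = _
    rw [extrapEquiv_embed]
    refine dirichletBasis.inner_eq_of_repr fun n => ?_
    rw [dirichletBasis.repr_sub_apply, dirichletBasis.repr_smul_apply, hR, hco, map_sub, map_mul,
      map_mul, Complex.conj_conj, Complex.conj_ofReal]
    have h1 := hs n
    field_simp
  · change inner ℂ ((starRingEnd ℂ) s • y - h) (extrapEquiv R hd (controlOperator s R hd z)) = _
    rw [extrapEquiv_controlOperator, inner_smul_right]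
    congr 1
    rw [← inner_idState, ← inner_neg_right, inner_conj_symm]
    refine dirichletBasis.inner_eq_of_repr fun n => ?_
    have h3 : dirichletBasis.repr (-h) n = -dirichletBasis.repr h n := by
      rw [← neg_one_smul ℂ, dirichletBasis.repr_smul_apply, neg_one_mul]
    rw [dirichletBasis.repr_sub_apply, dirichletBasis.repr_smul_apply, repr_controlState hs hR,
      h3, hco, repr_idState, map_sub, map_neg, map_mul, map_mul, Complex.conj_conj,
      Complex.conj_ofReal]
    have h1 := hs n
    have h2 := dirichletEigenvalue_ne_zero n
    field_simp

include hs hR in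
theorem hasSum_controlOperator : HasSum (fun n : ℕ+ => (dirichletCoeff n : ℂ) •
    extrapEmbed R (dirichletMode n)) (controlOperator s R hd 1) := by
  have h1 := (extrapEquiv R hd).symm.toContinuousLinearEquiv.toContinuousLinearMap.hasSum
    (dirichletBasis.hasSum_repr (controlState s R))
  convert h1 using 1
  · funext n
    refine (extrapEquiv R hd).injective ?_
    refine Eq.trans ?_ ((extrapEquiv R hd).apply_symm_apply _).symm
    rw [map_smul, extrapEquiv_embed, ← dirichletBasis_apply, hR.apply_basis, smul_smul,
      repr_controlState hs hR]
  · refine (extrapEquiv R hd).injective ?_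
    rw [extrapEquiv_controlOperator, one_smul]
    exact ((extrapEquiv R hd).apply_symm_apply _).symm

end ControlOperator

/-! ### Fractional powers of diagonal operators -/

/-- The point `r e^(iθ)`. -/
def rayPoint (θ r : ℝ) : ℂ := (r : ℂ) * Complex.exp (θ * Complex.I)

theorem abs_sin_mul_le_norm_rayPoint_sub (θ : ℝ) {r : ℝ} (hr : 0 ≤ r) (x : ℝ) :
    |Real.sin θ| * r ≤ ‖rayPoint θ r - x‖ := by
  refine le_trans (le_of_eq ?_) (Complex.abs_im_le_norm _)
  rw [rayPoint, Complex.sub_im, Complex.ofReal_im, sub_zero, Complex.im_ofReal_mul,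
    Complex.exp_ofReal_mul_I_im, abs_mul, abs_of_nonneg hr, mul_comm]

/-- A rotation by `-θ` exchanges the roles of `r` and `x`. This bound is used near the origin, the
preceding one far out on the ray. -/
theorem abs_sin_mul_le_norm_rayPoint_sub' (θ r : ℝ) {x : ℝ} (hx : 0 ≤ x) :
    |Real.sin θ| * x ≤ ‖rayPoint θ r - x‖ := by
  have h1 : rayPoint θ r - x =
      -Complex.exp (θ * Complex.I) * (rayPoint (-θ) x - r) := by
    rw [rayPoint, rayPoint, Complex.ofReal_neg, neg_mul (θ : ℂ), Complex.exp_neg]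
    field_simp [Complex.exp_ne_zero]
    ring
  rw [h1, norm_mul, norm_neg, Complex.norm_exp_ofReal_mul_I, one_mul]
  simpa using abs_sin_mul_le_norm_rayPoint_sub (-θ) hx r

theorem norm_inv_rayPoint_sub_le {θ r x : ℝ} (hθ : Real.sin θ ≠ 0) (hr : 0 ≤ r) (hx : 1 ≤ x) :
    ‖(rayPoint θ r - x)⁻¹‖ ≤ |Real.sin θ|⁻¹ * (max r 1)⁻¹ := by
  have hσ : 0 < |Real.sin θ| := abs_pos.2 hθ
  rw [norm_inv, ← mul_inv]
  refine inv_anti₀ (mul_pos hσ (lt_max_of_lt_right one_pos)) ?_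
  rcases le_total r 1 with h | h
  · rw [max_eq_right h]
    exact (mul_le_mul_of_nonneg_left hx hσ.le).trans
      (abs_sin_mul_le_norm_rayPoint_sub' θ r (zero_le_one.trans hx))
  · rw [max_eq_left h]
    exact abs_sin_mul_le_norm_rayPoint_sub θ hr x

theorem rayPoint_sub_ne_zero {θ : ℝ} (hθ : Real.sin θ ≠ 0) (r : ℝ) {x : ℝ} (hx : 0 < x) :
    rayPoint θ r - x ≠ 0 :=
  norm_pos_iff.1 ((mul_pos (abs_pos.2 hθ) hx).trans_le
    (abs_sin_mul_le_norm_rayPoint_sub' θ r hx.le))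

theorem rayPoint_cpow_mul {θ r : ℝ} (h1 : -Real.pi < θ) (h2 : θ ≤ Real.pi) (hr : 0 < r) (β : ℝ) :
    rayPoint θ r ^ (-(β : ℂ)) * Complex.exp (θ * Complex.I) =
      (r ^ (-β) : ℝ) * Complex.exp (((1 - β) * θ : ℝ) * Complex.I) := by
  have hne : rayPoint θ r ≠ 0 :=
    mul_ne_zero (Complex.ofReal_ne_zero.2 hr.ne') (Complex.exp_ne_zero _)
  rw [Complex.cpow_def_of_ne_zero hne, rayPoint, Complex.log_ofReal_mul hr (Complex.exp_ne_zero _),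
    Complex.log_exp (by simpa using h1) (by simpa using h2), Complex.ofReal_cpow hr.le,
    Complex.cpow_def_of_ne_zero (Complex.ofReal_ne_zero.2 hr.ne'), ← Complex.exp_add,
    ← Complex.exp_add, ← Complex.ofReal_log hr.le]
  congr 1
  push_cast
  ring

/-- Integrability at `0` comes from `β < 1`, at infinity from `β > 0`. -/
theorem integrableOn_rpow_mul_inv_max {β : ℝ} (h0 : 0 < β) (h1 : β < 1) :
    IntegrableOn (fun r : ℝ => r ^ (-β) * (max r 1)⁻¹) (Ioi 0) := by
  rw [← Ioc_union_Ioi_eq_Ioi zero_le_one]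
  refine IntegrableOn.union ?_ ?_
  · have h := (intervalIntegral.intervalIntegrable_rpow' (a := 0) (b := 1)
      (show -1 < -β by linarith)).1
    refine h.congr_fun (fun r hr => ?_) measurableSet_Ioc
    simp only [max_eq_right hr.2, inv_one, mul_one]
  · have h := integrableOn_Ioi_rpow_of_lt (show -β - 1 < -1 by linarith) one_pos
    refine h.congr_fun (fun r hr => ?_) measurableSet_Ioi
    have hr0 : (0 : ℝ) < r := one_pos.trans hr
    simp only [max_eq_left (mem_Ioi.1 hr).le]
    rw [Real.rpow_sub hr0, Real.rpow_one, div_eq_mul_inv]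

/-- The scalar integrand of the fractional power, on the ray of angle `θ`. -/
def rayIntegrand (β θ x r : ℝ) : ℂ :=
  (r ^ (-β) : ℝ) * Complex.exp (((1 - β) * θ : ℝ) * Complex.I) * (rayPoint θ r - x)⁻¹

theorem continuousOn_rpow_neg (β : ℝ) : ContinuousOn (fun r : ℝ => r ^ (-β)) (Ioi 0) :=
  fun r hr => (Real.continuousAt_rpow_const r _ (Or.inl (ne_of_gt hr))).continuousWithinAt

theorem continuous_rayPoint (θ : ℝ) : Continuous (rayPoint θ) := by
  unfold rayPoint
  fun_prop

theorem integrableOn_rayIntegrand {β θ x : ℝ} (h0 : 0 < β) (h1 : β < 1) (hθ : Real.sin θ ≠ 0)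
    (hx : 1 ≤ x) : IntegrableOn (rayIntegrand β θ x) (Ioi 0) := by
  refine ((integrableOn_rpow_mul_inv_max h0 h1).const_mul |Real.sin θ|⁻¹).mono' ?_ ?_
  · refine ContinuousOn.aestronglyMeasurable ?_ measurableSet_Ioi
    unfold rayIntegrand
    refine ContinuousOn.mul (ContinuousOn.mul ?_ continuousOn_const) ?_
    · exact Complex.continuous_ofReal.comp_continuousOn (continuousOn_rpow_neg β)
    · exact ContinuousOn.inv₀ ((continuous_rayPoint θ).sub continuous_const).continuousOn
        fun r _ => rayPoint_sub_ne_zero hθ r (one_pos.trans_le hx)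
  · filter_upwards [ae_restrict_mem measurableSet_Ioi] with r hr
    have hr0 : 0 ≤ r ^ (-β) := Real.rpow_nonneg (le_of_lt hr) _
    rw [rayIntegrand, norm_mul, norm_mul, Complex.norm_exp_ofReal_mul_I, mul_one,
      Complex.norm_real, Real.norm_of_nonneg hr0]
    calc _ ≤ r ^ (-β) * (|Real.sin θ|⁻¹ * (max r 1)⁻¹) :=
          mul_le_mul_of_nonneg_left (norm_inv_rayPoint_sub_le hθ (le_of_lt hr) hx) hr0
      _ = _ := by ring

/-- The substitution `r ↦ x r` extracts `x^(-β)`, leaving a constant common to all eigenvalues; no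
residue is computed. -/
theorem integral_rayIntegrand_eq (β θ : ℝ) {x : ℝ} (hx : 0 < x) :
    ∫ r in Ioi 0, rayIntegrand β θ x r =
      (x ^ (-β) : ℝ) * ∫ r in Ioi 0, rayIntegrand β θ 1 r := by
  have h1 := integral_comp_mul_left_Ioi (rayIntegrand β θ x) 0 hx
  have h2 : ∀ r ∈ Ioi (0 : ℝ), rayIntegrand β θ x (x * r) =
      ((x ^ (-β) * x⁻¹ : ℝ) : ℂ) * rayIntegrand β θ 1 r := by
    intro r hr
    have h3 : rayPoint θ (x * r) - x = x * (rayPoint θ r - (1 : ℝ)) := by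
      rw [rayPoint, rayPoint]
      push_cast
      ring
    rw [rayIntegrand, rayIntegrand, h3, mul_inv, Real.mul_rpow hx.le (le_of_lt hr)]
    push_cast
    ring
  rw [setIntegral_congr_fun measurableSet_Ioi h2, integral_const_mul, mul_zero,
    Complex.real_smul] at h1
  have hxc : (x : ℂ) ≠ 0 := Complex.ofReal_ne_zero.2 hx.ne'
  calc _ = (x : ℂ) * ((x⁻¹ : ℝ) * ∫ r in Ioi 0, rayIntegrand β θ x r) := by
        push_cast
        rw [mul_inv_cancel_left₀ hxc]
    _ = _ := by
        rw [← h1]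
        push_cast
        field_simp

theorem rayIntegrand_neg (β θ x r : ℝ) :
    rayIntegrand β (-θ) x r = (starRingEnd ℂ) (rayIntegrand β θ x r) := by
  simp only [rayIntegrand, rayPoint, map_mul, map_inv₀, map_sub, Complex.conj_ofReal,
    ← Complex.exp_conj, Complex.conj_I]
  push_cast
  ring_nf

/-- Clearing the denominator with its conjugate leaves a positive multiple of `r e^(-iβθ) -
e^(i(1-β)θ)`; both terms contribute negatively since `βθ` and `(1-β)θ` lie in `(0, π)`. -/
theorem im_rayIntegrand_neg_of_pos {β θ r : ℝ} (h0 : 0 < β) (h1 : β < 1) (hθ : 0 < θ)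
    (hθ' : θ ≤ Real.pi / 2) (hr : 0 < r) : (rayIntegrand β θ 1 r).im < 0 := by
  have hpi := Real.pi_pos
  have hsin : 0 < Real.sin θ := Real.sin_pos_of_pos_of_lt_pi hθ (by linarith)
  have hb1 : 0 < Real.sin (β * θ) :=
    Real.sin_pos_of_pos_of_lt_pi (by positivity) (by nlinarith)
  have hb2 : 0 < Real.sin ((1 - β) * θ) :=
    Real.sin_pos_of_pos_of_lt_pi (mul_pos (by linarith) hθ) (by nlinarith)
  have hn : 0 < Complex.normSq (rayPoint θ r - (1 : ℝ)) :=
    Complex.normSq_pos.2 (rayPoint_sub_ne_zero hsin.ne' r one_pos)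
  have h2 : rayIntegrand β θ 1 r =
      ((r ^ (-β) * (Complex.normSq (rayPoint θ r - (1 : ℝ)))⁻¹ : ℝ) : ℂ) *
        ((r : ℂ) * Complex.exp ((-(β * θ) : ℝ) * Complex.I) -
          Complex.exp (((1 - β) * θ : ℝ) * Complex.I)) := by
    have h3 : (starRingEnd ℂ) (rayPoint θ r - (1 : ℝ)) =
        r * Complex.exp ((-θ : ℝ) * Complex.I) - 1 := by
      rw [rayPoint, map_sub, map_mul, ← Complex.exp_conj]
      simp
    have h4 : Complex.exp ((-(β * θ) : ℝ) * Complex.I) =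
        Complex.exp (((1 - β) * θ : ℝ) * Complex.I) * Complex.exp ((-θ : ℝ) * Complex.I) := by
      rw [← Complex.exp_add]
      congr 1
      push_cast
      ring
    rw [rayIntegrand, Complex.inv_def, h3, h4]
    push_cast
    ring
  rw [h2, Complex.im_ofReal_mul, Complex.sub_im, Complex.im_ofReal_mul,
    Complex.exp_ofReal_mul_I_im, Complex.exp_ofReal_mul_I_im, Real.sin_neg]
  have h5 : 0 < r ^ (-β) * (Complex.normSq (rayPoint θ r - (1 : ℝ)))⁻¹ :=
    mul_pos (Real.rpow_pos_of_pos hr _) (inv_pos.2 hn)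
  nlinarith [mul_pos hr hb1]

/-- The two legs are complex conjugates, so their difference is a nonzero multiple of the imaginary
part, which has a strict sign. Only non-vanishing of this constant matters: a factor does not change
the space `X_{-β}`. -/
theorem integral_rayIntegrand_sub_ne_zero {β φ : ℝ} (h0 : 0 < β) (h1 : β < 1) (hφ : 0 < φ)
    (hφ' : φ ≤ Real.pi / 2) :
    (∫ r in Ioi 0, rayIntegrand β (-φ) 1 r) - ∫ r in Ioi 0, rayIntegrand β φ 1 r ≠ 0 := by
  have hsin : Real.sin φ ≠ 0 :=
    (Real.sin_pos_of_pos_of_lt_pi hφ (by linarith [Real.pi_pos])).ne'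
  have hint := integrableOn_rayIntegrand h0 h1 hsin le_rfl
  have him : IntegrableOn (fun r => -(rayIntegrand β φ 1 r).im) (Ioi 0) := hint.im.neg
  have hpos : 0 < ∫ r in Ioi 0, -(rayIntegrand β φ 1 r).im := by
    have hlt : ∀ r ∈ Ioi (0 : ℝ), 0 < -(rayIntegrand β φ 1 r).im := fun r hr =>
      neg_pos.2 (im_rayIntegrand_neg_of_pos h0 h1 hφ hφ' hr)
    rw [setIntegral_pos_iff_support_of_nonneg_ae ?_ him]
    · have hsub : Ioi (0 : ℝ) ⊆ Function.support fun r => -(rayIntegrand β φ 1 r).im :=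
        fun r hr => (hlt r hr).ne'
      rw [inter_eq_right.2 hsub, Real.volume_Ioi]
      exact ENNReal.zero_lt_top
    · filter_upwards [ae_restrict_mem measurableSet_Ioi] with r hr using (hlt r hr).le
  have hconj : ∫ r in Ioi 0, rayIntegrand β (-φ) 1 r =
      (starRingEnd ℂ) (∫ r in Ioi 0, rayIntegrand β φ 1 r) := by
    rw [← integral_conj]
    simp only [rayIntegrand_neg]
  have himI : (∫ r in Ioi 0, rayIntegrand β φ 1 r).im = ∫ r in Ioi 0, (rayIntegrand β φ 1 r).im :=
    (integral_im hint).symm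
  rw [integral_neg] at hpos
  intro h
  have h2 := congrArg Complex.im h
  rw [hconj, Complex.sub_im, Complex.conj_im, himI, Complex.zero_im] at h2
  linarith

namespace HilbertBasis

variable {ι X : Type*} [NormedAddCommGroup X] [InnerProductSpace ℂ X]
  {b : HilbertBasis ι ℂ X}

theorem IsDiag.norm_multiplier_le {S : X →L[ℂ] X} {m : ι → ℂ} (h : b.IsDiag S m) (n : ι) :
    ‖m n‖ ≤ ‖S‖ := by
  have h1 := S.le_opNorm (b n)
  rwa [h.apply_basis, norm_smul, b.orthonormal.1 n, mul_one, mul_one] at h1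

theorem isDiag_integral [CompleteSpace X] {S : ℝ → X →L[ℂ] X} {m : ℝ → ι → ℂ} {s : Set ℝ}
    (hs : MeasurableSet s) (hS : IntegrableOn S s) (h : ∀ r ∈ s, b.IsDiag (S r) (m r)) :
    b.IsDiag (∫ r in s, S r) (fun n => ∫ r in s, m r n) := by
  intro x n
  have h1 := ((innerSL ℂ (b n)).comp (ContinuousLinearMap.apply ℂ X x)).integral_comp_comm hS
  have h2 : ∀ S' : X →L[ℂ] X, ((innerSL ℂ (b n)).comp (ContinuousLinearMap.apply ℂ X x)) S' =
      b.repr (S' x) n := fun S' => (b.repr_apply_apply _ _).symm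
  simp only [h2] at h1
  rw [← h1, setIntegral_congr_fun hs fun r hr => h r hr x n, integral_mul_const]

variable {A : X →ₗ.[ℂ] X} {l : ι → ℝ}

theorem isDiag_resolventOp_rayPoint
    (hA : b.IsDiagonalOperator A (fun n => (l n : ℂ))) (hl : ∀ n, l n ≤ -1)
    {θ r : ℝ} (hθ : Real.sin θ ≠ 0) :
    b.IsDiag (resolventOp (-A) (rayPoint θ r)) (fun n => (rayPoint θ r - (-l n : ℝ))⁻¹) := by
  have h1 : b.IsDiagonalOperator (-A) (fun n => ((-l n : ℝ) : ℂ)) := by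
    simpa only [Complex.ofReal_neg] using hA.neg
  refine (h1.isDiag_resolventOp
    (h1.mem_unboundedResolventSet (abs_pos.2 hθ) fun n => ?_)).2
  have h2 : (1 : ℝ) ≤ -l n := by linarith [hl n]
  exact (le_mul_of_one_le_right (abs_nonneg _) h2).trans
    (abs_sin_mul_le_norm_rayPoint_sub' θ r (zero_le_one.trans h2))

/-- Needed for measurability of the operator-valued integrand; the Lipschitz constant comes from the
uniform distance `|sin θ|` between ray and eigenvalues. -/
theorem continuous_resolventOp_rayPoint
    (hA : b.IsDiagonalOperator A (fun n => (l n : ℂ))) (hl : ∀ n, l n ≤ -1)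
    {θ : ℝ} (hθ : Real.sin θ ≠ 0) :
    Continuous (fun r => resolventOp (-A) (rayPoint θ r)) := by
  have hσ : 0 < |Real.sin θ| := abs_pos.2 hθ
  refine (LipschitzWith.of_dist_le_mul (K := ⟨(|Real.sin θ| * |Real.sin θ|)⁻¹, by positivity⟩)
    fun r r' => ?_).continuous
  rw [dist_eq_norm, dist_eq_norm]
  refine ((isDiag_resolventOp_rayPoint hA hl hθ).sub
    (isDiag_resolventOp_rayPoint hA hl hθ)).opNorm_le
      (mul_nonneg (NNReal.coe_nonneg _) (norm_nonneg _)) fun n => ?_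
  have h2 : (1 : ℝ) ≤ -l n := by linarith [hl n]
  have hb : ∀ r, |Real.sin θ| ≤ ‖rayPoint θ r - (-l n : ℝ)‖ := fun r =>
    (le_mul_of_one_le_right (abs_nonneg _) h2).trans
      (abs_sin_mul_le_norm_rayPoint_sub' θ r (zero_le_one.trans h2))
  have hne := fun r => rayPoint_sub_ne_zero hθ r (one_pos.trans_le h2)
  have h3 : ‖rayPoint θ r' - rayPoint θ r‖ = ‖r - r'‖ := by
    rw [rayPoint, rayPoint, ← sub_mul, norm_mul, Complex.norm_exp_ofReal_mul_I, mul_one,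
      ← Complex.ofReal_sub, Complex.norm_real, norm_sub_rev]
  rw [inv_sub_inv (hne r) (hne r'), sub_sub_sub_cancel_right, norm_div, norm_mul, h3, div_eq_inv_mul]
  refine mul_le_mul_of_nonneg_right (inv_anti₀ (by positivity) ?_) (norm_nonneg _)
  exact mul_le_mul (hb r) (hb r') hσ.le (norm_nonneg _)

/-- The fractional power `(-A)^(-β)` is a nonzero multiple of the diagonal operator with the
multipliers `(-l n)^(-β)`. -/
theorem exists_isDiag_negFracPow [CompleteSpace X]
    (hA : b.IsDiagonalOperator A (fun n => (l n : ℂ))) (hl : ∀ n, l n ≤ -1)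
    {β φ : ℝ} (h0 : 0 < β) (h1 : β < 1) (hφ : 0 < φ) (hφ' : φ ≤ Real.pi / 2) :
    ∃ c : ℂ, c ≠ 0 ∧ b.IsDiag (negFracPow A φ β) (fun n => c * ((-l n) ^ (-β) : ℝ)) := by
  have hpi := Real.pi_pos
  have hsin : Real.sin φ ≠ 0 := (Real.sin_pos_of_pos_of_lt_pi hφ (by linarith)).ne'
  let leg : ℝ → X →L[ℂ] X := fun θ => ∫ r in Ioi (0 : ℝ),
    (rayPoint θ r ^ (-(β : ℂ)) * Complex.exp (θ * Complex.I)) • resolventOp (-A) (rayPoint θ r)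
  have hleg : ∀ θ, -Real.pi < θ → θ ≤ Real.pi → Real.sin θ ≠ 0 →
      b.IsDiag (leg θ) (fun n => ((-l n) ^ (-β) : ℝ) * ∫ r in Ioi 0, rayIntegrand β θ 1 r) := by
    intro θ hθ1 hθ2 hθ
    have e1 : leg θ = ∫ r in Ioi (0 : ℝ), ((r ^ (-β) : ℝ) *
        Complex.exp (((1 - β) * θ : ℝ) * Complex.I)) • resolventOp (-A) (rayPoint θ r) :=
      setIntegral_congr_fun measurableSet_Ioi fun r hr => by
        simp only [rayPoint_cpow_mul hθ1 hθ2 hr]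
    have e2 : IntegrableOn (fun r : ℝ => ((r ^ (-β) : ℝ) *
        Complex.exp (((1 - β) * θ : ℝ) * Complex.I)) • resolventOp (-A) (rayPoint θ r))
        (Ioi 0) := by
      refine ((integrableOn_rpow_mul_inv_max h0 h1).const_mul |Real.sin θ|⁻¹).mono' ?_ ?_
      · refine ContinuousOn.aestronglyMeasurable ?_ measurableSet_Ioi
        have hc : ContinuousOn (fun r : ℝ => ((r ^ (-β) : ℝ) : ℂ)) (Ioi 0) :=
          Complex.continuous_ofReal.comp_continuousOn (continuousOn_rpow_neg β)
        exact (hc.mul continuousOn_const).smul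
          (continuous_resolventOp_rayPoint hA hl hθ).continuousOn
      · filter_upwards [ae_restrict_mem measurableSet_Ioi] with r hr
        have hr0 : 0 ≤ r ^ (-β) := Real.rpow_nonneg (le_of_lt hr) _
        rw [norm_smul, norm_mul, Complex.norm_exp_ofReal_mul_I, mul_one,
          Complex.norm_real, Real.norm_of_nonneg hr0]
        have h2 : ‖resolventOp (-A) (rayPoint θ r)‖ ≤ |Real.sin θ|⁻¹ * (max r 1)⁻¹ :=
          (isDiag_resolventOp_rayPoint hA hl hθ).opNorm_le (by positivity) fun n =>
            norm_inv_rayPoint_sub_le hθ (le_of_lt hr) (by linarith [hl n])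
        calc _ ≤ r ^ (-β) * (|Real.sin θ|⁻¹ * (max r 1)⁻¹) :=
              mul_le_mul_of_nonneg_left h2 hr0
          _ = _ := by ring
    have e3 := isDiag_integral measurableSet_Ioi e2 fun r _ =>
      (isDiag_resolventOp_rayPoint (r := r) hA hl hθ).smul ((r ^ (-β) : ℝ) *
        Complex.exp (((1 - β) * θ : ℝ) * Complex.I))
    rw [← e1] at e3
    intro x n
    refine (e3 x n).trans ?_
    congr 1
    exact integral_rayIntegrand_eq β θ (x := -l n) (by linarith [hl n])
  refine ⟨(2 * Real.pi * Complex.I)⁻¹ * ((∫ r in Ioi 0, rayIntegrand β (-φ) 1 r) -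
      ∫ r in Ioi 0, rayIntegrand β φ 1 r), mul_ne_zero (inv_ne_zero Complex.two_pi_I_ne_zero)
      (integral_rayIntegrand_sub_ne_zero h0 h1 hφ hφ'), ?_⟩
  have e4 : negFracPow A φ β = (2 * Real.pi * Complex.I)⁻¹ • (leg (-φ) - leg φ) := rfl
  rw [e4]
  intro x n
  rw [((hleg (-φ) (by linarith) (by linarith) (by rwa [Real.sin_neg, neg_ne_zero])).sub
    (hleg φ (by linarith) (by linarith) hsin)).smul _ x n]
  ring

end HilbertBasis

/-! ### The range of the control operator -/

theorem norm_sq_dirichletCoeff (n : ℕ+) :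
    ‖(dirichletCoeff n : ℂ)‖ ^ 2 = 2 * Real.pi ^ 2 * (n : ℝ) ^ 2 := by
  rw [Complex.norm_real, Real.norm_eq_abs, sq_abs, dirichletCoeff]
  have h1 : (((-1 : ℝ)) ^ ((n : ℕ) + 1)) ^ 2 = 1 := by rw [← pow_mul, mul_comm, pow_mul]; simp
  have h2 : Real.sqrt 2 ^ 2 = 2 := Real.sq_sqrt (by norm_num)
  rw [mul_pow, h1, one_mul, mul_pow, mul_pow, h2]
  ring

theorem summable_pnat_rpow {p : ℝ} (hp : p < -1) : Summable fun n : ℕ+ => (n : ℝ) ^ p :=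
  (Real.summable_nat_rpow.2 hp).comp_injective PNat.coe_injective

theorem neg_dirichletEigenvalue_rpow (n : ℕ+) (q : ℝ) :
    (-dirichletEigenvalue n) ^ q = (Real.pi ^ (2 * q)) * (n : ℝ) ^ (2 * q) := by
  have h1 : (0 : ℝ) ≤ n := Nat.cast_nonneg _
  have h2 := Real.pi_pos.le
  rw [dirichletEigenvalue, neg_neg, ← mul_pow, ← Real.rpow_natCast,
    ← Real.rpow_mul (by positivity), Real.mul_rpow h1 h2, mul_comm]
  norm_num

/-- Read in `X` through both isometries, the embedding is the diagonal operator `D = R J⁻¹`, bounded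
because `(-λ_n)^β ≤ -λ_n`. The preimage of the control vector has coordinates `b_n` times the
multipliers of `J`, square summable since `2 - 4β < -1`. -/
theorem mapsIntoExtrap_controlOperator {s : ℂ} {R : HeatState →L[ℂ] HeatState}
    (hs : ∀ n : ℕ+, s - (dirichletEigenvalue n : ℂ) ≠ 0)
    (hR : dirichletBasis.IsDiag R (fun n => (s - (dirichletEigenvalue n : ℂ))⁻¹))
    (hd : DenseRange R) {φ β : ℝ} (hφ : 0 < φ) (hφ' : φ ≤ Real.pi / 2) (hβ : 3 / 4 < β)
    (hβ' : β < 1) :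
    MapsIntoExtrap R (negFracPow dirichletLaplacian φ β) (controlOperator s R hd) := by
  obtain ⟨c, hc, hJ⟩ := HilbertBasis.exists_isDiag_negFracPow
    isDiagonalOperator_dirichletLaplacian dirichletEigenvalue_le (by linarith) hβ' hφ hφ'
  set J := negFracPow dirichletLaplacian φ β
  have hx1 : ∀ n, 1 ≤ -dirichletEigenvalue n := fun n => by linarith [dirichletEigenvalue_le n]
  have hm : ∀ n, c * (((-dirichletEigenvalue n) ^ (-β) : ℝ) : ℂ) ≠ 0 := fun n =>
    mul_ne_zero hc (Complex.ofReal_ne_zero.2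
      (Real.rpow_pos_of_pos (one_pos.trans_le (hx1 n)) _).ne')
  have hdJ : DenseRange J := hJ.denseRange hm
  -- The multipliers of this bounded operator are `λ_n/(s - λ_n)`, so `K` bounds them uniformly for
  -- arbitrary `s`.
  set K := ‖s • R - ContinuousLinearMap.id ℂ HeatState‖
  obtain ⟨D, hD⟩ := dirichletBasis.exists_isDiag
    (m := fun n => (s - (dirichletEigenvalue n : ℂ))⁻¹ *
      (c * (((-dirichletEigenvalue n) ^ (-β) : ℝ) : ℂ))⁻¹) (C := ‖c‖⁻¹ * K) fun n => by
    have h1 := (isDiag_smul_sub_id hs hR).norm_multiplier_le n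
    have hx0 := one_pos.trans_le (hx1 n)
    have h2 : (-dirichletEigenvalue n) ^ β ≤ -dirichletEigenvalue n := by
      simpa using Real.rpow_le_rpow_of_exponent_le (hx1 n) hβ'.le
    rw [norm_mul, Complex.norm_real, Real.norm_of_nonpos (by linarith)] at h1
    rw [norm_mul, norm_inv (c * _), norm_mul, mul_inv, Complex.norm_real, Real.norm_of_nonneg
      (Real.rpow_nonneg hx0.le _), Real.rpow_neg hx0.le, inv_inv, mul_left_comm]
    refine mul_le_mul_of_nonneg_left (le_trans ?_ h1) (by positivity)
    rw [mul_comm]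
    exact mul_le_mul_of_nonneg_right h2 (norm_nonneg _)
  have hDm : ∀ n, (s - (dirichletEigenvalue n : ℂ))⁻¹ *
      (c * (((-dirichletEigenvalue n) ^ (-β) : ℝ) : ℂ))⁻¹ ≠ 0 := fun n =>
    mul_ne_zero (inv_ne_zero (hs n)) (inv_ne_zero (hm n))
  obtain ⟨w, hw⟩ := dirichletBasis.exists_repr_eq (c := fun n => (dirichletCoeff n : ℂ) *
      (c * (((-dirichletEigenvalue n) ^ (-β) : ℝ) : ℂ))) (by
    have h1 := (summable_pnat_rpow (p := 2 - 4 * β) (by linarith)).mul_left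
      (2 * Real.pi ^ 2 * ‖c‖ ^ 2 * (Real.pi ^ (2 * -β)) ^ 2)
    refine h1.congr fun n => ?_
    have hn : (0 : ℝ) < n := by exact_mod_cast n.pos
    have h2 : (n : ℝ) ^ (2 - 4 * β) = (n : ℝ) ^ 2 * ((n : ℝ) ^ (2 * -β)) ^ 2 := by
      rw [← Real.rpow_natCast, ← Real.rpow_natCast, ← Real.rpow_mul hn.le, ← Real.rpow_add hn]
      congr 1
      push_cast
      ring
    rw [norm_mul, mul_pow, norm_sq_dirichletCoeff, norm_mul, mul_pow, Complex.norm_real,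
      Real.norm_eq_abs, sq_abs, neg_dirichletEigenvalue_rpow, h2]
    ring)
  refine ⟨(extrapEquiv R hd).symm.toContinuousLinearEquiv.toContinuousLinearMap.comp
    (D.comp (extrapEquiv J hdJ).toContinuousLinearEquiv.toContinuousLinearMap), fun x => ?_,
    fun x y hxy => ?_, (extrapEquiv J hdJ).symm.toContinuousLinearEquiv.toContinuousLinearMap.comp
    (ContinuousLinearMap.toSpanSingleton ℂ w), fun z => ?_⟩
  · refine (extrapEquiv R hd).injective ?_
    refine ((extrapEquiv R hd).apply_symm_apply _).trans ?_
    change D (extrapEquiv J hdJ (extrapEmbed J x)) = _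
    rw [extrapEquiv_embed, extrapEquiv_embed]
    refine dirichletBasis.ext_repr fun n => ?_
    rw [hD, hJ, hR, mul_assoc, inv_mul_cancel_left₀ (hm n)]
  · exact (extrapEquiv J hdJ).injective (hD.injective hDm ((extrapEquiv R hd).symm.injective hxy))
  · refine (extrapEquiv R hd).injective ?_
    refine ((extrapEquiv R hd).apply_symm_apply _).trans ?_
    change D (extrapEquiv J hdJ ((extrapEquiv J hdJ).symm (z • w))) = _
    rw [LinearIsometryEquiv.apply_symm_apply, extrapEquiv_controlOperator, map_smul]
    congr 1
    refine dirichletBasis.ext_repr fun n => ?_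
    rw [hD, hw, repr_controlState hs hR]
    have h1 := mul_inv_cancel₀ (hm n)
    linear_combination ((dirichletCoeff n : ℂ) * (s - (dirichletEigenvalue n : ℂ))⁻¹) * h1

/-! ### Admissibility -/

section Admissible

variable {s : ℂ} {R : HeatState →L[ℂ] HeatState}
  (hs : ∀ n : ℕ+, s - (dirichletEigenvalue n : ℂ) ≠ 0)
  (hR : dirichletBasis.IsDiag R (fun n => (s - (dirichletEigenvalue n : ℂ))⁻¹))
  (hd : DenseRange R) {T : ℝ → HeatState →L[ℂ] HeatState} (hT : IsC0Semigroup T)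
  (hg : Generates dirichletLaplacian T)

/-- The convolution `∫_0^t e^(λ_n (t - τ)) u(τ) dτ`. -/
def modeIntegral (n : ℕ+) (t : ℝ) (u : ℝ → ℂ) : ℂ :=
  ∫ τ in Icc 0 t, Complex.exp ((dirichletEigenvalue n : ℂ) * (t - τ : ℝ)) * u τ

include hs hR hT hg in
-- The isometry carries the `X₋₁`-valued integral to `∫ u(τ) T(t - τ) controlState dτ` in `X`. Both
-- sides then have the factor `(s - λ_n)⁻¹` in coordinate `n`, which cancels.
theorem extrapEmbed_eq_integral_iff {t : ℝ} {u : ℝ → ℂ}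
    (hu : IntegrableOn u (Icc 0 t)) (x : HeatState) :
    extrapEmbed R x = ∫ τ in Icc 0 t, extrapExtend R (T (t - τ)) (controlOperator s R hd (u τ)) ↔
      ∀ n, dirichletBasis.repr x n = dirichletCoeff n * modeIntegral n t u := by
  have hTd : ∀ τ ∈ Icc 0 t, dirichletBasis.IsDiag (T (t - τ))
      (fun n => Complex.exp ((dirichletEigenvalue n : ℂ) * (t - τ : ℝ))) := fun τ hτ =>
    HilbertBasis.isDiag_of_generates isDiagonalOperator_dirichletLaplacian hT hg
      (sub_nonneg.2 hτ.2)
  have h1 : extrapEquiv R hd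
      (∫ τ in Icc 0 t, extrapExtend R (T (t - τ)) (controlOperator s R hd (u τ))) =
      ∫ τ in Icc 0 t, u τ • T (t - τ) (controlState s R) := by
    rw [← LinearIsometryEquiv.coe_toContinuousLinearEquiv,
      ← ContinuousLinearEquiv.integral_comp_comm]
    refine setIntegral_congr_fun measurableSet_Icc fun τ hτ => ?_
    change extrapEquiv R hd _ = _
    rw [extrapEquiv_extend hd ((hTd τ hτ).comm hR), extrapEquiv_controlOperator, map_smul]
  have hcont : ContinuousOn (fun τ => T (t - τ) (controlState s R)) (Icc 0 t) :=
    (hT.continuousOn (controlState s R)).comp (by fun_prop) fun τ hτ => sub_nonneg.2 hτ.2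
  have hint : IntegrableOn (fun τ => u τ • T (t - τ) (controlState s R)) (Icc 0 t) :=
    hu.smul_continuousOn hcont isCompact_Icc
  have h2 : ∀ n, dirichletBasis.repr (∫ τ in Icc 0 t, u τ • T (t - τ) (controlState s R)) n =
      (s - (dirichletEigenvalue n : ℂ))⁻¹ * (dirichletCoeff n * modeIntegral n t u) := by
    intro n
    have h3 := (innerSL ℂ (dirichletBasis n)).integral_comp_comm hint
    have h4 : ∀ x, innerSL ℂ (dirichletBasis n) x = dirichletBasis.repr x n := fun x =>
      (dirichletBasis.repr_apply_apply _ _).symm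
    simp only [h4] at h3
    rw [← h3, modeIntegral, ← integral_const_mul, ← integral_const_mul]
    refine setIntegral_congr_fun measurableSet_Icc fun τ hτ => ?_
    dsimp only
    rw [dirichletBasis.repr_smul_apply, hTd τ hτ, repr_controlState hs hR]
    ring
  rw [← (extrapEquiv R hd).injective.eq_iff, h1, extrapEquiv_embed]
  constructor
  · intro h n
    have h5 := h2 n
    rw [← h, hR] at h5
    exact mul_left_cancel₀ (inv_ne_zero (hs n)) h5
  · intro h
    refine dirichletBasis.ext_repr fun n => ?_
    rw [h2, hR, h]

/-- The bound does not depend on `t`; this is the source of infinite-time admissibility. -/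
theorem lintegral_exp_le {a t : ℝ} (ha : 0 < a) (ht : 0 ≤ t) :
    ∫⁻ τ in Icc 0 t, ENNReal.ofReal (Real.exp (-(a * (t - τ)))) ≤ ENNReal.ofReal a⁻¹ := by
  have hc : Continuous fun τ : ℝ => Real.exp (-(a * (t - τ))) := by fun_prop
  rw [← ofReal_integral_eq_lintegral_ofReal hc.continuousOn.integrableOn_Icc
    (Eventually.of_forall fun τ => (Real.exp_pos _).le)]
  refine ENNReal.ofReal_le_ofReal ?_
  have hd : ∀ τ ∈ uIcc (0 : ℝ) t, HasDerivAt (fun τ => Real.exp (-(a * (t - τ))) / a)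
      (Real.exp (-(a * (t - τ)))) τ := by
    intro τ _
    have h1 := ((((hasDerivAt_id τ).const_sub t).const_mul a).neg).exp.div_const a
    refine h1.congr_deriv ?_
    simp only [Pi.neg_apply, id]
    field_simp
  rw [integral_Icc_eq_integral_Ioc, ← intervalIntegral.integral_of_le ht,
    intervalIntegral.integral_eq_sub_of_hasDerivAt hd (hc.intervalIntegrable _ _)]
  simp only [sub_self, mul_zero, neg_zero, Real.exp_zero, one_div]
  have : 0 ≤ Real.exp (-(a * (t - 0))) / a := by positivity
  linarith

theorem norm_cexp_dirichletEigenvalue (n : ℕ+) (r : ℝ) :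
    ‖Complex.exp ((dirichletEigenvalue n : ℂ) * r)‖ = Real.exp (dirichletEigenvalue n * r) := by
  rw [← Complex.ofReal_mul, Complex.norm_exp_ofReal]

/-- Hölder, with the `L^q` norm of the exponential at most `(q |λ_n|)^(-1/q)`; the factor `q ≥ 1` is
discarded. -/
theorem norm_modeIntegral_le {p q : ℝ≥0∞} [hpq : q.HolderConjugate p] (hq1 : 1 ≤ q)
    (hq : q ≠ ⊤) (n : ℕ+) {t : ℝ} (ht : 0 ≤ t) {u : ℝ → ℂ}
    (hu : MemLp u p (volume.restrict (Icc 0 t))) :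
    ‖modeIntegral n t u‖ ≤ (-dirichletEigenvalue n) ^ (-q.toReal⁻¹) *
      (eLpNorm u p (volume.restrict (Icc 0 t))).toReal := by
  have hx : 0 < -dirichletEigenvalue n := neg_pos.2 (dirichletEigenvalue_neg n)
  have hq1' : 1 ≤ q.toReal := by
    simpa using (ENNReal.toReal_le_toReal ENNReal.one_ne_top hq).2 hq1
  have hq0 : 0 < q.toReal := one_pos.trans_le hq1'
  set f : ℝ → ℂ := fun τ => Complex.exp ((dirichletEigenvalue n : ℂ) * (t - τ : ℝ)) with hf
  have hfc : Continuous f := by fun_prop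
  have h1 : eLpNorm (f • u) 1 (volume.restrict (Icc 0 t)) ≤
      eLpNorm f q (volume.restrict (Icc 0 t)) * eLpNorm u p (volume.restrict (Icc 0 t)) :=
    eLpNorm_smul_le_mul_eLpNorm hu.1 hfc.aestronglyMeasurable
  have h2 : eLpNorm f q (volume.restrict (Icc 0 t)) ≤
      ENNReal.ofReal ((-dirichletEigenvalue n) ^ (-q.toReal⁻¹)) := by
    rw [eLpNorm_eq_lintegral_rpow_enorm_toReal (one_pos.trans_le hq1).ne' hq]
    have h3 : ∀ τ, ‖f τ‖ₑ ^ q.toReal = ENNReal.ofReal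
        (Real.exp (-((q.toReal * -dirichletEigenvalue n) * (t - τ)))) := by
      intro τ
      rw [← ofReal_norm, hf, norm_cexp_dirichletEigenvalue,
        ENNReal.ofReal_rpow_of_pos (Real.exp_pos _), ← Real.exp_mul]
      congr 2
      ring
    simp only [h3]
    rw [Real.rpow_neg hx.le, ← Real.inv_rpow hx.le,
      ← ENNReal.ofReal_rpow_of_pos (inv_pos.2 hx), one_div]
    refine ENNReal.rpow_le_rpow ((lintegral_exp_le (by positivity) ht).trans ?_)
      (inv_nonneg.2 hq0.le)
    exact ENNReal.ofReal_le_ofReal (inv_anti₀ hx (le_mul_of_one_le_left hx.le hq1'))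
  have h4 : ‖modeIntegral n t u‖ₑ ≤ ENNReal.ofReal ((-dirichletEigenvalue n) ^ (-q.toReal⁻¹)) *
      eLpNorm u p (volume.restrict (Icc 0 t)) := by
    refine (enorm_integral_le_lintegral_enorm _).trans ?_
    rw [eLpNorm_one_eq_lintegral_enorm] at h1
    exact h1.trans (mul_le_mul_left h2 _)
  have h5 := ENNReal.toReal_mono (ENNReal.mul_ne_top ENNReal.ofReal_ne_top hu.2.ne) h4
  rwa [ENNReal.toReal_mul, ENNReal.toReal_ofReal (Real.rpow_nonneg hx.le _), toReal_enorm] at h5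

include hs hR hT hg in
theorem infiniteTimeAdmissible_controlOperator {p : ℝ≥0∞} (hp : 4 < p) :
    InfiniteTimeAdmissible T R (controlOperator s R hd) p := by
  have hp1 : 1 ≤ p := le_trans (by norm_num) hp.le
  set q := p.conjExponent
  have hpq : p.HolderConjugate q := ENNReal.HolderConjugate.conjExponent hp1
  have : q.HolderConjugate p := hpq.symm
  -- The conjugate exponent is `q = 1 + (p - 1)⁻¹`, so `p > 4` becomes `q < 4/3`; the case `p = ∞`
  -- gives `q = 1` and is included.
  have h1 : (p - 1)⁻¹ < 3⁻¹ := by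
    rw [ENNReal.inv_lt_inv, lt_tsub_iff_right]
    norm_num
    exact hp
  have hq1 : 1 ≤ q := le_self_add
  have hq : q ≠ ⊤ := ENNReal.add_ne_top.2 ⟨ENNReal.one_ne_top, (h1.trans_le le_top).ne⟩
  have hq2 : q.toReal < 4 / 3 := by
    have h2 : q.toReal = 1 + ((p - 1)⁻¹).toReal :=
      ENNReal.toReal_add ENNReal.one_ne_top (h1.trans_le le_top).ne
    have h3 := (ENNReal.toReal_lt_toReal (h1.trans_le le_top).ne (by simp)).2 h1
    have h4 : ((3 : ℝ≥0∞)⁻¹).toReal = 1 / 3 := by simp [ENNReal.toReal_inv]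
    rw [h4] at h3
    linarith
  have hq0 : 0 < q.toReal := ENNReal.toReal_pos (one_pos.trans_le hq1).ne' hq
  have hq3 : 3 / 4 < q.toReal⁻¹ := by
    rw [lt_inv_comm₀ (by norm_num) hq0]
    norm_num
    exact hq2
  have hsum : Summable fun n : ℕ+ =>
      (‖(dirichletCoeff n : ℂ)‖ * (-dirichletEigenvalue n) ^ (-q.toReal⁻¹)) ^ 2 := by
    have h2 := (summable_pnat_rpow (p := 2 - 4 * q.toReal⁻¹) (by linarith)).mul_left
      (2 * Real.pi ^ 2 * (Real.pi ^ (2 * -q.toReal⁻¹)) ^ 2)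
    refine h2.congr fun n => ?_
    have hn : (0 : ℝ) < n := by exact_mod_cast n.pos
    have h3 : (n : ℝ) ^ (2 - 4 * q.toReal⁻¹) = (n : ℝ) ^ 2 * ((n : ℝ) ^ (2 * -q.toReal⁻¹)) ^ 2 := by
      rw [← Real.rpow_natCast, ← Real.rpow_natCast, ← Real.rpow_mul hn.le, ← Real.rpow_add hn]
      congr 1
      push_cast
      ring
    rw [mul_pow, norm_sq_dirichletCoeff, neg_dirichletEigenvalue_rpow, h3]
    ring
  set S := ∑' n : ℕ+, (‖(dirichletCoeff n : ℂ)‖ * (-dirichletEigenvalue n) ^ (-q.toReal⁻¹)) ^ 2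
  have hS : 0 ≤ S := tsum_nonneg fun n => by positivity
  -- The summand `1` only secures a strictly positive constant.
  refine ⟨Real.sqrt S + 1, by positivity, fun t ht u hu => ?_⟩
  set N := (eLpNorm u p (volume.restrict (Icc 0 t))).toReal
  have hN : 0 ≤ N := ENNReal.toReal_nonneg
  have hb : ∀ n, ‖(dirichletCoeff n : ℂ) * modeIntegral n t u‖ ^ 2 ≤
      (‖(dirichletCoeff n : ℂ)‖ * (-dirichletEigenvalue n) ^ (-q.toReal⁻¹)) ^ 2 * N ^ 2 := by
    intro n
    rw [← mul_pow, norm_mul, mul_assoc]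
    refine pow_le_pow_left₀ (by positivity) ?_ 2
    exact mul_le_mul_of_nonneg_left (norm_modeIntegral_le hq1 hq n ht hu) (norm_nonneg _)
  have hsum2 := hsum.mul_right (N ^ 2)
  obtain ⟨x, hx⟩ := dirichletBasis.exists_repr_eq
    (hsum2.of_nonneg_of_le (fun n => by positivity) hb)
  refine ⟨x, (extrapEmbed_eq_integral_iff hs hR hd hT hg (hu.integrable hp1) x).2 hx, ?_⟩
  have h5 : ‖x‖ ^ 2 ≤ S * N ^ 2 := by
    refine hasSum_le (fun n => ?_) (dirichletBasis.hasSum_norm_sq_repr x)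
      (hsum.hasSum.mul_right (N ^ 2))
    rw [hx]
    exact hb n
  have h6 : ‖x‖ ≤ Real.sqrt S * N := by
    refine le_of_sq_le_sq ?_ (by positivity)
    rwa [mul_pow, Real.sq_sqrt hS]
  exact h6.trans (mul_le_mul_of_nonneg_right (by linarith) hN)

theorem InfiniteTimeAdmissible.finiteTimeAdmissible {X U : Type*} [NormedAddCommGroup X]
    [NormedSpace ℂ X] [NormedAddCommGroup U] [NormedSpace ℂ U] {T : ℝ → X →L[ℂ] X}
    {R : X →L[ℂ] X} {B : U →L[ℂ] ExtrapSpace R} {p : ℝ≥0∞} (h : InfiniteTimeAdmissible T R B p) :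
    FiniteTimeAdmissible T R B p := by
  obtain ⟨C, hC, h⟩ := h
  exact fun t ht => ⟨C, hC, h t ht⟩

/-! ### Failure of admissibility for `p ≤ 4` -/

/-- The input `(1 - τ)^(-1/4)`, cut off at `1 - τ = ε`. -/
def singularInput (ε τ : ℝ) : ℝ := if ε ≤ 1 - τ then (1 - τ) ^ (-(1 / 4) : ℝ) else 0

theorem measurable_singularInput (ε : ℝ) : Measurable (singularInput ε) := by
  refine Measurable.ite (measurableSet_le measurable_const (by fun_prop)) ?_ measurable_const
  exact (measurable_const.sub measurable_id).pow_const _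

theorem singularInput_nonneg {ε : ℝ} (hε : 0 < ε) (τ : ℝ) : 0 ≤ singularInput ε τ := by
  unfold singularInput
  split_ifs with h
  · exact Real.rpow_nonneg (hε.le.trans h) _
  · exact le_rfl

theorem singularInput_le {ε : ℝ} (hε : 0 < ε) (τ : ℝ) :
    singularInput ε τ ≤ ε ^ (-(1 / 4) : ℝ) := by
  unfold singularInput
  split_ifs with h
  · exact Real.rpow_le_rpow_of_nonpos hε h (by norm_num)
  · exact Real.rpow_nonneg hε.le _

theorem memLp_singularInput {ε : ℝ} (hε : 0 < ε) (p : ℝ≥0∞) :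
    MemLp (fun τ => (singularInput ε τ : ℂ)) p (volume.restrict (Icc 0 1)) := by
  refine MemLp.of_bound ((Complex.measurable_ofReal.comp
    (measurable_singularInput ε)).aestronglyMeasurable) (ε ^ (-(1 / 4) : ℝ))
    (Eventually.of_forall fun τ => ?_)
  rw [Complex.norm_real, Real.norm_of_nonneg (singularInput_nonneg hε τ)]
  exact singularInput_le hε τ

/-- On a probability space the `L^p` norm is at most the `L⁴` norm, and the fourth power of the
input is `(1 - τ)⁻¹` on `[0, 1 - ε]`. -/
theorem eLpNorm_singularInput_le {ε : ℝ} (hε : 0 < ε) (hε1 : ε ≤ 1) {p : ℝ≥0∞} (hp : p ≤ 4) :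
    (eLpNorm (fun τ => (singularInput ε τ : ℂ)) p (volume.restrict (Icc 0 1))).toReal ^ 4 ≤
      Real.log ε⁻¹ := by
  have h0 := memLp_singularInput hε 4
  have h1 : (eLpNorm (fun τ => (singularInput ε τ : ℂ)) p (volume.restrict (Icc 0 1))).toReal ≤
      (eLpNorm (fun τ => (singularInput ε τ : ℂ)) 4 (volume.restrict (Icc 0 1))).toReal :=
    ENNReal.toReal_mono h0.2.ne (eLpNorm_le_eLpNorm_of_exponent_le hp h0.1)
  refine (pow_le_pow_left₀ ENNReal.toReal_nonneg h1 4).trans ?_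
  have h2 : eLpNorm (fun τ => (singularInput ε τ : ℂ)) 4 (volume.restrict (Icc 0 1)) ^ 4 =
      ∫⁻ τ in Icc (0 : ℝ) 1, ENNReal.ofReal (singularInput ε τ ^ 4) := by
    have h3 := eLpNorm_nnreal_pow_eq_lintegral (μ := volume.restrict (Icc (0 : ℝ) 1))
      (f := fun τ => (singularInput ε τ : ℂ)) (p := 4) (by norm_num)
    simp only [NNReal.coe_ofNat, ENNReal.coe_ofNat, ENNReal.rpow_ofNat] at h3
    refine h3.trans (lintegral_congr fun τ => ?_)
    rw [← ofReal_norm, Complex.norm_real,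
      Real.norm_of_nonneg (singularInput_nonneg hε τ),
      ENNReal.ofReal_pow (singularInput_nonneg hε τ)]
  have h4 : ∀ τ, τ ∈ Icc (0 : ℝ) 1 → ENNReal.ofReal (singularInput ε τ ^ 4) =
      (Icc 0 (1 - ε)).indicator (fun τ => ENNReal.ofReal (1 - τ)⁻¹) τ := by
    intro τ hτ
    by_cases h : ε ≤ 1 - τ
    · rw [indicator_of_mem (show τ ∈ Icc 0 (1 - ε) from ⟨hτ.1, by linarith⟩), singularInput, if_pos h, ← Real.rpow_natCast,
        ← Real.rpow_mul (hε.le.trans h)]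
      norm_num
      rw [Real.rpow_neg_one]
    · rw [indicator_of_notMem (fun hh => h (by linarith [hh.2])), singularInput, if_neg h]
      simp
  have hc : ContinuousOn (fun τ : ℝ => (1 - τ)⁻¹) (Icc 0 (1 - ε)) :=
    ContinuousOn.inv₀ (by fun_prop) fun τ hτ => by have := hτ.2; intro h; linarith
  have h5 : ∫⁻ τ in Icc (0 : ℝ) 1, ENNReal.ofReal (singularInput ε τ ^ 4) ≤
      ENNReal.ofReal (Real.log ε⁻¹) := by
    rw [setLIntegral_congr_fun measurableSet_Icc h4]
    refine (setLIntegral_le_lintegral _ _).trans ?_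
    rw [lintegral_indicator measurableSet_Icc, ← ofReal_integral_eq_lintegral_ofReal
      hc.integrableOn_Icc ?_]
    · refine ENNReal.ofReal_le_ofReal (le_of_eq ?_)
      have hd : ∀ τ ∈ uIcc (0 : ℝ) (1 - ε), HasDerivAt (fun τ => -Real.log (1 - τ))
          ((1 - τ)⁻¹) τ := by
        intro τ hτ
        rw [uIcc_of_le (by linarith)] at hτ
        have h6 := (((hasDerivAt_id τ).const_sub 1).log (by
          have := hτ.2
          simp only [id]
          intro h
          linarith)).neg
        refine h6.congr_deriv ?_
        simp [neg_div]
      rw [integral_Icc_eq_integral_Ioc, ← intervalIntegral.integral_of_le (by linarith),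
        intervalIntegral.integral_eq_sub_of_hasDerivAt hd
          (ContinuousOn.intervalIntegrable (by rwa [uIcc_of_le (by linarith)]))]
      simp [Real.log_inv]
    · filter_upwards [ae_restrict_mem measurableSet_Icc] with τ hτ
      exact inv_nonneg.2 (by linarith [hτ.2])
  rw [← ENNReal.toReal_pow, h2]
  exact ENNReal.toReal_le_of_le_ofReal (Real.log_nonneg ((one_le_inv₀ hε).2 hε1)) h5

/-- The integrand is nonnegative, so only `1 - τ ∈ [a/4, a]` is kept, where `a = n⁻²` is the time
scale of the mode. There the exponential is at least `e^(-π²)` and the input at least `a^(-1/4) =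
n^(1/2)`; the length is `3a/4`. The cutoff `1/(4M²)` stays below `a/4` for every `n ≤ M`. -/
theorem le_norm_modeIntegral_singularInput {M : ℕ} {n : ℕ+} (hn : (n : ℕ) ≤ M) :
    3 / 4 * Real.exp (-Real.pi ^ 2) * (((n : ℝ) ^ 2)⁻¹ * ((n : ℝ) ^ (1 / 2 : ℝ))) ≤
      ‖modeIntegral n 1 (fun τ => (singularInput (4 * (M : ℝ) ^ 2)⁻¹ τ : ℂ))‖ := by
  have hn0 : (0 : ℝ) < n := by exact_mod_cast n.pos
  have hn1 : (1 : ℝ) ≤ n := by exact_mod_cast n.pos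
  have hnM : (n : ℝ) ≤ M := by exact_mod_cast hn
  have hM0 : (0 : ℝ) < M := hn0.trans_le hnM
  set ε : ℝ := (4 * (M : ℝ) ^ 2)⁻¹ with hεdef
  have hε : 0 < ε := by positivity
  set a : ℝ := ((n : ℝ) ^ 2)⁻¹ with hadef
  have ha0 : 0 < a := by positivity
  have ha1 : a ≤ 1 := inv_le_one_of_one_le₀ (one_le_pow₀ hn1)
  have hεa : ε ≤ a / 4 := by
    rw [hεdef, hadef, inv_div_left]
    refine inv_anti₀ (by positivity) ?_
    nlinarith
  set F : ℝ → ℝ := fun τ => Real.exp (dirichletEigenvalue n * (1 - τ)) * singularInput ε τ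
  have hF : modeIntegral n 1 (fun τ => (singularInput ε τ : ℂ)) =
      ((∫ τ in Icc (0 : ℝ) 1, F τ : ℝ) : ℂ) := by
    rw [modeIntegral, ← integral_complex_ofReal]
    refine integral_congr_ae (Eventually.of_forall fun τ => ?_)
    simp only [F]
    push_cast
    rfl
  have hF0 : ∀ τ, 0 ≤ F τ := fun τ => mul_nonneg (Real.exp_pos _).le (singularInput_nonneg hε τ)
  have hFi : IntegrableOn F (Icc 0 1) := by
    refine IntegrableOn.continuousOn_mul (by fun_prop) ?_ isCompact_Icc
    exact ((memLp_singularInput hε 1).integrable le_rfl).re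
  have hsub : Icc (1 - a) (1 - a / 4) ⊆ Icc (0 : ℝ) 1 :=
    Icc_subset_Icc (by linarith) (by linarith)
  have h1 : ∀ τ ∈ Icc (1 - a) (1 - a / 4),
      Real.exp (-Real.pi ^ 2) * (n : ℝ) ^ (1 / 2 : ℝ) ≤ F τ := by
    intro τ hτ
    have hτ1 : 1 - τ ≤ a := by linarith [hτ.1]
    have hτ2 : a / 4 ≤ 1 - τ := by linarith [hτ.2]
    have hτ0 : 0 < 1 - τ := by linarith
    refine mul_le_mul ?_ ?_ (Real.rpow_nonneg hn0.le _) (Real.exp_pos _).le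
    · refine Real.exp_le_exp.2 ?_
      have h2 : dirichletEigenvalue n * a = -Real.pi ^ 2 := by
        rw [dirichletEigenvalue, hadef]
        field_simp
      rw [← h2]
      exact mul_le_mul_of_nonpos_left hτ1 (dirichletEigenvalue_neg n).le
    · rw [singularInput, if_pos (hεa.trans hτ2)]
      have h2 : (n : ℝ) ^ (1 / 2 : ℝ) = a ^ (-(1 / 4) : ℝ) := by
        rw [hadef, Real.inv_rpow (by positivity), ← Real.rpow_natCast, ← Real.rpow_mul hn0.le,
          ← Real.rpow_neg hn0.le]
        norm_num
      rw [h2]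
      exact Real.rpow_le_rpow_of_nonpos hτ0 hτ1 (by norm_num)
  have h2 := setIntegral_ge_of_const_le measurableSet_Icc (by simp) h1 (hFi.mono_set hsub)
  have h3 := setIntegral_mono_set hFi (Eventually.of_forall hF0) hsub.eventuallyLE
  have h4 : volume.real (Icc (1 - a) (1 - a / 4)) = 3 / 4 * a := by
    rw [measureReal_def, Real.volume_Icc, ENNReal.toReal_ofReal (by linarith)]
    ring
  rw [h4, smul_eq_mul] at h2
  rw [hF, Complex.norm_real]
  refine le_trans (le_of_eq ?_) ((h2.trans h3).trans (le_abs_self _))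
  ring

include hs hR hT hg in
theorem not_finiteTimeAdmissible_controlOperator {p : ℝ≥0∞} (hp1 : 1 ≤ p) (hp : p ≤ 4) :
    ¬ FiniteTimeAdmissible T R (controlOperator s R hd) p := by
  intro h
  obtain ⟨C, hC, h⟩ := h 1 zero_le_one
  -- The product of `|b_n|²/n² = 2π²` with the squared constant of the mode estimate: mode `n`
  -- contributes at least `κ/n` to `‖x‖²`.
  set κ : ℝ := 2 * Real.pi ^ 2 * (3 / 4 * Real.exp (-Real.pi ^ 2)) ^ 2 with hκdef
  have hκ : 0 < κ := by have := Real.pi_pos; positivity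
  have key : ∀ M : ℕ, 1 ≤ M → (κ * Real.log (M + 1)) ^ 2 ≤ C ^ 4 * (4 * Real.log (M + 1)) := by
    intro M hM
    have hM1 : (1 : ℝ) ≤ M := by exact_mod_cast hM
    set ε : ℝ := (4 * (M : ℝ) ^ 2)⁻¹ with hεdef
    have hε : 0 < ε := by positivity
    have hε1 : ε ≤ 1 := inv_le_one_of_one_le₀ (by nlinarith)
    have hu := memLp_singularInput hε p
    obtain ⟨x, hx1, hx2⟩ := h _ hu
    have hx := (extrapEmbed_eq_integral_iff hs hR hd hT hg (hu.integrable hp1) x).1 hx1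
    have hlow : κ * Real.log (M + 1) ≤ ‖x‖ ^ 2 := by
      -- Only the modes `1, …, M` are kept; their contributions form `κ` times a harmonic sum, at
      -- least `κ log(M + 1)`.
      have h1 := sum_le_hasSum ((Finset.range M).map ⟨Nat.succPNat, Nat.succPNat_injective⟩)
        (fun n _ => by positivity) (dirichletBasis.hasSum_norm_sq_repr x)
      refine le_trans ?_ h1
      rw [Finset.sum_map]
      have h2 := log_add_one_le_harmonic M
      rw [harmonic] at h2
      push_cast at h2
      refine (mul_le_mul_of_nonneg_left h2 hκ.le).trans ?_
      rw [Finset.mul_sum]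
      refine Finset.sum_le_sum fun i hi => ?_
      have h3 := le_norm_modeIntegral_singularInput (M := M) (n := Nat.succPNat i)
        (Finset.mem_range.1 hi)
      have hc : ((Nat.succPNat i : ℕ+) : ℝ) = (i : ℝ) + 1 := by
        simp [Nat.succPNat_coe]
      have hi0 : (0 : ℝ) < (i : ℝ) + 1 := by positivity
      rw [hc] at h3
      have h4 := pow_le_pow_left₀ (by positivity) h3 2
      simp only [Function.Embedding.coeFn_mk]
      rw [hx, norm_mul, mul_pow, norm_sq_dirichletCoeff, hc]
      refine le_trans (le_of_eq ?_) (mul_le_mul_of_nonneg_left h4 (by positivity))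
      have h5 : (((i : ℝ) + 1) ^ (1 / 2 : ℝ)) ^ 2 = (i : ℝ) + 1 := by
        rw [← Real.rpow_natCast, ← Real.rpow_mul hi0.le]
        norm_num
      rw [hκdef, mul_pow _ (_ * _), mul_pow _ (((i : ℝ) + 1) ^ (1 / 2 : ℝ)), h5]
      field_simp
    have hup : ‖x‖ ^ 4 ≤ C ^ 4 * Real.log ε⁻¹ := by
      refine (pow_le_pow_left₀ (norm_nonneg _) hx2 4).trans ?_
      rw [mul_pow]
      exact mul_le_mul_of_nonneg_left (eLpNorm_singularInput_le hε hε1 hp) (by positivity)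
    -- `4M² ≤ (M + 1)⁴` expresses both bounds in the same logarithm.
    have hlog : Real.log ε⁻¹ ≤ 4 * Real.log (M + 1) := by
      rw [hεdef, inv_inv, show (4 : ℝ) * Real.log (M + 1) = Real.log (((M : ℝ) + 1) ^ 4) by
        rw [Real.log_pow]; norm_num]
      refine Real.log_le_log (by positivity) ?_
      have h6 : 2 * (M : ℝ) ≤ ((M : ℝ) + 1) ^ 2 := by nlinarith
      calc 4 * (M : ℝ) ^ 2 = (2 * (M : ℝ)) ^ 2 := by ring
        _ ≤ (((M : ℝ) + 1) ^ 2) ^ 2 := pow_le_pow_left₀ (by positivity) h6 2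
        _ = _ := by ring
    have hl0 : 0 ≤ Real.log ((M : ℝ) + 1) := Real.log_nonneg (by linarith)
    calc (κ * Real.log (M + 1)) ^ 2 ≤ (‖x‖ ^ 2) ^ 2 :=
          pow_le_pow_left₀ (by positivity) hlow 2
      _ = ‖x‖ ^ 4 := by ring
      _ ≤ _ := hup.trans (mul_le_mul_of_nonneg_left hlog (by positivity))
  have hlim : Tendsto (fun M : ℕ => Real.log ((M : ℝ) + 1)) atTop atTop :=
    Real.tendsto_log_atTop.comp
      (tendsto_atTop_add_const_right _ _ tendsto_natCast_atTop_atTop)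
  -- Dividing `key` by `log(M + 1)` would bound this logarithm by `4C⁴/κ²`.
  obtain ⟨M, hM1, hM2⟩ := ((hlim.eventually_gt_atTop (4 * C ^ 4 / κ ^ 2)).and
    (eventually_ge_atTop 1)).exists
  have h1 := key M hM2
  have hl : 0 < Real.log ((M : ℝ) + 1) := Real.log_pos (by
    have : (1 : ℝ) ≤ M := by exact_mod_cast hM2
    linarith)
  rw [div_lt_iff₀ (by positivity)] at hM1
  nlinarith

end Admissible

end

/-! ### Assembly of the theorem -/

theorem mainTheorem7 :
    -- the Dirichlet controlled heat equation is a boundary control system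
    IsBoundaryControlSystem heatMax heatTrace ∧
    -- diagonal representation of `A`
    (Orthonormal ℂ dirichletMode ∧
      (Submodule.span ℂ (Set.range dirichletMode)).topologicalClosure = ⊤ ∧
      ∀ n : ℕ+, (dirichletMode n, (dirichletEigenvalue n : ℂ) • dirichletMode n) ∈
        dirichletLaplacian.graph) ∧
    (0 : ℂ) ∈ unboundedResolventSet dirichletLaplacian ∧
    -- the semigroup `T` generated by `A`, and the space `X₋₁` formed with any `s ∈ ρ(A)`
    ∀ T : ℝ → HeatState →L[ℂ] HeatState, IsC0Semigroup T → Generates dirichletLaplacian T →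
    ∀ s ∈ unboundedResolventSet dirichletLaplacian,
    ∃ B : ℂ →L[ℂ] ExtrapSpace (resolventOp dirichletLaplacian s),
      -- `B` is the control operator of the system, and the only one
      (∀ B' : ℂ →L[ℂ] ExtrapSpace (resolventOp dirichletLaplacian s),
        IsControlOperator heatMax heatTrace (resolventOp dirichletLaplacian s) B' ↔ B' = B) ∧
      -- `B = δ'_1`, represented by the sequence `b_n`
      IsDeltaPrimeOne (resolventOp dirichletLaplacian s) B ∧
      HasSum (fun n : ℕ+ => (dirichletCoeff n : ℂ) •
        extrapEmbed (resolventOp dirichletLaplacian s) (dirichletMode n)) (B 1) ∧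
      -- `B` maps into `X_{-β}` for all `β > 3/4`
      (∀ φ : ℝ, 0 < φ → φ ≤ Real.pi / 2 → ∀ β : ℝ, 3 / 4 < β → β < 1 →
        MapsIntoExtrap (resolventOp dirichletLaplacian s)
          (negFracPow dirichletLaplacian φ β) B) ∧
      -- `B` is `p`-admissible for all `p > 4`
      (∀ p : ℝ≥0∞, 4 < p →
        FiniteTimeAdmissible T (resolventOp dirichletLaplacian s) B p ∧
        InfiniteTimeAdmissible T (resolventOp dirichletLaplacian s) B p) ∧
      -- `B` is not `p`-admissible for any `p ≤ 4`
      (∀ p : ℝ≥0∞, 1 ≤ p → p ≤ 4 →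
        ¬ FiniteTimeAdmissible T (resolventOp dirichletLaplacian s) B p ∧
        ¬ InfiniteTimeAdmissible T (resolventOp dirichletLaplacian s) B p) := by
  refine ⟨isBoundaryControlSystem_heat, ⟨orthonormal_dirichletMode,
    span_dirichletMode_topologicalClosure, fun n => ?_⟩,
    zero_mem_unboundedResolventSet_dirichletLaplacian, fun T hT hg s hsρ => ?_⟩
  · rw [← dirichletBasis_apply]
    exact isDiagonalOperator_dirichletLaplacian.basis_mem_graph n
  · obtain ⟨hs, hR⟩ := isDiagonalOperator_dirichletLaplacian.isDiag_resolventOp hsρ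
    have hd := hR.denseRange fun n => inv_ne_zero (hs n)
    refine ⟨controlOperator s _ hd, isControlOperator_iff hs hR hd,
      isDeltaPrimeOne_controlOperator hs hR hd, hasSum_controlOperator hs hR hd,
      fun φ hφ hφ' β hβ hβ' => mapsIntoExtrap_controlOperator hs hR hd hφ hφ' hβ hβ',
      fun p hp => ?_, fun p hp1 hp => ?_⟩
    · have h := infiniteTimeAdmissible_controlOperator hs hR hd hT hg hp
      exact ⟨h.finiteTimeAdmissible, h⟩
    · have h := not_finiteTimeAdmissible_controlOperator hs hR hd hT hg hp1 hp
      exact ⟨h, fun h' => h h'.finiteTimeAdmissible⟩
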